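/- **Theorem 3.1.** Work in Kohlenbach's language of finite types ($0$ is the type of natural numbers, $\sigma\to\tau$ the type of functionals, $1=0\to0$). $\mathsf{RCA}_0^\omega$ consists of the axioms of ordered semi-rings for $0,1,+,\times,<$, the defining axioms of the combinators $\Pi,\Sigma$ and of the recursor $\mathbf R_0$ (primitive recursion of type $0$), the axiom of extensionality at all types, induction for quantifier-free formulas, and $\mathsf{QF\text{-}AC}^{1,0}$. Here $\mathsf{QF\text{-}AC}^{\sigma,\tau}$ is the schema $$(\forall f^\sigma)(\exists g^\tau)\varphi(f,g)\to(\exists\Phi^{\sigma\to\tau})(\forall f^\sigma)\varphi(f,\Phi(f))\qquad(\varphi\text{ quantifier-free, with parameters of any type}).$$ $\mathsf{ACA}_0^\omega$ is $\mathsf{RCA}_0^\omega$ plus $(\exists^2)$: there is $E:\mathbb N^{\mathbb N}\to\{0,1\}$ such that for all $f\in\mathbb N^{\mathbb N}$, $E(f)=0\leftrightarrow(\exists n\in\mathbb N)(f(n)=0)$. Real numbers are fast-converging Cauchy sequences of (coded) rationals; sets are given by characteristic functions; sets of reals and functions on them respect $=_{\mathbb R}$, and sets and functions on a metric space $(M,d)$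 respect its equality $=_M$, where $x=_My\leftrightarrow d(x,y)=_{\mathbb R}0$ (for $M\subset\mathbb R$, $=_M$ is $=_{\mathbb R}$). Open sets are arbitrary sets (given by characteristic functions) that contain a ball, respectively a basic set, around each of their points. A space is connected if it is not the union of two disjoint non-empty open subsets, and a subset is connected if it is so as a subspace. For $A\subset M$, "$A$ is uncountable" means that for every $Y:M\to\mathbb N$ there are $x,y\in A$ with $x\neq_My$ and $Y(x)=Y(y)$. A second-countable space over the reals is a set $X\subset\mathbb R$, with the equality of reals, and a sequence $(B_n)_{n\in\mathbb N}$ of subsets of $X$ that is a basis of a topology: the $B_n$ cover $X$, and if $x\in B_m\cap B_n$, then $x\in B_k\subset B_m\cap B_n$ for some $k$. A space $X$ is functionally Hausdorff if for any distinct $x,y\in X$ there is a continuous $f:X\to[0,1]$ with $f(x)=0$ and $f(y)=1$. The following are equivalent over $\mathsf{ACA}_0^\omega+\mathsf{QF\text{-}AC}^{1,1}$, i.e. in every (possibly non-standard) model of this system: (a) $\mathsf{NIN}_{[0,1]}$: for any $Y:[0,1]\to\mathbb N$ there are $x,y\in[0,1]$ with $x\ne_{\mathbb R}y$ and $Y(x)=Y(y)$.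 (b) For $X\subset\mathbb R$, if there is a surjection $f:X\to[0,1]$, then $X$ is uncountable (as a subset of $\mathbb R$). (c) Let $(M,d)$ be a metric space with $M\subset\mathbb R$ and let $A\subset M$ be connected with at least two points. Then $A$ is uncountable. (d) Let $(M,d)$ be a connected metric space with $M\subset\mathbb R$ and let $f:M\to\mathbb R$ be continuous. If the set $f(M)$ exists and has two distinct elements, it is uncountable. (e) The previous item for continuous $f:M\to M_0$, where $(M_0,d_0)$ is any metric space (whose points are objects of an arbitrary finite type). (f) Let $(M_i,d_i)$ for $i=0,1$ be metric spaces with $M_i\subset\mathbb R$, let $M_0$ be connected with at least two points, and let $f:M_1\to M_0$ be surjective. Then $M_1$ is uncountable. (g) Any connected functionally Hausdorff second-countable space over the reals with at least two points is uncountable. Moreover, $\mathsf{QF\text{-}AC}^{1,1}$ is not needed for item (d): the equivalence of (a) and (d) holds over $\mathsf{ACA}_0^\omega$. -/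

import Mathlib

universe u

namespace HOA

/-! ## The language of finite types -/

/-- Finite types: the type `0` of natural numbers, and function types. -/
inductive FinType where
  | zero : FinType
  | arrow : FinType → FinType → FinType
  deriving DecidableEq

infixr:60 " ⇾ " => FinType.arrow

/-- The type `1 = 0 → 0` of elements of Baire space. -/
abbrev FinType.one : FinType := FinType.zero ⇾ FinType.zero

/-- The constants of the language: `0`, `1`, `+`, `×`, the combinators `Π` and `Σ` (at all types),
and the recursor `R₀` for primitive recursion of type `0`. -/
inductive Cst : FinType → Type where
  | zero : Cst FinType.zero
  | one : Cst FinType.zero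
  | add : Cst (FinType.zero ⇾ FinType.zero ⇾ FinType.zero)
  | mul : Cst (FinType.zero ⇾ FinType.zero ⇾ FinType.zero)
  | combK (σ τ : FinType) : Cst (σ ⇾ τ ⇾ σ)
  | combS (ρ σ τ : FinType) : Cst ((ρ ⇾ σ ⇾ τ) ⇾ (ρ ⇾ σ) ⇾ ρ ⇾ τ)
  | recursor : Cst ((FinType.zero ⇾ FinType.zero ⇾ FinType.zero) ⇾
      FinType.zero ⇾ FinType.zero ⇾ FinType.zero)

/-- Terms; there are countably many variables of every finite type. -/
inductive Term : FinType → Type where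
  | var (σ : FinType) (i : ℕ) : Term σ
  | cst {σ : FinType} (c : Cst σ) : Term σ
  | app {σ τ : FinType} (s : Term (σ ⇾ τ)) (t : Term σ) : Term τ

/-- Quantifier-free formulas. The prime formulas are equations and inequalities of type `0`;
variables of all finite types may occur. -/
inductive QFFormula where
  | eq (s t : Term FinType.zero) : QFFormula
  | lt (s t : Term FinType.zero) : QFFormula
  | neg (φ : QFFormula) : QFFormula
  | and (φ ψ : QFFormula) : QFFormula
  | or (φ ψ : QFFormula) : QFFormula
  | imp (φ ψ : QFFormula) : QFFormula

/-! ## Structures and satisfaction -/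

/-- A (Henkin, possibly non-standard) structure for the many-sorted language of finite types.
The relation `=₀` is interpreted as equality. -/
structure Str : Type (u + 1) where
  Car : FinType → Type u
  app : {σ τ : FinType} → Car (σ ⇾ τ) → Car σ → Car τ
  cst : {σ : FinType} → Cst σ → Car σ
  lt : Car FinType.zero → Car FinType.zero → Prop

/-- Application of an element of functional type inside a structure. -/
abbrev ap {M : Str.{u}} {σ τ : FinType} (f : M.Car (σ ⇾ τ)) (x : M.Car σ) : M.Car τ := M.app f x

infixl:100 " ⬝ " => ap

/-- The numbers of a structure, i.e. its objects of type `0`. -/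
abbrev Str.N (M : Str.{u}) : Type u := M.Car FinType.zero

instance (M : Str.{u}) : Zero M.N := ⟨M.cst Cst.zero⟩
instance (M : Str.{u}) : One M.N := ⟨M.cst Cst.one⟩
instance (M : Str.{u}) : Add M.N := ⟨fun a b => M.cst Cst.add ⬝ a ⬝ b⟩
instance (M : Str.{u}) : Mul M.N := ⟨fun a b => M.cst Cst.mul ⬝ a ⬝ b⟩
instance (M : Str.{u}) : LT M.N := ⟨fun a b => M.lt a b⟩
instance (M : Str.{u}) : LE M.N := ⟨fun a b => a < b ∨ a = b⟩

/-- Equality of higher type is defined pointwise from `=₀`. -/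
def Str.eqT (M : Str.{u}) : (σ : FinType) → M.Car σ → M.Car σ → Prop
  | FinType.zero, x, y => x = y
  | FinType.arrow σ τ, f, g => ∀ x : M.Car σ, M.eqT τ (f ⬝ x) (g ⬝ x)

/-- Assignments of values to the variables. -/
abbrev Str.Val (M : Str.{u}) : Type u := (p : FinType × ℕ) → M.Car p.1

/-- The assignment `v` with the value of the `i`-th variable of type `σ` changed to `x`. -/
def Str.Val.set {M : Str.{u}} (v : M.Val) (σ : FinType) (i : ℕ) (x : M.Car σ) : M.Val :=
  Function.update v (σ, i) x

def Term.eval (M : Str.{u}) (v : M.Val) : {σ : FinType} → Term σ → M.Car σ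
  | _, Term.var σ i => v (σ, i)
  | _, Term.cst c => M.cst c
  | _, Term.app s t => Term.eval M v s ⬝ Term.eval M v t

def QFFormula.Holds (M : Str.{u}) (v : M.Val) : QFFormula → Prop
  | QFFormula.eq s t => s.eval M v = t.eval M v
  | QFFormula.lt s t => s.eval M v < t.eval M v
  | QFFormula.neg φ => ¬ φ.Holds M v
  | QFFormula.and φ ψ => φ.Holds M v ∧ ψ.Holds M v
  | QFFormula.or φ ψ => φ.Holds M v ∨ ψ.Holds M v
  | QFFormula.imp φ ψ => φ.Holds M v → ψ.Holds M v

/-! ## The axiom systems -/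

/-- The schema `QF-AC^{σ,τ}`:
`(∀ f^σ)(∃ g^τ) φ(f, g) → (∃ Φ^{σ → τ})(∀ f^σ) φ(f, Φ(f))` for quantifier-free `φ`, which may
have further variables (parameters) of any type. Up to renaming of variables, `f` is the variable
number `0` of type `σ` and `g` is the variable number `1` of type `τ`. -/
def Str.QFAC (M : Str.{u}) (σ τ : FinType) : Prop :=
  ∀ (φ : QFFormula) (v : M.Val),
    (∀ f : M.Car σ, ∃ g : M.Car τ, φ.Holds M ((v.set σ 0 f).set τ 1 g)) →
    ∃ Φ : M.Car (σ ⇾ τ), ∀ f : M.Car σ, φ.Holds M ((v.set σ 0 f).set τ 1 (Φ ⬝ f))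

/-- `M` is a model of `RCA₀^ω`. -/
structure Str.RCA (M : Str.{u}) : Prop where
  -- the numbers form a (discretely) ordered semi-ring
  add_assoc : ∀ a b c : M.N, a + b + c = a + (b + c)
  add_comm : ∀ a b : M.N, a + b = b + a
  add_zero : ∀ a : M.N, a + 0 = a
  mul_assoc : ∀ a b c : M.N, a * b * c = a * (b * c)
  mul_comm : ∀ a b : M.N, a * b = b * a
  mul_zero : ∀ a : M.N, a * 0 = 0
  mul_one : ∀ a : M.N, a * 1 = a
  mul_add : ∀ a b c : M.N, a * (b + c) = a * b + a * c
  lt_irrefl : ∀ a : M.N, ¬ a < a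
  lt_trans : ∀ a b c : M.N, a < b → b < c → a < c
  lt_trichotomy : ∀ a b : M.N, a < b ∨ a = b ∨ b < a
  zero_lt_one : (0 : M.N) < 1
  zero_le : ∀ a : M.N, 0 ≤ a
  lt_add_one : ∀ a b : M.N, a < b + 1 → a ≤ b
  add_lt_add : ∀ a b c : M.N, a < b → a + c < b + c
  mul_lt_mul : ∀ a b c : M.N, a < b → 0 < c → a * c < b * c
  -- the combinators
  combK : ∀ (σ τ : FinType) (x : M.Car σ) (y : M.Car τ),
    M.eqT σ (M.cst (Cst.combK σ τ) ⬝ x ⬝ y) x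
  combS : ∀ (ρ σ τ : FinType) (x : M.Car (ρ ⇾ σ ⇾ τ)) (y : M.Car (ρ ⇾ σ)) (z : M.Car ρ),
    M.eqT τ (M.cst (Cst.combS ρ σ τ) ⬝ x ⬝ y ⬝ z) (x ⬝ z ⬝ (y ⬝ z))
  -- primitive recursion of type `0`
  rec_zero : ∀ (f : M.Car (FinType.zero ⇾ FinType.zero ⇾ FinType.zero)) (m : M.N),
    M.cst Cst.recursor ⬝ f ⬝ m ⬝ (0 : M.N) = m
  rec_succ : ∀ (f : M.Car (FinType.zero ⇾ FinType.zero ⇾ FinType.zero)) (m n : M.N),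
    M.cst Cst.recursor ⬝ f ⬝ m ⬝ (n + 1) = f ⬝ n ⬝ (M.cst Cst.recursor ⬝ f ⬝ m ⬝ n)
  -- the axiom of extensionality
  ext : ∀ (σ τ : FinType) (φ : M.Car (σ ⇾ τ)) (x y : M.Car σ),
    M.eqT σ x y → M.eqT τ (φ ⬝ x) (φ ⬝ y)
  -- induction for quantifier-free formulas, with parameters
  induction : ∀ (φ : QFFormula) (v : M.Val),
    φ.Holds M (v.set FinType.zero 0 (0 : M.N)) →
    (∀ n : M.N, φ.Holds M (v.set FinType.zero 0 n) → φ.Holds M (v.set FinType.zero 0 (n + 1))) →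
    ∀ n : M.N, φ.Holds M (v.set FinType.zero 0 n)
  -- quantifier-free choice from Baire space to the numbers
  qfac : M.QFAC FinType.one FinType.zero

/-- Kleene's quantifier `∃²` exists. -/
def Str.Exists2 (M : Str.{u}) : Prop :=
  ∃ E : M.Car (FinType.one ⇾ FinType.zero), ∀ f : M.Car FinType.one,
    (E ⬝ f = 0 ∨ E ⬝ f = 1) ∧ (E ⬝ f = 0 ↔ ∃ n : M.N, f ⬝ n = 0)

/-- `M` is a model of `ACA₀^ω`, i.e. of `RCA₀^ω + (∃²)`. -/
structure Str.ACA (M : Str.{u}) : Prop where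
  rca : M.RCA
  exists2 : M.Exists2

/-! ## Rational and real numbers inside a structure -/

/-- The fraction `(pos - neg) / den`. -/
structure Frac (M : Str.{u}) where
  pos : M.N
  neg : M.N
  den : M.N

namespace Frac

variable {M : Str.{u}}

/-- The order (by cross-multiplication; the denominators are positive wherever it is used). -/
def le (q r : Frac M) : Prop :=
  q.pos * r.den + r.neg * q.den ≤ r.pos * q.den + q.neg * r.den

def lt (q r : Frac M) : Prop :=
  q.pos * r.den + r.neg * q.den < r.pos * q.den + q.neg * r.den

def add (q r : Frac M) : Frac M :=
  ⟨q.pos * r.den + r.pos * q.den, q.neg * r.den + r.neg * q.den, q.den * r.den⟩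

instance : LE (Frac M) := ⟨le⟩
instance : LT (Frac M) := ⟨lt⟩
instance : Add (Frac M) := ⟨add⟩
instance : Zero (Frac M) := ⟨⟨0, 0, 1⟩⟩
instance : One (Frac M) := ⟨⟨1, 0, 1⟩⟩

end Frac

section Reals

variable (M : Str.{u})

/-- The usual pairing function of second-order arithmetic. -/
def Str.pair (i j : M.N) : M.N := (i + j) * (i + j) + i

/-- The number `((pos, neg), den)` that codes a fraction. -/
def Str.codeFrac (q : Frac M) : M.N := M.pair (M.pair q.pos q.neg) q.den

open Classical in
/-- The fraction (with positive denominator) coded by a number; numbers that are no codes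
are read as `0`. -/
noncomputable def Str.decode (c : M.N) : Frac M :=
  if h : ∃ q : Frac M, 0 < q.den ∧ M.codeFrac q = c then h.choose else 0

/-- The functional `λ n m. m + m`. -/
def Str.double : M.Car (FinType.zero ⇾ FinType.zero ⇾ FinType.zero) :=
  M.cst (Cst.combK FinType.one FinType.zero) ⬝
    (M.cst (Cst.combS FinType.zero FinType.zero FinType.zero) ⬝ M.cst Cst.add ⬝
      (M.cst (Cst.combS FinType.zero FinType.one FinType.zero) ⬝
        M.cst (Cst.combK FinType.zero FinType.one) ⬝
        M.cst (Cst.combK FinType.zero FinType.zero)))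

/-- The number `2 ^ n`, by primitive recursion. -/
def Str.pow2 (n : M.N) : M.N := M.cst Cst.recursor ⬝ M.double ⬝ (1 : M.N) ⬝ n

/-- The fraction `2 ^ (-n)`. -/
def Str.eps (n : M.N) : Frac M := ⟨1, 0, M.pow2 n⟩

/-- Sequences of fractions. -/
abbrev FSeq : Type u := M.N → Frac M

/-- The sequence of fractions coded by an object of type `1`. -/
noncomputable def Str.seq (x : M.Car FinType.one) : FSeq M := fun n => M.decode (x ⬝ n)

/-- `x` is a real number: a fast-converging Cauchy sequence `(qₙ)` of rationals, that is,
`|qₙ - qₙ₊ᵢ| ≤ 2 ^ (-n)`. -/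
def Str.IsReal (x : M.Car FinType.one) : Prop :=
  ∀ n i : M.N, M.seq x n ≤ M.seq x (n + i) + M.eps n ∧ M.seq x (n + i) ≤ M.seq x n + M.eps n

end Reals

namespace FSeq

variable {M : Str.{u}}

/-- `s < t` for reals: `sₙ + 2 ^ (-n + 1) < tₙ` for some `n`. -/
def Lt (s t : FSeq M) : Prop := ∃ n : M.N, s n + (M.eps n + M.eps n) < t n

/-- `s ≤ t` for reals. -/
def Le (s t : FSeq M) : Prop := ∀ n : M.N, s n ≤ t n + (M.eps n + M.eps n)

/-- Equality of reals: `|sₙ - tₙ| ≤ 2 ^ (-n + 1)` for all `n`. -/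
def Eqv (s t : FSeq M) : Prop := Le s t ∧ Le t s

/-- The sum of two reals, again fast-converging. -/
def add (s t : FSeq M) : FSeq M := fun n => s (n + 1) + t (n + 1)

/-- A rational as a real. -/
def const (q : Frac M) : FSeq M := fun _ => q

/-- `|s - t| < 2 ^ (-k)`. -/
def Close (s t : FSeq M) (k : M.N) : Prop :=
  Lt s (add t (const (M.eps k))) ∧ Lt t (add s (const (M.eps k)))

end FSeq

/-! ## Sets and functions inside a structure -/

/-- A collection of objects of type `ρ` with the equality relation that is considered on it. -/
structure Dom (M : Str.{u}) (ρ : FinType) where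
  mem : M.Car ρ → Prop
  eqv : M.Car ρ → M.Car ρ → Prop

namespace Dom

variable {M : Str.{u}} {ρ τ : FinType}

/-- `F` is (the characteristic function of) a subset of `D`; it respects the equality of `D`. -/
def IsSubset (D : Dom M ρ) (F : M.Car (ρ ⇾ FinType.zero)) : Prop :=
  (∀ x, D.mem x → F ⬝ x = 0 ∨ F ⬝ x = 1) ∧
  ∀ x y, D.mem x → D.mem y → D.eqv x y → F ⬝ x = F ⬝ y

/-- The subset of `D` with characteristic function `F`. -/
def sub (D : Dom M ρ) (F : M.Car (ρ ⇾ FinType.zero)) : Dom M ρ where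
  mem x := D.mem x ∧ F ⬝ x = 1
  eqv := D.eqv

/-- `f` is a function from `D` to `E`; it respects the equalities of `D` and `E`. -/
def IsMap (D : Dom M ρ) (E : Dom M τ) (f : M.Car (ρ ⇾ τ)) : Prop :=
  (∀ x, D.mem x → E.mem (f ⬝ x)) ∧
  ∀ x y, D.mem x → D.mem y → D.eqv x y → E.eqv (f ⬝ x) (f ⬝ y)

def IsSurj (D : Dom M ρ) (E : Dom M τ) (f : M.Car (ρ ⇾ τ)) : Prop :=
  ∀ y, E.mem y → ∃ x, D.mem x ∧ E.eqv (f ⬝ x) y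

/-- There are at least two distinct elements. -/
def TwoPoints (D : Dom M ρ) : Prop := ∃ x y, D.mem x ∧ D.mem y ∧ ¬ D.eqv x y

/-- The natural numbers. -/
def nat (M : Str.{u}) : Dom M FinType.zero where
  mem _ := True
  eqv m n := m = n

/-- The real numbers. -/
def real (M : Str.{u}) : Dom M FinType.one where
  mem x := M.IsReal x
  eqv x y := FSeq.Eqv (M.seq x) (M.seq y)

/-- The unit interval. -/
def unit (M : Str.{u}) : Dom M FinType.one where
  mem x := M.IsReal x ∧ FSeq.Le (FSeq.const 0) (M.seq x) ∧ FSeq.Le (M.seq x) (FSeq.const 1)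
  eqv x y := FSeq.Eqv (M.seq x) (M.seq y)

/-- The part `A` of `D` is uncountable: no `Y : D → ℕ` is injective on `A`. -/
def UncountableIn (D A : Dom M ρ) : Prop :=
  ∀ Y : M.Car (ρ ⇾ FinType.zero), D.IsMap (nat M) Y →
    ∃ x y, A.mem x ∧ A.mem y ∧ ¬ D.eqv x y ∧ Y ⬝ x = Y ⬝ y

/-- `F` is the range of the function `f : D → E`, as a subset of `E`. -/
def IsRange (D : Dom M ρ) (E : Dom M τ) (f : M.Car (ρ ⇾ τ)) (F : M.Car (τ ⇾ FinType.zero)) :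
    Prop :=
  E.IsSubset F ∧ ∀ y, E.mem y → (F ⬝ y = 1 ↔ ∃ x, D.mem x ∧ E.eqv (f ⬝ x) y)

/-- `D` is connected with respect to the given notion of open subset of `D`: it is not the union
of two disjoint non-empty open subsets. -/
def Connected (D : Dom M ρ) (IsOpen : M.Car (ρ ⇾ FinType.zero) → Prop) : Prop :=
  ¬ ∃ U V : M.Car (ρ ⇾ FinType.zero), IsOpen U ∧ IsOpen V ∧
    (∃ x, D.mem x ∧ U ⬝ x = 1) ∧ (∃ x, D.mem x ∧ V ⬝ x = 1) ∧
    (∀ x, D.mem x → U ⬝ x = 1 ∨ V ⬝ x = 1) ∧ ¬ ∃ x, D.mem x ∧ U ⬝ x = 1 ∧ V ⬝ x = 1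

/-! ### Metric spaces -/

/-- `d` is a metric on `D`. -/
structure IsMetric (D : Dom M ρ) (d : M.Car (ρ ⇾ ρ ⇾ FinType.one)) : Prop where
  real : ∀ x y, D.mem x → D.mem y → M.IsReal (d ⬝ x ⬝ y)
  congr : ∀ x x' y y', D.mem x → D.mem x' → D.mem y → D.mem y' → D.eqv x x' → D.eqv y y' →
    FSeq.Eqv (M.seq (d ⬝ x ⬝ y)) (M.seq (d ⬝ x' ⬝ y'))
  nonneg : ∀ x y, D.mem x → D.mem y → FSeq.Le (FSeq.const 0) (M.seq (d ⬝ x ⬝ y))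
  eq_zero : ∀ x y, D.mem x → D.mem y →
    (FSeq.Eqv (M.seq (d ⬝ x ⬝ y)) (FSeq.const 0) ↔ D.eqv x y)
  symm : ∀ x y, D.mem x → D.mem y → FSeq.Eqv (M.seq (d ⬝ x ⬝ y)) (M.seq (d ⬝ y ⬝ x))
  triangle : ∀ x y z, D.mem x → D.mem y → D.mem z →
    FSeq.Le (M.seq (d ⬝ x ⬝ z)) (FSeq.add (M.seq (d ⬝ x ⬝ y)) (M.seq (d ⬝ y ⬝ z)))

/-- `d(x, y) < 2 ^ (-k)`. -/
def Near (d : M.Car (ρ ⇾ ρ ⇾ FinType.one)) (x y : M.Car ρ) (k : M.N) : Prop :=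
  FSeq.Lt (M.seq (d ⬝ x ⬝ y)) (FSeq.const (M.eps k))

/-- `U` is an open subset of the metric space `(D, d)`. -/
def MetricOpen (D : Dom M ρ) (d : M.Car (ρ ⇾ ρ ⇾ FinType.one)) (U : M.Car (ρ ⇾ FinType.zero)) :
    Prop :=
  D.IsSubset U ∧ ∀ x, D.mem x → U ⬝ x = 1 → ∃ k, ∀ y, D.mem y → Near d x y k → U ⬝ y = 1

/-- The metric space `(D, d)` is connected. -/
def MetricConnected (D : Dom M ρ) (d : M.Car (ρ ⇾ ρ ⇾ FinType.one)) : Prop :=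
  D.Connected (D.MetricOpen d)

/-- `(D, d)` is a metric space where `D` is the set of reals with characteristic function `F`
(and with the equality of reals). -/
def realMetric (F : M.Car (FinType.one ⇾ FinType.zero))
    (d : M.Car (FinType.one ⇾ FinType.one ⇾ FinType.one)) : Prop :=
  (real M).IsSubset F ∧ ((real M).sub F).IsMetric d

/-- The set of objects of type `ρ` with characteristic function `F`, where objects at distance `0`
are considered equal. -/
def ofMetric (F : M.Car (ρ ⇾ FinType.zero)) (d : M.Car (ρ ⇾ ρ ⇾ FinType.one)) : Dom M ρ where
  mem x := F ⬝ x = 1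
  eqv x y := FSeq.Eqv (M.seq (d ⬝ x ⬝ y)) (FSeq.const 0)

/-- A metric space of objects of type `ρ`: a set given by a characteristic function `F` with a
metric `d`; the equality of a metric space is `d(x, y) = 0`. -/
def metricSpace (F : M.Car (ρ ⇾ FinType.zero)) (d : M.Car (ρ ⇾ ρ ⇾ FinType.one)) : Prop :=
  (∀ x, F ⬝ x = 0 ∨ F ⬝ x = 1) ∧ (ofMetric F d).IsMetric d

/-- The real-valued function `f` is continuous on the metric space `(D, d)`. -/
def MetricContinuousReal (D : Dom M ρ) (d : M.Car (ρ ⇾ ρ ⇾ FinType.one))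
    (f : M.Car (ρ ⇾ FinType.one)) : Prop :=
  ∀ x, D.mem x → ∀ k, ∃ m, ∀ y, D.mem y → Near d x y m →
    FSeq.Close (M.seq (f ⬝ x)) (M.seq (f ⬝ y)) k

/-- The function `f` from the metric space `(D, d)` to a metric space with metric `d'` is
continuous. -/
def MetricContinuous (D : Dom M ρ) (d : M.Car (ρ ⇾ ρ ⇾ FinType.one))
    (d' : M.Car (τ ⇾ τ ⇾ FinType.one)) (f : M.Car (ρ ⇾ τ)) : Prop :=
  ∀ x, D.mem x → ∀ k, ∃ m, ∀ y, D.mem y → Near d x y m → Near d' (f ⬝ x) (f ⬝ y) k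

/-! ### Second-countable spaces -/

/-- The sequence of sets `B` is a countable basis of a topology on `D`. -/
structure IsBasis (D : Dom M ρ) (B : M.Car (FinType.zero ⇾ ρ ⇾ FinType.zero)) : Prop where
  subset : ∀ n : M.N, D.IsSubset (B ⬝ n)
  cover : ∀ x, D.mem x → ∃ n : M.N, B ⬝ n ⬝ x = 1
  inter : ∀ x, D.mem x → ∀ m n : M.N, B ⬝ m ⬝ x = 1 → B ⬝ n ⬝ x = 1 →
    ∃ k : M.N, B ⬝ k ⬝ x = 1 ∧ ∀ y, D.mem y → B ⬝ k ⬝ y = 1 → B ⬝ m ⬝ y = 1 ∧ B ⬝ n ⬝ y = 1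

/-- `U` is open in the topology with basis `B` on `D`. -/
def BasisOpen (D : Dom M ρ) (B : M.Car (FinType.zero ⇾ ρ ⇾ FinType.zero))
    (U : M.Car (ρ ⇾ FinType.zero)) : Prop :=
  D.IsSubset U ∧ ∀ x, D.mem x → U ⬝ x = 1 →
    ∃ n : M.N, B ⬝ n ⬝ x = 1 ∧ ∀ y, D.mem y → B ⬝ n ⬝ y = 1 → U ⬝ y = 1

/-- The real-valued function `f` is continuous in the topology with basis `B` on `D`. -/
def BasisContinuous (D : Dom M ρ) (B : M.Car (FinType.zero ⇾ ρ ⇾ FinType.zero))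
    (f : M.Car (ρ ⇾ FinType.one)) : Prop :=
  ∀ x, D.mem x → ∀ k, ∃ n : M.N, B ⬝ n ⬝ x = 1 ∧
    ∀ y, D.mem y → B ⬝ n ⬝ y = 1 → FSeq.Close (M.seq (f ⬝ x)) (M.seq (f ⬝ y)) k

/-- Distinct points are separated by continuous functions into the unit interval. -/
def FunctionallyHausdorff (D : Dom M ρ) (B : M.Car (FinType.zero ⇾ ρ ⇾ FinType.zero)) : Prop :=
  ∀ x y, D.mem x → D.mem y → ¬ D.eqv x y →
    ∃ f : M.Car (ρ ⇾ FinType.one), D.IsMap (unit M) f ∧ D.BasisContinuous B f ∧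
      FSeq.Eqv (M.seq (f ⬝ x)) (FSeq.const 0) ∧ FSeq.Eqv (M.seq (f ⬝ y)) (FSeq.const 1)

end Dom

/-! ## The principles -/

section Principles

variable (M : Str.{u})

/-- `NIN_{[0,1]}`: there is no injection from the unit interval to the natural numbers. -/
def NIN : Prop := (Dom.unit M).UncountableIn (Dom.unit M)

/-- A set of reals that surjects onto the unit interval is uncountable. -/
def SurjectsOntoUnit : Prop :=
  ∀ (X : M.Car (FinType.one ⇾ FinType.zero)) (f : M.Car (FinType.one ⇾ FinType.one)),
    (Dom.real M).IsSubset X → ((Dom.real M).sub X).IsMap (Dom.unit M) f →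
    ((Dom.real M).sub X).IsSurj (Dom.unit M) f →
    (Dom.real M).UncountableIn ((Dom.real M).sub X)

/-- A connected subset `A` with at least two points of a metric space `(S, d)` with `S ⊂ ℝ` is
uncountable. -/
def ConnectedSubset : Prop :=
  ∀ (S A : M.Car (FinType.one ⇾ FinType.zero))
    (d : M.Car (FinType.one ⇾ FinType.one ⇾ FinType.one)),
    Dom.realMetric S d → ((Dom.real M).sub S).IsSubset A →
    (((Dom.real M).sub S).sub A).MetricConnected d →
    (((Dom.real M).sub S).sub A).TwoPoints →
    ((Dom.real M).sub S).UncountableIn (((Dom.real M).sub S).sub A)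

/-- Let `(S, d)` be a connected metric space with `S ⊂ ℝ` and let `f : S → ℝ` be continuous. If
the set `f(S)` exists and has two distinct elements, then it is uncountable. -/
def RealImage : Prop :=
  ∀ (S : M.Car (FinType.one ⇾ FinType.zero))
    (d : M.Car (FinType.one ⇾ FinType.one ⇾ FinType.one))
    (f : M.Car (FinType.one ⇾ FinType.one)) (Z : M.Car (FinType.one ⇾ FinType.zero)),
    Dom.realMetric S d → ((Dom.real M).sub S).MetricConnected d →
    ((Dom.real M).sub S).IsMap (Dom.real M) f → ((Dom.real M).sub S).MetricContinuousReal d f →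
    ((Dom.real M).sub S).IsRange (Dom.real M) f Z → ((Dom.real M).sub Z).TwoPoints →
    (Dom.real M).UncountableIn ((Dom.real M).sub Z)

/-- Let `(S, d)` be a connected metric space with `S ⊂ ℝ`, let `(S₀, d₀)` be any metric space (of
objects of any finite type `ρ`) and let `f : S → S₀` be continuous. If the set `f(S)` exists and has
two distinct elements, then it is uncountable. -/
def MetricImage : Prop :=
  ∀ (ρ : FinType) (S : M.Car (FinType.one ⇾ FinType.zero))
    (d : M.Car (FinType.one ⇾ FinType.one ⇾ FinType.one))
    (S₀ : M.Car (ρ ⇾ FinType.zero)) (d₀ : M.Car (ρ ⇾ ρ ⇾ FinType.one))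
    (f : M.Car (FinType.one ⇾ ρ)) (Z : M.Car (ρ ⇾ FinType.zero)),
    Dom.realMetric S d → ((Dom.real M).sub S).MetricConnected d → Dom.metricSpace S₀ d₀ →
    ((Dom.real M).sub S).IsMap (Dom.ofMetric S₀ d₀) f →
    ((Dom.real M).sub S).MetricContinuous d d₀ f →
    ((Dom.real M).sub S).IsRange (Dom.ofMetric S₀ d₀) f Z →
    ((Dom.ofMetric S₀ d₀).sub Z).TwoPoints →
    (Dom.ofMetric S₀ d₀).UncountableIn ((Dom.ofMetric S₀ d₀).sub Z)

/-- Let `(Sᵢ, dᵢ)` be metric spaces with `Sᵢ ⊂ ℝ`, where `S₀` is connected and has at least two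
points, and let `f : S₁ → S₀` be surjective. Then `S₁` is uncountable. -/
def SurjectsOntoConnected : Prop :=
  ∀ (S₀ S₁ : M.Car (FinType.one ⇾ FinType.zero))
    (d₀ d₁ : M.Car (FinType.one ⇾ FinType.one ⇾ FinType.one))
    (f : M.Car (FinType.one ⇾ FinType.one)),
    Dom.realMetric S₀ d₀ → Dom.realMetric S₁ d₁ →
    ((Dom.real M).sub S₀).TwoPoints → ((Dom.real M).sub S₀).MetricConnected d₀ →
    ((Dom.real M).sub S₁).IsMap ((Dom.real M).sub S₀) f →
    ((Dom.real M).sub S₁).IsSurj ((Dom.real M).sub S₀) f →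
    ((Dom.real M).sub S₁).UncountableIn ((Dom.real M).sub S₁)

/-- A connected functionally Hausdorff second-countable space over the reals with at least two
points is uncountable. -/
def SecondCountable : Prop :=
  ∀ (X : M.Car (FinType.one ⇾ FinType.zero))
    (B : M.Car (FinType.zero ⇾ FinType.one ⇾ FinType.zero)),
    (Dom.real M).IsSubset X → ((Dom.real M).sub X).IsBasis B →
    ((Dom.real M).sub X).Connected (((Dom.real M).sub X).BasisOpen B) →
    ((Dom.real M).sub X).FunctionallyHausdorff B →
    ((Dom.real M).sub X).TwoPoints →
    ((Dom.real M).sub X).UncountableIn ((Dom.real M).sub X)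

end Principles

end HOA

/-!
Let `M` be a model of `ACA₀^ω`.

*From `NIN` to the other principles.* Let `h` be a continuous real-valued function on a connected
space, taking values below and above the real `r`. The sets `{h < r}` and `{h > r}` have
characteristic functions in `M`, because `∃²` decides arithmetical predicates; so connectedness
yields a point with `h x = r` (`Dom.Connected.exists_value`). In a connected metric space with two
points `x₀ ≠ x₁`, the function `h x = min (1, 2 ^ k * d (x₀, x))`, with `2 ^ (-k) ≤ d (x₀, x₁)`,
therefore maps onto the unit interval (`exists_onto_unit`), and in a connected functionally
Hausdorff space a function separating two points does. It remains to see that a set of reals with a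
map `h` onto `[0,1]` is uncountable (`NIN.exists_ne`): `QF-AC^{1,1}` provides a right inverse
`Φ` of `h`, and if `W` has values in the numbers, `NIN` applies to `x ↦ W (Φ (c x))`. Here `c`
sends a real to a representation that depends on its equivalence class only
(`exists_canonical`); it is needed because `Φ` need not respect equality of reals.
For a real-valued `f` with range the set `Z`, the range contains an interval, on which `NIN` can be
used directly, so that no choice is needed (`NIN.realImage`).

*From the other principles to `NIN`.* Each principle is applied to the unit interval, with the
distance of the reals or with the intervals with rational end points as a basis. This requires that
the unit interval is connected (`unit_connected`): if it is the disjoint union of open `U` and `V`,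
with rationals `a ∈ U` and `b ∈ V`, `a < b`, then the supremum of the rationals `q` such that
all rationals between `a` and `q` are in `U` exists by arithmetical comprehension, and it belongs
to neither of the two sets.

*Working inside `M`.* The combinators make the functions and predicates that have representatives
in `M` (`Rep`, `Dec`) closed under explicit definition, and `∃²` closes them under numerical
quantifiers. The numbers of `M`, possibly non-standard, form a canonically ordered semiring with an
ordered field of fractions. In an ultrapower of this field along the numbers of `M` every real of
`M` has a value `rv x`, and the relations `≤`, `<`, `=` of reals become inequalities between
values up to the errors `ep n = 2 ^ (-n)`; all estimates are carried out there.
-/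

namespace HOA

set_option linter.unusedSectionVars false

/-! ### Models: equality, choice and induction in terms of objects -/

/-- `M` is a model of `ACA₀^ω`, as a class. -/
class Model (M : Str.{u}) : Prop where
  aca : M.ACA

section Basic

variable {M : Str.{u}}

theorem eqT_refl : ∀ {σ : FinType} (x : M.Car σ), M.eqT σ x x
  | .zero, _ => rfl
  | .arrow _ _, f => fun x => eqT_refl (f ⬝ x)

theorem eqT_trans : ∀ {σ : FinType} {x y z : M.Car σ},
    M.eqT σ x y → M.eqT σ y z → M.eqT σ x z
  | .zero, _, _, _, h, h' => Eq.trans h h'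
  | .arrow _ _, _, _, _, h, h' => fun z => eqT_trans (h z) (h' z)

/-- An object of each type, used to build assignments. -/
def dflt (M : Str.{u}) : (σ : FinType) → M.Car σ
  | .zero => 0
  | .arrow σ τ => M.cst (Cst.combK τ σ) ⬝ dflt M τ

/-- An assignment used where the values of the variables do not matter. -/
def dfltVal (M : Str.{u}) : M.Val := fun p => dflt M p.1

variable [Model M]

theorem rca (M : Str.{u}) [Model M] : M.RCA := (Model.aca (M := M)).rca

theorem eqT_congr {σ τ : FinType} {f g : M.Car (σ ⇾ τ)} {x y : M.Car σ}
    (h : M.eqT _ f g) (h' : M.eqT _ x y) : M.eqT τ (f ⬝ x) (g ⬝ y) :=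
  eqT_trans (h x) ((rca M).ext _ _ g x y h')

instance instCommSemiring : CommSemiring M.N where
  add_assoc := (rca M).add_assoc
  add_comm := (rca M).add_comm
  add_zero := (rca M).add_zero
  zero_add a := by rw [(rca M).add_comm, (rca M).add_zero]
  mul_assoc := (rca M).mul_assoc
  mul_comm := (rca M).mul_comm
  mul_zero := (rca M).mul_zero
  zero_mul a := by rw [(rca M).mul_comm, (rca M).mul_zero]
  mul_one := (rca M).mul_one
  one_mul a := by rw [(rca M).mul_comm, (rca M).mul_one]
  left_distrib := (rca M).mul_add
  right_distrib a b c := by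
    rw [(rca M).mul_comm, (rca M).mul_add, (rca M).mul_comm c, (rca M).mul_comm c]
  nsmul := nsmulRec

open Classical in
noncomputable instance instLinearOrder : LinearOrder M.N where
  le := (· ≤ ·)
  lt := (· < ·)
  le_refl _ := Or.inr rfl
  le_trans := by
    rintro a b c (h | rfl) (h' | rfl)
    · exact Or.inl ((rca M).lt_trans _ _ _ h h')
    · exact Or.inl h
    · exact Or.inl h'
    · exact Or.inr rfl
  lt_iff_le_not_ge a b := by
    constructor
    · intro h
      refine ⟨Or.inl h, ?_⟩
      rintro (h' | rfl)
      · exact (rca M).lt_irrefl _ ((rca M).lt_trans _ _ _ h h')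
      · exact (rca M).lt_irrefl _ h
    · rintro ⟨h | rfl, h'⟩
      · exact h
      · exact absurd (Or.inr rfl) h'
  le_antisymm := by
    rintro a b (h | rfl) (h' | h')
    · exact absurd ((rca M).lt_trans _ _ _ h h') ((rca M).lt_irrefl _)
    · exact h'.symm
    · rfl
    · rfl
  le_total a b := by
    rcases (rca M).lt_trichotomy a b with h | h | h
    · exact Or.inl (Or.inl h)
    · exact Or.inl (Or.inr h)
    · exact Or.inr (Or.inl h)
  toDecidableLE := Classical.decRel _
  toDecidableEq := Classical.decEq _
  toDecidableLT := Classical.decRel _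

instance instIsStrictOrderedRing : IsStrictOrderedRing M.N where
  add_le_add_left a b h c := by
    rcases (h : a < b ∨ a = b) with h | rfl
    · exact Or.inl ((rca M).add_lt_add _ _ c h)
    · exact le_rfl
  le_of_add_le_add_left a b c h := by
    by_contra hc
    have h1 := (rca M).add_lt_add _ _ a (not_le.1 hc)
    rw [(rca M).add_comm c, (rca M).add_comm b] at h1
    exact absurd h (not_le.2 h1)
  zero_le_one := Or.inl (rca M).zero_lt_one
  exists_pair_ne := ⟨0, 1, ne_of_lt (rca M).zero_lt_one⟩
  mul_lt_mul_of_pos_left a ha b c h := by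
    have := (rca M).mul_lt_mul _ _ _ h ha
    show a * b < a * c
    rwa [(rca M).mul_comm a, (rca M).mul_comm a]
  mul_lt_mul_of_pos_right a ha b c h := (rca M).mul_lt_mul _ _ _ h ha

theorem zero_le_num (a : M.N) : 0 ≤ a := (rca M).zero_le a

theorem lt_add_one_iff_num {a b : M.N} : a < b + 1 ↔ a ≤ b :=
  ⟨(rca M).lt_add_one a b, fun h => lt_of_le_of_lt h (lt_add_one b)⟩

theorem add_one_le_iff_num {a b : M.N} : a + 1 ≤ b ↔ a < b := by
  rw [← not_lt, lt_add_one_iff_num, not_le]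

/-- Quantifier-free choice, for predicates given by characteristic functions. -/
theorem exists_choice {σ τ : FinType} (hac : M.QFAC σ τ) (χ : M.Car (σ ⇾ τ ⇾ .zero))
    (h : ∀ f, ∃ g, χ ⬝ f ⬝ g = 1) : ∃ Φ : M.Car (σ ⇾ τ), ∀ f, χ ⬝ f ⬝ (Φ ⬝ f) = 1 := by
  have := hac (.eq (.app (.app (.var (σ ⇾ τ ⇾ .zero) 2) (.var σ 0)) (.var τ 1)) (.cst .one))
    ((dfltVal M).set _ 2 χ)
  simp only [QFFormula.Holds, Term.eval, Str.Val.set] at this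
  simp [Function.update_of_ne] at this
  exact this h

theorem induction_obj (χ : M.Car FinType.one) (h0 : χ ⬝ (0 : M.N) = 1)
    (hs : ∀ n : M.N, χ ⬝ n = 1 → χ ⬝ (n + 1) = 1) (n : M.N) : χ ⬝ n = 1 := by
  have := (rca M).induction (.eq (.app (.var FinType.one 1) (.var .zero 0)) (.cst .one))
    ((dfltVal M).set _ 1 χ)
  simp only [QFFormula.Holds, Term.eval, Str.Val.set] at this
  simp [Function.update_of_ne] at this
  exact this h0 hs n

/-- Quantifier-free choice provides characteristic functions of quantifier-free predicates on
Baire space. -/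
theorem exists_char_of_formula (φ : QFFormula) (P : M.Car FinType.one → Prop)
    (hφ : ∀ f (n : M.N), φ.Holds M (((dfltVal M).set _ 0 f).set .zero 1 n) ↔ P f) :
    ∃ Φ : M.Car (FinType.one ⇾ .zero), ∀ f, (Φ ⬝ f = 1 ↔ P f) ∧ (Φ ⬝ f = 0 ∨ Φ ⬝ f = 1) := by
  classical
  obtain ⟨Φ, h⟩ := (rca M).qfac
    (.or (.and φ (.eq (.var .zero 1) (.cst .one))) (.and (.neg φ) (.eq (.var .zero 1) (.cst .zero))))
    (dfltVal M) (fun f => by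
      by_cases hP : P f
      · refine ⟨(1 : M.N), Or.inl ⟨(hφ _ _).2 hP, ?_⟩⟩
        simp [Str.Val.set]; rfl
      · refine ⟨(0 : M.N), Or.inr ⟨fun h => hP ((hφ _ _).1 h), ?_⟩⟩
        simp [Str.Val.set]; rfl)
  refine ⟨Φ, fun f => ?_⟩
  have h01 : (1 : M.N) ≠ 0 := one_ne_zero
  rcases h f with ⟨h1, h2⟩ | ⟨h1, h2⟩
  · have h2 : Φ ⬝ f = 1 := by
      simp [QFFormula.Holds, Term.eval, Str.Val.set] at h2; exact h2
    exact ⟨⟨fun _ => (hφ _ _).1 h1, fun _ => h2⟩, Or.inr h2⟩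
  · have h2 : Φ ⬝ f = 0 := by
      simp [QFFormula.Holds, Term.eval, Str.Val.set] at h2; exact h2
    exact ⟨⟨fun h => absurd (h.symm.trans h2) h01, fun h => absurd ((hφ _ _).2 h) h1⟩, Or.inl h2⟩

end Basic

/-! ### Explicit definability -/

/-- A context: a type of tuples of objects over which explicit definitions can be made. The objects
of type `fn τ` represent functions from tuples to objects of type `τ`. -/
class Ctx (M : Str.{u}) (X : Type u) where
  fn : FinType → FinType
  run : {τ : FinType} → M.Car (fn τ) → X → M.Car τ
  const : ∀ {τ : FinType} (c : M.Car τ), ∃ f : M.Car (fn τ), ∀ x, M.eqT τ (run f x) c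
  app : ∀ {σ τ : FinType} (f : M.Car (fn (σ ⇾ τ))) (g : M.Car (fn σ)),
    ∃ h : M.Car (fn τ), ∀ x, M.eqT τ (run h x) (run f x ⬝ run g x)

section Rep

variable {M : Str.{u}} [Model M]

/-- A single variable, abstracted with the combinators `Π` and `Σ`. -/
instance Ctx.single (σ : FinType) : Ctx M (M.Car σ) where
  fn τ := σ ⇾ τ
  run f x := f ⬝ x
  const c := ⟨M.cst (.combK _ _) ⬝ c, fun _ => (rca M).combK _ _ _ _⟩
  app f g := ⟨M.cst (.combS _ _ _) ⬝ f ⬝ g, fun _ => (rca M).combS _ _ _ _ _ _⟩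

/-- Adding a last variable to a context: represented functions are curried. -/
instance Ctx.snoc (X : Type u) [Ctx M X] (σ : FinType) : Ctx M (X × M.Car σ) where
  fn τ := Ctx.fn M X (σ ⇾ τ)
  run f p := Ctx.run f p.1 ⬝ p.2
  const {τ} c := by
    obtain ⟨f, hf⟩ := Ctx.const (X := X) (M.cst (.combK τ σ) ⬝ c)
    exact ⟨f, fun p => eqT_trans (hf p.1 p.2) ((rca M).combK _ _ _ _)⟩
  app {ρ τ} f g := by
    obtain ⟨s, hs⟩ := Ctx.const (X := X) (M.cst (.combS σ ρ τ))
    obtain ⟨h, hh⟩ := Ctx.app (X := X) s f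
    obtain ⟨k, hk⟩ := Ctx.app (X := X) h g
    refine ⟨k, fun p => eqT_trans (hk p.1 p.2) ?_⟩
    exact eqT_trans (eqT_congr (eqT_trans (hh p.1) (eqT_congr (hs p.1) (eqT_refl _)))
      (eqT_refl _) p.2) ((rca M).combS _ _ _ _ _ _)

/-- The function `F` on a context is represented by an object of the model. -/
def Rep {X : Type u} [Ctx M X] {τ : FinType} (F : X → M.Car τ) : Prop :=
  ∃ f : M.Car (Ctx.fn M X τ), ∀ x, M.eqT τ (Ctx.run f x) (F x)

variable {X : Type u} [Ctx M X] {σ τ ρ : FinType}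

theorem Rep.congr {F G : X → M.Car τ} (hF : Rep F) (h : ∀ x, M.eqT τ (F x) (G x)) : Rep G := by
  obtain ⟨f, hf⟩ := hF
  exact ⟨f, fun x => eqT_trans (hf x) (h x)⟩

theorem Rep.const (c : M.Car τ) : Rep (fun _ : X => c) := Ctx.const c

theorem Rep.app {F : X → M.Car (σ ⇾ τ)} {G : X → M.Car σ} (hF : Rep F) (hG : Rep G) :
    Rep (fun x => F x ⬝ G x) := by
  obtain ⟨f, hf⟩ := hF
  obtain ⟨g, hg⟩ := hG
  obtain ⟨h, hh⟩ := Ctx.app f g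
  exact ⟨h, fun x => eqT_trans (hh x) (eqT_congr (hf x) (hg x))⟩

theorem exists_id (σ : FinType) : ∃ i : M.Car (σ ⇾ σ), ∀ x, M.eqT σ (i ⬝ x) x :=
  ⟨M.cst (.combS σ (σ ⇾ σ) σ) ⬝ M.cst (.combK _ _) ⬝ M.cst (.combK _ _), fun _ =>
    eqT_trans ((rca M).combS _ _ _ _ _ _) ((rca M).combK _ _ _ _)⟩

theorem Rep.id : Rep (fun x : M.Car σ => x) := exists_id σ

/-- Weakening by a new last variable. -/
theorem Rep.fst {F : X → M.Car τ} (hF : Rep F) : Rep (fun p : X × M.Car σ => F p.1) := by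
  obtain ⟨f, hf⟩ := hF
  obtain ⟨k, hk⟩ := Ctx.const (X := X) (M.cst (.combK τ σ))
  obtain ⟨h, hh⟩ := Ctx.app k f
  refine ⟨h, fun p => eqT_trans (hh p.1 p.2) ?_⟩
  exact eqT_trans (eqT_congr (hk p.1) (hf p.1) p.2) ((rca M).combK _ _ _ _)

theorem Rep.snd : Rep (fun p : X × M.Car σ => p.2) := by
  obtain ⟨i, hi⟩ := exists_id (M := M) σ
  obtain ⟨f, hf⟩ := Ctx.const (X := X) i
  exact ⟨f, fun p => eqT_trans (hf p.1 p.2) (hi p.2)⟩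

/-- Abstraction over the last variable. -/
theorem Rep.lam {F : X → M.Car σ → M.Car τ} (hF : Rep (fun p : X × M.Car σ => F p.1 p.2)) :
    ∃ G : X → M.Car (σ ⇾ τ), Rep G ∧ ∀ x y, M.eqT τ (G x ⬝ y) (F x y) := by
  obtain ⟨f, hf⟩ := hF
  exact ⟨fun x => Ctx.run (M := M) (X := X) f x, ⟨f, fun _ => eqT_refl _⟩, fun x y => hf (x, y)⟩

theorem Rep.var1 : Rep (fun p : (X × M.Car σ) × M.Car ρ => p.1.2) := Rep.fst Rep.snd
theorem Rep.var2 {ν : FinType} : Rep (fun p : ((X × M.Car σ) × M.Car ρ) × M.Car ν => p.1.1.2) :=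
  Rep.fst (Rep.fst Rep.snd)
theorem Rep.id1 : Rep (fun p : M.Car σ × M.Car ρ => p.1) := Rep.fst Rep.id
theorem Rep.id2 {ν : FinType} : Rep (fun p : (M.Car σ × M.Car ρ) × M.Car ν => p.1.1) :=
  Rep.fst Rep.id1
theorem Rep.id3 {ν μ : FinType} :
    Rep (fun p : ((M.Car σ × M.Car ρ) × M.Car ν) × M.Car μ => p.1.1.1) :=
  Rep.fst Rep.id2

theorem Rep.add {F G : X → M.N} (hF : Rep F) (hG : Rep G) : Rep (fun x => F x + G x) :=
  ((Rep.const (M.cst .add)).app hF).app hG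

theorem Rep.mul {F G : X → M.N} (hF : Rep F) (hG : Rep G) : Rep (fun x => F x * G x) :=
  ((Rep.const (M.cst .mul)).app hF).app hG

theorem rec_one (f : M.Car (FinType.zero ⇾ FinType.zero ⇾ FinType.zero)) (m : M.N) :
    M.cst Cst.recursor ⬝ f ⬝ m ⬝ (1 : M.N) = f ⬝ (0 : M.N) ⬝ m := by
  have := (rca M).rec_succ f m 0
  rwa [zero_add, (rca M).rec_zero] at this

/-- An element of Baire space with given first two values. -/
def pairFn (a b : M.N) : M.Car FinType.one :=
  M.cst Cst.recursor ⬝ (M.cst (.combK FinType.one FinType.zero) ⬝ (M.cst (.combK _ _) ⬝ b)) ⬝ a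

theorem pairFn_zero (a b : M.N) : pairFn a b ⬝ (0 : M.N) = a := (rca M).rec_zero _ _

theorem pairFn_one (a b : M.N) : pairFn a b ⬝ (1 : M.N) = b := by
  refine (rec_one _ _).trans ?_
  exact eqT_trans (σ := .zero) ((rca M).combK FinType.one _ _ _ _) ((rca M).combK _ _ _ _)

theorem Rep.pairFn {F G : X → M.N} (hF : Rep F) (hG : Rep G) :
    Rep (fun x => HOA.pairFn (F x) (G x)) :=
  ((Rep.const _).app ((Rep.const _).app ((Rep.const _).app hG))).app hF

open Classical in
/-- The predicate `P` on a context has a characteristic function in the model. -/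
def Dec (P : X → Prop) : Prop := Rep (fun x => if P x then (1 : M.N) else 0)

theorem Dec.of_rep {P : X → Prop} {F : X → M.N} (hF : Rep F) (h : ∀ x, F x = 1 ↔ P x)
    (h' : ∀ x, F x = 0 ∨ F x = 1) : Dec (M := M) P := by
  refine hF.congr fun x => ?_
  show F x = _
  split_ifs with hP
  · exact (h x).2 hP
  · exact (h' x).resolve_right fun h1 => hP ((h x).1 h1)

theorem Dec.rep {P : X → Prop} [∀ x, Decidable (P x)] (hP : Dec (M := M) P) :
    Rep (fun x => if P x then (1 : M.N) else 0) := by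
  unfold Dec at hP
  convert hP

theorem Dec.congr {P Q : X → Prop} (hP : Dec (M := M) P) (h : ∀ x, P x ↔ Q x) :
    Dec (M := M) Q := by
  have : P = Q := funext fun x => propext (h x)
  exact this ▸ hP

theorem Dec.exists_char {P : M.Car σ → Prop} (hP : Dec (M := M) P) :
    ∃ χ : M.Car (σ ⇾ .zero), ∀ x, (χ ⬝ x = 0 ∨ χ ⬝ x = 1) ∧ (χ ⬝ x = 1 ↔ P x) := by
  classical
  obtain ⟨χ, h⟩ := hP
  refine ⟨χ, fun x => ?_⟩
  have : χ ⬝ x = if P x then (1 : M.N) else 0 := h x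
  rw [this]
  split_ifs with hx <;> simp [hx]

theorem Dec.exists_rel {P : M.Car σ → M.Car τ → Prop}
    (hP : Dec (M := M) (fun p : M.Car σ × M.Car τ => P p.1 p.2)) :
    ∃ χ : M.Car (σ ⇾ τ ⇾ .zero), ∀ x y,
      (χ ⬝ x ⬝ y = 0 ∨ χ ⬝ x ⬝ y = 1) ∧ (χ ⬝ x ⬝ y = 1 ↔ P x y) := by
  classical
  obtain ⟨χ, h⟩ := hP.rep
  refine ⟨χ, fun x y => ?_⟩
  have : χ ⬝ x ⬝ y = if P x y then (1 : M.N) else 0 := h (x, y)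
  rw [this]
  split_ifs with hx <;> simp [hx]

/-- The two numbers are packed into an element of Baire space, to which `exists_char_of_formula`
applies. -/
theorem Dec.of_formula {φ : QFFormula} (P : M.N → M.N → Prop)
    (hφ : ∀ (f : M.Car FinType.one) (n : M.N),
      φ.Holds M (((dfltVal M).set _ 0 f).set .zero 1 n) ↔ P (f ⬝ (0 : M.N)) (f ⬝ (1 : M.N)))
    {F G : X → M.N} (hF : Rep F) (hG : Rep G) : Dec (M := M) (fun x => P (F x) (G x)) := by
  obtain ⟨Φ, h⟩ := exists_char_of_formula φ _ hφ
  refine Dec.of_rep ((Rep.const Φ).app (Rep.pairFn hF hG)) (fun x => ?_) (fun x => (h _).2)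
  rw [(h _).1, pairFn_zero, pairFn_one]

theorem Dec.eq {F G : X → M.N} (hF : Rep F) (hG : Rep G) : Dec (M := M) (fun x => F x = G x) :=
  Dec.of_formula (φ := .eq (.app (.var .one 0) (.cst .zero)) (.app (.var .one 0) (.cst .one)))
    (fun a b => a = b) (fun f n => by simp [QFFormula.Holds, Term.eval, Str.Val.set]; rfl) hF hG

theorem Dec.lt {F G : X → M.N} (hF : Rep F) (hG : Rep G) : Dec (M := M) (fun x => F x < G x) :=
  Dec.of_formula (φ := .lt (.app (.var .one 0) (.cst .zero)) (.app (.var .one 0) (.cst .one)))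
    (fun a b => a < b) (fun f n => by simp [QFFormula.Holds, Term.eval, Str.Val.set]; rfl) hF hG

theorem Dec.imp {P Q : X → Prop} (hP : Dec (M := M) P) (hQ : Dec (M := M) Q) :
    Dec (M := M) (fun x => P x → Q x) := by
  classical
  refine (Dec.of_formula (φ := .imp (.eq (.app (.var .one 0) (.cst .zero)) (.cst .one))
    (.eq (.app (.var .one 0) (.cst .one)) (.cst .one)))
    (fun a b => a = 1 → b = 1) (fun f n => ?_) hP hQ).congr fun x => by simp
  simp [QFFormula.Holds, Term.eval, Str.Val.set]; rfl

theorem Dec.not {P : X → Prop} (hP : Dec (M := M) P) : Dec (M := M) (fun x => ¬ P x) :=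
  (Dec.imp hP ((Dec.eq (Rep.const 0) (Rep.const (1 : M.N))))).congr fun x => by simp

theorem Dec.and {P Q : X → Prop} (hP : Dec (M := M) P) (hQ : Dec (M := M) Q) :
    Dec (M := M) (fun x => P x ∧ Q x) :=
  (hP.imp hQ.not).not.congr fun x => by tauto

theorem Dec.or {P Q : X → Prop} (hP : Dec (M := M) P) (hQ : Dec (M := M) Q) :
    Dec (M := M) (fun x => P x ∨ Q x) :=
  (hP.not.imp hQ).congr fun x => by tauto

theorem Dec.le {F G : X → M.N} (hF : Rep F) (hG : Rep G) : Dec (M := M) (fun x => F x ≤ G x) :=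
  (Dec.lt hG hF).not.congr fun _ => not_lt

/-- Numerical quantifiers are decided by `∃²`. -/
theorem Dec.ex {P : X → M.N → Prop} (hP : Dec (M := M) (fun p : X × M.N => P p.1 p.2)) :
    Dec (M := M) (fun x => ∃ n, P x n) := by
  classical
  obtain ⟨E, hE⟩ := (Model.aca (M := M)).exists2
  obtain ⟨G, hG, h⟩ := Rep.lam (F := fun x n => if ¬ P x n then (1 : M.N) else 0) hP.not.rep
  have h : ∀ x n, G x ⬝ n = if ¬ P x n then (1 : M.N) else 0 := h
  refine (Dec.eq ((Rep.const E).app hG) (Rep.const 0)).congr fun x => ?_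
  rw [(hE _).2]
  simp [h]

theorem Dec.all {P : X → M.N → Prop} (hP : Dec (M := M) (fun p : X × M.N => P p.1 p.2)) :
    Dec (M := M) (fun x => ∀ n, P x n) :=
  (Dec.ex (P := fun x n => ¬ P x n) hP.not).not.congr fun x => by simp

/-- Definition by cases. -/
theorem Rep.ite {P : X → Prop} [∀ x, Decidable (P x)] {F G : X → M.N} (hP : Dec (M := M) P)
    (hF : Rep F) (hG : Rep G) : Rep (fun x => if P x then F x else G x) := by
  classical
  refine ((Rep.pairFn hG hF).app hP).congr fun x => ?_
  show _ = _
  by_cases h : P x <;> simp only [h, if_true, if_false]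
  · exact pairFn_one _ _
  · exact pairFn_zero _ _

/-- Functions with a decidable graph are represented, by `QF-AC^{1,0}` and `∃²`. -/
theorem Rep.of_graph {F : X → M.N} (hF : Dec (M := M) (fun p : X × M.N => F p.1 = p.2)) :
    Rep F := by
  classical
  -- Feferman's search operator `μ`: it finds an argument where a sequence takes the value `1`
  have h1 : Dec (M := M) (fun p : M.Car FinType.one × M.N =>
      (∃ n : M.N, p.1 ⬝ n = 1) → p.1 ⬝ p.2 = 1) :=
    Dec.imp (Dec.ex (P := fun (p : M.Car FinType.one × M.N) n => p.1 ⬝ n = 1)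
      (Dec.eq (Rep.app Rep.id2 Rep.snd) (Rep.const 1)))
      (Dec.eq (Rep.app Rep.id1 Rep.snd) (Rep.const 1))
  obtain ⟨χ, h⟩ := h1.rep
  have h : ∀ f n, χ ⬝ f ⬝ n = if ((∃ n : M.N, f ⬝ n = 1) → f ⬝ n = 1) then (1 : M.N) else 0 :=
    fun f n => h (f, n)
  obtain ⟨μ, hμ⟩ := exists_choice (rca M).qfac χ (fun f => by
    by_cases hf : ∃ n : M.N, f ⬝ n = 1
    · obtain ⟨n, hn⟩ := hf
      exact ⟨n, by rw [h, if_pos fun _ => hn]⟩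
    · exact ⟨0, by rw [h, if_pos fun h => absurd h hf]⟩)
  obtain ⟨G, hG, h'⟩ := Rep.lam (F := fun x n => if F x = n then (1 : M.N) else 0) hF.rep
  refine ((Rep.const μ).app hG).congr fun x => ?_
  have h' : ∀ n, G x ⬝ n = if F x = n then (1 : M.N) else 0 := h' x
  have h2 := hμ (G x)
  rw [h] at h2
  have h3 : (∃ n : M.N, G x ⬝ n = 1) → G x ⬝ (μ ⬝ G x) = 1 := by
    by_contra hc
    rw [if_neg hc] at h2
    exact zero_ne_one h2
  have h4 := h3 ⟨F x, by rw [h', if_pos rfl]⟩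
  rw [h'] at h4
  by_contra hc
  rw [if_neg (fun e => hc e.symm)] at h4
  exact zero_ne_one h4

/-- Induction for arithmetical predicates with parameters. -/
theorem Dec.induction {P : M.N → Prop} (hP : Dec (M := M) P) (h0 : P 0)
    (hs : ∀ n, P n → P (n + 1)) (n : M.N) : P n := by
  obtain ⟨χ, h⟩ := hP.exists_char
  exact (h n).2.1 (induction_obj χ ((h 0).2.2 h0) (fun k hk => (h _).2.2 (hs k ((h k).2.1 hk))) n)

theorem Dec.exists_least {P : M.N → Prop} (hP : Dec (M := M) P) (h : ∃ n, P n) :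
    ∃ n, P n ∧ ∀ m, P m → n ≤ m := by
  by_contra hc
  push Not at hc
  have key : ∀ n : M.N, ∀ m, m < n → ¬ P m := by
    have hd : Dec (M := M) (fun n : M.N => ∀ m, m < n → ¬ P m) := by
      obtain ⟨χ, hχ⟩ := hP.exists_char
      refine (Dec.all (P := fun n m => m < n → ¬ χ ⬝ m = 1) (Dec.imp (Dec.lt Rep.snd Rep.id1)
        (Dec.not (Dec.eq (Rep.app (Rep.const χ) Rep.snd) (Rep.const 1))))).congr fun n => ?_
      simp only [(hχ _).2]
    refine hd.induction (fun m hm => absurd hm (not_lt.2 (zero_le_num m))) fun n ih m hm hPm => ?_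
    obtain ⟨k, hk, hkm⟩ := hc m hPm
    exact ih k (lt_of_lt_of_le hkm (lt_add_one_iff_num.1 hm)) hk
  obtain ⟨n, hn⟩ := h
  exact key (n + 1) n (lt_add_one n) hn

/-- Subtraction, which the axioms provide only through induction. -/
theorem num_exists_add {a b : M.N} (h : a ≤ b) : ∃ c, b = a + c := by
  have hd : Dec (M := M) (fun b : M.N => a ≤ b → ∃ c, b = a + c) :=
    Dec.imp (Dec.le (Rep.const a) Rep.id)
      (Dec.ex (P := fun b c => b = a + c) (Dec.eq Rep.id1 (Rep.add (Rep.const a) Rep.snd)))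
  revert h
  refine hd.induction (fun h => ⟨0, ?_⟩) (fun b ih h => ?_) b
  · rw [add_zero]; exact le_antisymm (zero_le_num a) h
  · rcases h.lt_or_eq with h | h
    · obtain ⟨c, rfl⟩ := ih (lt_add_one_iff_num.1 h)
      exact ⟨c + 1, by rw [add_assoc]⟩
    · exact ⟨0, by rw [add_zero, h]⟩

/-- The choice of least witnesses is represented. -/
theorem Rep.exists_least {P : X → M.N → Prop} (hP : Dec (M := M) (fun p : X × M.N => P p.1 p.2))
    (h : ∀ x, ∃ n, P x n) :
    ∃ F : X → M.N, Rep F ∧ ∀ x, P x (F x) ∧ ∀ n, P x n → F x ≤ n := by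
  classical
  obtain ⟨G, hG, h'⟩ := Rep.lam (F := fun x n => if P x n then (1 : M.N) else 0) hP.rep
  have h' : ∀ x n, G x ⬝ n = 1 ↔ P x n := fun x n => by
    have : G x ⬝ n = if P x n then (1 : M.N) else 0 := h' x n
    rw [this]
    by_cases hx : P x n <;> simp [hx]
  have hl : ∀ x, ∃ n, P x n ∧ ∀ m, P x m → n ≤ m := fun x => by
    refine Dec.exists_least ?_ (h x)
    exact (Dec.eq (Rep.app (Rep.const (G x)) Rep.id) (Rep.const 1)).congr fun n => h' x n
  choose F hF using hl
  refine ⟨F, Rep.of_graph ?_, hF⟩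
  have : Dec (M := M) (fun p : X × M.N => G p.1 ⬝ p.2 = 1 ∧ ∀ m, G p.1 ⬝ m = 1 → p.2 ≤ m) :=
    Dec.and (Dec.eq (Rep.app (Rep.fst hG) Rep.snd) (Rep.const 1))
      (Dec.all (P := fun (p : X × M.N) m => G p.1 ⬝ m = 1 → p.2 ≤ m) (Dec.imp
        (Dec.eq (Rep.app (Rep.fst (Rep.fst hG)) Rep.snd) (Rep.const 1)) (Dec.le Rep.var1 Rep.snd)))
  refine this.congr fun p => ?_
  simp only [h']
  constructor
  · rintro ⟨h1, h2⟩
    exact le_antisymm ((hF _).2 _ h1) (h2 _ (hF _).1)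
  · intro h; rw [← h]; exact hF p.1

end Rep

/-! ### The ordered field of fractions of a canonically ordered semiring -/

section Diff

variable (R : Type u) [CommSemiring R] [LinearOrder R] [IsStrictOrderedRing R]

/-- Two pairs have the same difference. -/
def diffSetoid : Setoid (R × R) where
  r a b := a.1 + b.2 = b.1 + a.2
  iseqv :=
    { refl := fun _ => rfl
      symm := fun h => h.symm
      trans := fun {a b c} h h' => by
        have : (a.1 + c.2) + (b.1 + b.2) = (c.1 + a.2) + (b.1 + b.2) := by
          calc _ = (a.1 + b.2) + (b.1 + c.2) := by ring
            _ = (b.1 + a.2) + (c.1 + b.2) := by rw [h, h']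
            _ = _ := by ring
        exact add_right_cancel this }

/-- The ring of formal differences of the elements of a semiring. -/
def Diff : Type u := Quotient (diffSetoid R)

namespace Diff

variable {R}

theorem sound {a b : R × R} (h : a.1 + b.2 = b.1 + a.2) :
    (Quotient.mk (diffSetoid R) a) = Quotient.mk (diffSetoid R) b := Quotient.sound h

instance : Zero (Diff R) := ⟨Quotient.mk _ (0, 0)⟩
instance : One (Diff R) := ⟨Quotient.mk _ (1, 0)⟩
instance : Neg (Diff R) := ⟨Quotient.map (fun a => (a.2, a.1)) fun a b (h : _ = _) => by
  show a.2 + b.1 = b.2 + a.1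
  rw [add_comm, ← h, add_comm]⟩
instance : Add (Diff R) := ⟨Quotient.map₂ (fun a b => (a.1 + b.1, a.2 + b.2))
  fun a a' (h : _ = _) b b' (h' : _ = _) => by
    show a.1 + b.1 + (a'.2 + b'.2) = a'.1 + b'.1 + (a.2 + b.2)
    calc _ = (a.1 + a'.2) + (b.1 + b'.2) := by ring
      _ = (a'.1 + a.2) + (b'.1 + b.2) := by rw [h, h']
      _ = _ := by ring⟩
instance : Mul (Diff R) := ⟨Quotient.map₂
  (fun a b => (a.1 * b.1 + a.2 * b.2, a.1 * b.2 + a.2 * b.1))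
  fun a a' (h : _ = _) b b' (h' : _ = _) => by
    refine (diffSetoid R).trans (b := (a'.1 * b.1 + a'.2 * b.2, a'.1 * b.2 + a'.2 * b.1)) ?_ ?_
    · show a.1 * b.1 + a.2 * b.2 + (a'.1 * b.2 + a'.2 * b.1)
        = a'.1 * b.1 + a'.2 * b.2 + (a.1 * b.2 + a.2 * b.1)
      calc _ = (a.1 + a'.2) * b.1 + (a'.1 + a.2) * b.2 := by ring
        _ = (a'.1 + a.2) * b.1 + (a.1 + a'.2) * b.2 := by rw [h]
        _ = _ := by ring
    · show a'.1 * b.1 + a'.2 * b.2 + (a'.1 * b'.2 + a'.2 * b'.1)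
        = a'.1 * b'.1 + a'.2 * b'.2 + (a'.1 * b.2 + a'.2 * b.1)
      calc _ = a'.1 * (b.1 + b'.2) + a'.2 * (b'.1 + b.2) := by ring
        _ = a'.1 * (b'.1 + b.2) + a'.2 * (b.1 + b'.2) := by rw [h']
        _ = _ := by ring⟩

instance : CommRing (Diff R) where
  add_assoc := by
    rintro ⟨a⟩ ⟨b⟩ ⟨c⟩; apply sound; dsimp only; ring
  add_comm := by rintro ⟨a⟩ ⟨b⟩; apply sound; dsimp only; ring
  add_zero := by rintro ⟨a⟩; apply sound; dsimp only; ring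
  zero_add := by rintro ⟨a⟩; apply sound; dsimp only; ring
  mul_assoc := by rintro ⟨a⟩ ⟨b⟩ ⟨c⟩; apply sound; dsimp only; ring
  mul_comm := by rintro ⟨a⟩ ⟨b⟩; apply sound; dsimp only; ring
  mul_one := by rintro ⟨a⟩; apply sound; dsimp only; ring
  one_mul := by rintro ⟨a⟩; apply sound; dsimp only; ring
  mul_zero := by rintro ⟨a⟩; apply sound; dsimp only; ring
  zero_mul := by rintro ⟨a⟩; apply sound; dsimp only; ring
  left_distrib := by rintro ⟨a⟩ ⟨b⟩ ⟨c⟩; apply sound; dsimp only; ring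
  right_distrib := by rintro ⟨a⟩ ⟨b⟩ ⟨c⟩; apply sound; dsimp only; ring
  neg_add_cancel := by rintro ⟨a⟩; apply sound; dsimp only; ring
  nsmul := nsmulRec
  zsmul := zsmulRec

/-- The embedding of the semiring into its ring of differences. -/
def ofNum : R →+* Diff R where
  toFun a := Quotient.mk _ (a, 0)
  map_zero' := rfl
  map_one' := rfl
  map_add' a b := by apply sound; dsimp only; ring
  map_mul' a b := by apply sound; dsimp only; ring

theorem ofNum_injective : Function.Injective (ofNum (R := R)) := fun a b h => by
  have : a + 0 = b + 0 := Quotient.exact h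
  simpa using this

variable [CanonicallyOrderedAdd R]

theorem eq_ofNum_or_neg (z : Diff R) : ∃ a, z = ofNum a ∨ z = -ofNum a := by
  obtain ⟨a, b⟩ := z
  rcases le_total a b with h | h
  · obtain ⟨c, rfl⟩ := exists_add_of_le h
    exact ⟨c, Or.inr (by apply sound; dsimp only; ring)⟩
  · obtain ⟨c, rfl⟩ := exists_add_of_le h
    exact ⟨c, Or.inl (by apply sound; dsimp only; ring)⟩

instance : Nontrivial (Diff R) := ⟨0, 1, fun h => zero_ne_one (ofNum_injective
  (by rw [map_zero, map_one]; exact h) : (0 : R) = 1)⟩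

instance : IsDomain (Diff R) := by
  have : NoZeroDivisors (Diff R) := ⟨by
    intro x y h
    have key : ∀ a b : R, ofNum a * ofNum b = 0 → a = 0 ∨ b = 0 := fun a b h => by
      rw [← map_mul, ← map_zero ofNum] at h
      have h := ofNum_injective h
      by_contra hc
      push Not at hc
      have := mul_pos (pos_iff_ne_zero.2 hc.1) (pos_iff_ne_zero.2 hc.2)
      exact this.ne' h
    obtain ⟨a, rfl | rfl⟩ := eq_ofNum_or_neg x <;> obtain ⟨b, rfl | rfl⟩ := eq_ofNum_or_neg y <;>
      rcases key a b (by simpa using h) with rfl | rfl <;> simp⟩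
  exact NoZeroDivisors.to_isDomain _

end Diff

variable [CanonicallyOrderedAdd R]

/-- The field of fractions of the ring of differences. -/
def QField : Type u := FractionRing (Diff R)

namespace QField

noncomputable instance : Field (QField R) := inferInstanceAs (Field (FractionRing (Diff R)))

variable {R}

/-- The embedding of the semiring into its field of fractions. -/
noncomputable def ofNum : R →+* QField R :=
  (algebraMap (Diff R) (FractionRing (Diff R))).comp Diff.ofNum

theorem ofNum_injective : Function.Injective (ofNum (R := R)) :=
  (IsFractionRing.injective (Diff R) (FractionRing (Diff R))).comp Diff.ofNum_injective

theorem ofNum_eq_zero {a : R} : ofNum a = 0 ↔ a = 0 := by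
  rw [← map_zero (ofNum (R := R)), ofNum_injective.eq_iff]

variable (R) in
/-- The non-negative elements, i.e. the quotients of elements of the semiring. -/
def cone : RingCone (QField R) where
  carrier := {x | ∃ a b : R, b ≠ 0 ∧ x = ofNum a / ofNum b}
  zero_mem' := ⟨0, 1, one_ne_zero, by simp⟩
  one_mem' := ⟨1, 1, one_ne_zero, by simp⟩
  add_mem' := by
    rintro _ _ ⟨a, b, hb, rfl⟩ ⟨c, d, hd, rfl⟩
    have hb' := mt ofNum_eq_zero.1 hb
    have hd' := mt ofNum_eq_zero.1 hd
    exact ⟨a * d + b * c, b * d, mul_ne_zero hb hd, by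
      rw [div_add_div _ _ hb' hd']; simp only [map_add, map_mul]⟩
  mul_mem' := by
    rintro _ _ ⟨a, b, hb, rfl⟩ ⟨c, d, hd, rfl⟩
    exact ⟨a * c, b * d, mul_ne_zero hb hd, by
      rw [div_mul_div_comm]; simp only [map_mul]⟩
  eq_zero_of_mem_of_neg_mem' := by
    rintro _ ⟨a, b, hb, rfl⟩ ⟨c, d, hd, h⟩
    have hb' := mt ofNum_eq_zero.1 hb
    have hd' := mt ofNum_eq_zero.1 hd
    have h1 : ofNum (c * b + a * d) = 0 := by
      simp only [map_add, map_mul]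
      field_simp at h
      linear_combination -h
    have h2 := ofNum_eq_zero.1 h1
    have h3 : a * d = 0 := by
      by_contra hc
      have := add_pos_of_nonneg_of_pos (zero_le : 0 ≤ c * b) (pos_iff_ne_zero.2 hc)
      exact this.ne' h2
    have : a = 0 := (mul_eq_zero.1 h3).resolve_right hd
    simp [this]

theorem mem_cone {x : QField R} :
    x ∈ cone R ↔ ∃ a b : R, b ≠ 0 ∧ x = ofNum a / ofNum b := Iff.rfl

theorem mem_or_neg_mem (x : QField R) : x ∈ cone R ∨ -x ∈ cone R := by
  obtain ⟨z, w, hw, rfl⟩ := IsFractionRing.div_surjective (A := Diff R) (K := FractionRing (Diff R)) x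
  have hw0 : w ≠ 0 := nonZeroDivisors.ne_zero hw
  obtain ⟨a, ha⟩ := Diff.eq_ofNum_or_neg z
  obtain ⟨b, hb⟩ := Diff.eq_ofNum_or_neg w
  have hb0 : b ≠ 0 := by
    rintro rfl
    rcases hb with rfl | rfl <;> simp at hw0
  rcases ha with rfl | rfl <;> rcases hb with rfl | rfl
  · exact Or.inl (mem_cone.2 ⟨a, b, hb0, rfl⟩)
  · exact Or.inr (mem_cone.2 ⟨a, b, hb0, by simp only [map_neg, div_neg]; exact neg_neg (ofNum a / ofNum b)⟩)
  · exact Or.inr (mem_cone.2 ⟨a, b, hb0, by simp only [map_neg, neg_div]; exact neg_neg (ofNum a / ofNum b)⟩)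
  · exact Or.inl (mem_cone.2 ⟨a, b, hb0, by simp only [map_neg, div_neg, neg_div, neg_neg]; rfl⟩)

instance : HasMemOrNegMem (cone R) := ⟨mem_or_neg_mem⟩

open Classical in
noncomputable instance : LinearOrder (QField R) := LinearOrder.mkOfAddGroupCone (cone R)

instance : IsOrderedRing (QField R) := IsOrderedRing.mkOfCone (cone R)

instance : IsStrictOrderedRing (QField R) := IsOrderedRing.toIsStrictOrderedRing _

theorem ofNum_nonneg (a : R) : 0 ≤ ofNum a := by
  show _ - _ ∈ cone R
  exact mem_cone.2 ⟨a, 1, one_ne_zero, by simp⟩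

theorem ofNum_strictMono : StrictMono (ofNum (R := R)) := fun a b h => by
  obtain ⟨c, rfl⟩ := exists_add_of_le h.le
  refine lt_of_le_of_ne ?_ fun e => h.ne (ofNum_injective e)
  rw [map_add]
  exact le_add_of_nonneg_right (ofNum_nonneg c)

theorem ofNum_le {a b : R} : ofNum a ≤ ofNum b ↔ a ≤ b := ofNum_strictMono.le_iff_le
theorem ofNum_lt {a b : R} : ofNum a < ofNum b ↔ a < b := ofNum_strictMono.lt_iff_lt

theorem ofNum_pos {a : R} (h : 0 < a) : 0 < ofNum a := by
  rw [← map_zero (ofNum (R := R))]; exact ofNum_lt.2 h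

/-- Positive elements are bounded below by inverses of elements of the semiring. -/
theorem exists_inv_le (h1 : ∀ a : R, 0 < a → 1 ≤ a) {x : QField R} (hx : 0 < x) : ∃ b : R, 0 < b ∧ 1 / ofNum b ≤ x := by
  have h : x ∈ cone R := by
    have := hx.le
    change _ - _ ∈ cone R at this
    rwa [sub_zero] at this
  obtain ⟨a, b, hb, rfl⟩ := mem_cone.1 h
  have hb' := ofNum_pos (pos_iff_ne_zero.2 hb)
  refine ⟨b, pos_iff_ne_zero.2 hb, ?_⟩
  gcongr
  have ha : a ≠ 0 := by rintro rfl; simp at hx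
  rw [← map_one (ofNum (R := R))]
  exact ofNum_le.2 (h1 a (pos_iff_ne_zero.2 ha))

end QField

end Diff

/-! ### The values of fractions and of reals -/

section Values

variable {M : Str.{u}} [Model M]

instance : CanonicallyOrderedAdd M.N where
  exists_add_of_le h := num_exists_add h
  le_self_add _ b := le_add_of_nonneg_right (zero_le_num b)
  le_add_self _ b := le_add_of_nonneg_left (zero_le_num b)

theorem one_le_num {a : M.N} (h : 0 < a) : 1 ≤ a := by
  rw [← zero_add (1 : M.N)]; exact add_one_le_iff_num.2 h

theorem double_apply (n m : M.N) : M.double ⬝ n ⬝ m = m + m := by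
  refine eqT_trans (σ := .zero) ((rca M).combK FinType.one FinType.zero _ _ _) ?_
  refine eqT_trans (σ := .zero) ((rca M).combS _ _ _ _ _ _) ?_
  show M.cst Cst.add ⬝ m ⬝ _ = M.cst Cst.add ⬝ m ⬝ m
  congr 1
  exact eqT_trans (σ := .zero) ((rca M).combS _ _ _ _ _ _) ((rca M).combK _ _ _ _)

theorem pow2_zero : M.pow2 0 = 1 := (rca M).rec_zero _ _

theorem pow2_succ (n : M.N) : M.pow2 (n + 1) = M.pow2 n + M.pow2 n := by
  refine ((rca M).rec_succ _ _ _).trans ?_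
  exact double_apply _ _

theorem Rep.pow2 {X : Type u} [Ctx M X] {F : X → M.N} (hF : Rep F) :
    Rep (fun x => M.pow2 (F x)) := (Rep.const _).app hF

theorem lt_pow2 (n : M.N) : n < M.pow2 n := by
  refine Dec.induction (P := fun n => n < M.pow2 n) (Dec.lt Rep.id (Rep.pow2 Rep.id)) ?_ ?_ n
  · rw [pow2_zero]; exact zero_lt_one
  · intro n ih
    rw [pow2_succ]
    have := one_le_num (lt_of_le_of_lt (zero_le_num n) ih)
    exact add_lt_add_of_lt_of_le ih this

theorem pow2_pos (n : M.N) : 0 < M.pow2 n := lt_of_le_of_lt (zero_le_num n) (lt_pow2 n)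

theorem pow2_add (n k : M.N) : M.pow2 (n + k) = M.pow2 n * M.pow2 k := by
  refine Dec.induction (P := fun k => M.pow2 (n + k) = M.pow2 n * M.pow2 k)
    (Dec.eq (Rep.pow2 (Rep.add (Rep.const n) Rep.id))
      (Rep.mul (Rep.const _) (Rep.pow2 Rep.id))) ?_ ?_ k
  · rw [pow2_zero, add_zero, mul_one]
  · intro k ih
    rw [← add_assoc, pow2_succ, ih, pow2_succ, mul_add]

/-- The ordered field of rationals of the model. -/
abbrev Rat (M : Str.{u}) [Model M] : Type u := QField M.N

theorem Rat.le_of_forall {x y : Rat M}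
    (h : ∀ n : M.N, x ≤ y + 1 / QField.ofNum (M.pow2 n)) : x ≤ y := by
  by_contra hc
  push Not at hc
  obtain ⟨b, hb, hle⟩ := QField.exists_inv_le (fun a => one_le_num) (sub_pos.2 hc)
  have h1 := h b
  have h2 : 1 / QField.ofNum (M.pow2 b) < 1 / QField.ofNum b :=
    one_div_lt_one_div_of_lt (QField.ofNum_pos hb) (QField.ofNum_lt.2 (lt_pow2 b))
  linarith

/-- An ultrafilter at infinity on the numbers of the model. -/
noncomputable def ultra (M : Str.{u}) [Model M] : Ultrafilter M.N :=
  haveI : Nonempty M.N := ⟨0⟩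
  Ultrafilter.of Filter.atTop

theorem ultra_le : (ultra M : Filter M.N) ≤ Filter.atTop := Ultrafilter.of_le _

/-- An ordered field extension of the rationals of the model in which every real number of the model
has a value, unique up to infinitesimals: the ultrapower by an ultrafilter at infinity on the
numbers of the model. -/
abbrev Hyp (M : Str.{u}) [Model M] : Type u := Filter.Germ (ultra M : Filter M.N) (Rat M)

/-- The embedding of the rationals of the model. -/
noncomputable def Rat.toHyp (x : Rat M) : Hyp M := (x : Filter.Germ (ultra M : Filter M.N) (Rat M))

/-- `2 ^ (-n)`. -/
noncomputable def ep (n : M.N) : Hyp M := Rat.toHyp (1 / QField.ofNum (M.pow2 n))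

theorem Rat.toHyp_le {x y : Rat M} : Rat.toHyp x ≤ Rat.toHyp y ↔ x ≤ y :=
  Filter.Germ.const_le_iff

theorem Rat.toHyp_lt {x y : Rat M} : Rat.toHyp x < Rat.toHyp y ↔ x < y :=
  Filter.Germ.const_lt_iff

theorem Rat.toHyp_add (x y : Rat M) : Rat.toHyp (x + y) = Rat.toHyp x + Rat.toHyp y := rfl
theorem Rat.toHyp_sub (x y : Rat M) : Rat.toHyp (x - y) = Rat.toHyp x - Rat.toHyp y := rfl
theorem Rat.toHyp_mul (x y : Rat M) : Rat.toHyp (x * y) = Rat.toHyp x * Rat.toHyp y := rfl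
theorem Rat.toHyp_zero : Rat.toHyp (0 : Rat M) = 0 := rfl
theorem Rat.toHyp_one : Rat.toHyp (1 : Rat M) = 1 := rfl

theorem ep_pos (n : M.N) : 0 < ep n := by
  rw [← Rat.toHyp_zero]
  exact Rat.toHyp_lt.2 (one_div_pos.2 (QField.ofNum_pos (pow2_pos n)))

theorem ep_zero : ep (0 : M.N) = 1 := by
  rw [ep, pow2_zero, map_one, div_one, Rat.toHyp_one]

theorem ep_half (n : M.N) : ep (n + 1) + ep (n + 1) = ep n := by
  rw [ep, ep, ← Rat.toHyp_add, pow2_succ, map_add]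
  congr 1
  have := (QField.ofNum_pos (pow2_pos n)).ne'
  field_simp

theorem ep_add (n k : M.N) : ep (n + k) = ep n * ep k := by
  rw [ep, ep, ep, ← Rat.toHyp_mul, pow2_add, map_mul, one_div_mul_one_div]

theorem ep_anti {n m : M.N} (h : n ≤ m) : ep m ≤ ep n := by
  obtain ⟨k, rfl⟩ := num_exists_add h
  refine Rat.toHyp_le.2 (one_div_le_one_div_of_le (QField.ofNum_pos (pow2_pos n))
    (QField.ofNum_le.2 ?_))
  rw [pow2_add]
  exact le_mul_of_one_le_right (zero_le_num _) (one_le_num (pow2_pos k))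

/-- The value of a fraction. -/
noncomputable def Frac.val (q : Frac M) : Hyp M :=
  Rat.toHyp ((QField.ofNum q.pos - QField.ofNum q.neg) / QField.ofNum q.den)

theorem Frac.val_le {q r : Frac M} (hq : 0 < q.den) (hr : 0 < r.den) :
    q ≤ r ↔ q.val ≤ r.val := by
  rw [Frac.val, Frac.val, Rat.toHyp_le,
    div_le_div_iff₀ (QField.ofNum_pos hq) (QField.ofNum_pos hr)]
  show q.pos * r.den + r.neg * q.den ≤ r.pos * q.den + q.neg * r.den ↔ _
  rw [← QField.ofNum_le]
  simp only [map_add, map_mul]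
  constructor <;> intro h <;> linarith

theorem Frac.val_lt {q r : Frac M} (hq : 0 < q.den) (hr : 0 < r.den) :
    q < r ↔ q.val < r.val := by
  rw [← not_le, ← Frac.val_le hr hq]
  show q.pos * r.den + r.neg * q.den < r.pos * q.den + q.neg * r.den ↔
    ¬ (r.pos * q.den + q.neg * r.den ≤ q.pos * r.den + r.neg * q.den)
  rw [not_le]

theorem Frac.den_add_pos {q r : Frac M} (hq : 0 < q.den) (hr : 0 < r.den) : 0 < (q + r).den :=
  mul_pos hq hr

theorem Frac.val_add {q r : Frac M} (hq : 0 < q.den) (hr : 0 < r.den) :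
    (q + r).val = q.val + r.val := by
  rw [Frac.val, Frac.val, Frac.val, ← Rat.toHyp_add]
  congr 1
  show (QField.ofNum (q.pos * r.den + r.pos * q.den) - QField.ofNum (q.neg * r.den + r.neg * q.den))
    / QField.ofNum (q.den * r.den) = _
  have h1 := (QField.ofNum_pos hq).ne'
  have h2 := (QField.ofNum_pos hr).ne'
  simp only [map_add, map_mul]
  field_simp
  ring

theorem Frac.val_zero : (0 : Frac M).val = 0 := by
  show Rat.toHyp ((QField.ofNum 0 - QField.ofNum 0) / QField.ofNum 1) = 0
  rw [sub_self, zero_div, Rat.toHyp_zero]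

theorem Frac.val_one : (1 : Frac M).val = 1 := by
  show Rat.toHyp ((QField.ofNum 1 - QField.ofNum 0) / QField.ofNum 1) = 1
  rw [map_one, map_zero, sub_zero, div_one, Rat.toHyp_one]

theorem val_eps (n : M.N) : (M.eps n).val = ep n := by
  show Rat.toHyp ((QField.ofNum 1 - QField.ofNum 0) / QField.ofNum (M.pow2 n)) = _
  rw [map_one, map_zero, sub_zero, ep]

theorem den_eps_pos (n : M.N) : 0 < (M.eps n).den := pow2_pos n

theorem den_zero_pos : 0 < (0 : Frac M).den := (zero_lt_one : (0 : M.N) < 1)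
theorem den_one_pos : 0 < (1 : Frac M).den := (zero_lt_one : (0 : M.N) < 1)

theorem den_decode_pos (c : M.N) : 0 < (M.decode c).den := by
  rw [Str.decode]
  split_ifs with h
  · exact h.choose_spec.1
  · exact den_zero_pos

/-- There are no infinitesimals among the rationals of the model. -/
theorem Frac.le_of_forall_val {q r : Frac M} (h : ∀ n : M.N, q.val ≤ r.val + ep n) :
    q.val ≤ r.val :=
  Rat.toHyp_le.2 (Rat.le_of_forall fun n => Rat.toHyp_le.1 (h n))

/-- The sequence `s` of fractions converges to `a` at the rate `2 ^ (-n)`. -/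
def HasVal (s : FSeq M) (a : Hyp M) : Prop :=
  (∀ n, 0 < (s n).den) ∧ ∀ n, (s n).val ≤ a + ep n ∧ a ≤ (s n).val + ep n

theorem HasVal.const {q : Frac M} (hq : 0 < q.den) : HasVal (FSeq.const q) q.val :=
  ⟨fun _ => hq, fun n => ⟨le_add_of_nonneg_right (ep_pos n).le,
    le_add_of_nonneg_right (ep_pos n).le⟩⟩

theorem HasVal.const_zero : HasVal (FSeq.const (0 : Frac M)) 0 := by
  simpa only [Frac.val_zero] using HasVal.const (den_zero_pos (M := M))

theorem HasVal.const_one : HasVal (FSeq.const (1 : Frac M)) 1 := by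
  simpa only [Frac.val_one] using HasVal.const (den_one_pos (M := M))

theorem HasVal.const_eps (n : M.N) : HasVal (FSeq.const (M.eps n)) (ep n) := by
  simpa only [val_eps] using HasVal.const (den_eps_pos n)

theorem HasVal.add {s t : FSeq M} {a b : Hyp M} (hs : HasVal s a) (ht : HasVal t b) :
    HasVal (FSeq.add s t) (a + b) := by
  refine ⟨fun n => Frac.den_add_pos (hs.1 _) (ht.1 _), fun n => ?_⟩
  rw [FSeq.add, Frac.val_add (hs.1 _) (ht.1 _)]
  have h1 := hs.2 (n + 1)
  have h2 := ht.2 (n + 1)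
  have h3 := ep_half n
  constructor <;> linarith

/-- The inequality of reals is the inequality of the values up to infinitesimals. -/
theorem HasVal.le_iff {s t : FSeq M} {a b : Hyp M} (hs : HasVal s a) (ht : HasVal t b) :
    FSeq.Le s t ↔ ∀ n, a ≤ b + ep n := by
  have hle : FSeq.Le s t ↔ ∀ n, (s n).val ≤ (t n).val + (ep n + ep n) := by
    refine forall_congr' fun n => ?_
    have hd := Frac.den_add_pos (den_eps_pos n) (den_eps_pos n)
    rw [Frac.val_le (hs.1 n) (Frac.den_add_pos (ht.1 n) hd), Frac.val_add (ht.1 n) hd,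
      Frac.val_add (den_eps_pos n) (den_eps_pos n), val_eps]
  rw [hle]
  constructor
  · intro h n
    have h0 := h (n + 1 + 1)
    have h1 := hs.2 (n + 1 + 1)
    have h2 := ht.2 (n + 1 + 1)
    have h3 := ep_half n
    have h4 := ep_half (n + 1)
    linarith
  · intro h n
    have hd := Frac.den_add_pos (den_eps_pos n) (den_eps_pos n)
    have key : (s n).val ≤ (t n + (M.eps n + M.eps n)).val := by
      refine Frac.le_of_forall_val fun m => ?_
      rw [Frac.val_add (ht.1 n) hd, Frac.val_add (den_eps_pos n) (den_eps_pos n), val_eps]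
      have h1 := hs.2 n
      have h2 := ht.2 n
      have h3 := h m
      linarith
    rwa [Frac.val_add (ht.1 n) hd, Frac.val_add (den_eps_pos n) (den_eps_pos n), val_eps] at key

/-- The strict inequality of reals leaves a gap between the values. -/
theorem HasVal.lt_iff {s t : FSeq M} {a b : Hyp M} (hs : HasVal s a) (ht : HasVal t b) :
    FSeq.Lt s t ↔ ∃ n, a + ep n < b := by
  have : FSeq.Lt s t ↔ ¬ FSeq.Le t s := by
    simp only [FSeq.Lt, FSeq.Le, not_forall]
    refine exists_congr fun n => ?_
    have hd := Frac.den_add_pos (hs.1 n) (Frac.den_add_pos (den_eps_pos n) (den_eps_pos n))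
    rw [Frac.val_lt hd (ht.1 n), Frac.val_le (ht.1 n) hd, not_le]
  rw [this, ht.le_iff hs]
  push Not
  rfl

theorem HasVal.eqv_iff {s t : FSeq M} {a b : Hyp M} (hs : HasVal s a) (ht : HasVal t b) :
    FSeq.Eqv s t ↔ ∀ n, |a - b| ≤ ep n := by
  rw [FSeq.Eqv, hs.le_iff ht, ht.le_iff hs, ← forall_and]
  refine forall_congr' fun n => ?_
  rw [abs_sub_le_iff]
  constructor <;> rintro ⟨h1, h2⟩ <;> constructor <;> linarith

theorem HasVal.close_iff {s t : FSeq M} {a b : Hyp M} (hs : HasVal s a) (ht : HasVal t b)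
    (k : M.N) : FSeq.Close s t k ↔ ∃ n, |a - b| + ep n < ep k := by
  rw [FSeq.Close, hs.lt_iff (ht.add (HasVal.const_eps k)),
    ht.lt_iff (hs.add (HasVal.const_eps k))]
  constructor
  · rintro ⟨⟨n, hn⟩, m, hm⟩
    refine ⟨n + m, ?_⟩
    have h1 := ep_anti (le_add_of_nonneg_right (zero_le_num m) : n ≤ n + m)
    have h2 := ep_anti (le_add_of_nonneg_left (zero_le_num n) : m ≤ n + m)
    rcases abs_cases (a - b) with h | h <;> rw [h.1] <;> linarith
  · rintro ⟨n, hn⟩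
    have h1 := le_abs_self (a - b)
    have h2 := neg_abs_le (a - b)
    exact ⟨⟨n, by linarith⟩, n, by linarith⟩

/-- The value of a real number of the model. -/
noncomputable def rv (x : M.Car FinType.one) : Hyp M :=
  ((fun n => (QField.ofNum (M.seq x n).pos - QField.ofNum (M.seq x n).neg) /
    QField.ofNum (M.seq x n).den : M.N → Rat M) : Filter.Germ (ultra M : Filter M.N) (Rat M))

theorem den_seq_pos (x : M.Car FinType.one) (n : M.N) : 0 < (M.seq x n).den := den_decode_pos _

theorem isReal_iff {x : M.Car FinType.one} : M.IsReal x ↔ ∀ n i : M.N,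
    (M.seq x n).val ≤ (M.seq x (n + i)).val + ep n ∧
    (M.seq x (n + i)).val ≤ (M.seq x n).val + ep n := by
  refine forall_congr' fun n => forall_congr' fun i => ?_
  rw [Frac.val_le (den_seq_pos _ _) (Frac.den_add_pos (den_seq_pos _ _) (den_eps_pos _)),
    Frac.val_le (den_seq_pos _ _) (Frac.den_add_pos (den_seq_pos _ _) (den_eps_pos _)),
    Frac.val_add (den_seq_pos _ _) (den_eps_pos _), Frac.val_add (den_seq_pos _ _) (den_eps_pos _),
    val_eps]

theorem hasVal_rv {x : M.Car FinType.one} (hx : M.IsReal x) : HasVal (M.seq x) (rv x) := by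
  rw [isReal_iff] at hx
  refine ⟨den_seq_pos x, fun n => ?_⟩
  have hev : ∀ᶠ m in (ultra M : Filter M.N), n ≤ m := ultra_le (Filter.eventually_ge_atTop n)
  constructor
  · refine Filter.Germ.coe_le.2 ?_
    filter_upwards [hev] with m hm
    obtain ⟨i, rfl⟩ := num_exists_add hm
    exact Rat.toHyp_le.1 (hx n i).1
  · refine Filter.Germ.coe_le.2 ?_
    filter_upwards [hev] with m hm
    obtain ⟨i, rfl⟩ := num_exists_add hm
    exact Rat.toHyp_le.1 (hx n i).2

/-- A sequence that converges twice as fast as required is a real number. -/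
theorem isReal_of_fast {x : M.Car FinType.one} {a : Hyp M}
    (h : ∀ n, |(M.seq x n).val - a| ≤ ep (n + 1)) : M.IsReal x ∧ HasVal (M.seq x) a := by
  have h' : ∀ n, (M.seq x n).val - a ≤ ep (n + 1) ∧ a - (M.seq x n).val ≤ ep (n + 1) :=
    fun n => abs_sub_le_iff.1 (h n)
  constructor
  · rw [isReal_iff]
    intro n i
    have h1 := h' n
    have h2 := h' (n + i)
    have h3 := ep_half n
    have h4 : ep (n + i + 1) ≤ ep (n + 1) := by
      apply ep_anti; gcongr; exact le_add_of_nonneg_right (zero_le_num i)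
    constructor <;> linarith
  · refine ⟨den_seq_pos x, fun n => ?_⟩
    have h1 := h' n
    have h3 := ep_half n
    have h4 := ep_pos (n + 1)
    constructor <;> linarith

/-- Values are unique up to infinitesimals. -/
theorem HasVal.unique {s : FSeq M} {a b : Hyp M} (ha : HasVal s a) (hb : HasVal s b) (n : M.N) :
    |a - b| ≤ ep n := by
  have h1 := ha.2 (n + 1)
  have h2 := hb.2 (n + 1)
  have h3 := ep_half n
  rw [abs_sub_le_iff]
  constructor <;> linarith

theorem hasVal_of_eqv {s t : FSeq M} {a b : Hyp M} (hs : HasVal s a) (ht : HasVal t b)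
    (h : ∀ n, |a - b| ≤ ep n) : FSeq.Eqv s t := (hs.eqv_iff ht).2 h

end Values

/-! ### Codes of fractions, and definable fractions and reals -/

section Codes

variable {M : Str.{u}} [Model M]

/-- The pairing function orders pairs by their sums first, hence it is injective. -/
theorem pair_lt_pair {i j i' j' : M.N} (h : i + j < i' + j') : M.pair i j < M.pair i' j' := by
  have h1 : i + j + 1 ≤ i' + j' := add_one_le_iff_num.2 h
  have hi := zero_le_num i
  have hj := zero_le_num j
  have hi' := zero_le_num i'
  show (i + j) * (i + j) + i < (i' + j') * (i' + j') + i'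
  calc (i + j) * (i + j) + i ≤ (i + j) * (i + j) + (i + j) :=
        add_le_add_right (le_add_of_nonneg_right hj) _
    _ < (i + j) * (i + j) + (i + j) + ((i + j) + 1) :=
        lt_add_of_pos_right _ (add_pos_of_nonneg_of_pos (add_nonneg hi hj) zero_lt_one)
    _ = (i + j + 1) * (i + j + 1) := by ring
    _ ≤ (i' + j') * (i' + j') :=
        mul_le_mul h1 h1 (zero_le_num _) (zero_le_num _)
    _ ≤ _ := le_add_of_nonneg_right hi'

theorem pair_inj {i j i' j' : M.N} (h : M.pair i j = M.pair i' j') : i = i' ∧ j = j' := by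
  have hs : i + j = i' + j' := by
    rcases lt_trichotomy (i + j) (i' + j') with h1 | h1 | h1
    · exact absurd h (pair_lt_pair h1).ne
    · exact h1
    · exact absurd h (pair_lt_pair h1).ne'
  have h2 : (i + j) * (i + j) + i = (i' + j') * (i' + j') + i' := h
  rw [hs] at h2
  have h3 := add_left_cancel h2
  subst h3
  exact ⟨rfl, add_left_cancel hs⟩

theorem codeFrac_inj {q r : Frac M} (h : M.codeFrac q = M.codeFrac r) : q = r := by
  obtain ⟨h1, h2⟩ := pair_inj h
  obtain ⟨h3, h4⟩ := pair_inj h1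
  cases q; cases r
  simp only [Frac.mk.injEq]
  exact ⟨h3, h4, h2⟩

theorem decode_codeFrac {q : Frac M} (hq : 0 < q.den) : M.decode (M.codeFrac q) = q := by
  have h : ∃ r : Frac M, 0 < r.den ∧ M.codeFrac r = M.codeFrac q := ⟨q, hq, rfl⟩
  rw [Str.decode, dif_pos h]
  exact codeFrac_inj h.choose_spec.2

variable {X : Type u} [Ctx M X]

theorem Rep.pair {F G : X → M.N} (hF : Rep F) (hG : Rep G) :
    Rep (fun x => M.pair (F x) (G x)) :=
  Rep.add (Rep.mul (Rep.add hF hG) (Rep.add hF hG)) hF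

theorem Rep.codeFrac_mk {F G H : X → M.N} (hF : Rep F) (hG : Rep G) (hH : Rep H) :
    Rep (fun x => M.codeFrac ⟨F x, G x, H x⟩) :=
  Rep.pair (Rep.pair hF hG) hH

/-- The components of a decoded fraction are definable: decoding is an unbounded search, which
`Rep.of_graph` makes available. -/
theorem Rep.decode_component (π : Frac M → M.N)
    (hπ : Rep (fun p : ((((M.N × M.N) × M.N) × M.N) × M.N) => π ⟨p.1.1.2, p.1.2, p.2⟩))
    {F : X → M.N} (hF : Rep F) : Rep (fun x => π (M.decode (F x))) := by
  have key : Rep (fun c : M.N => π (M.decode c)) := by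
    have h1 : Dec (M := M) (fun p : (((M.N × M.N) × M.N) × M.N) × M.N =>
        0 < p.2 ∧ M.codeFrac ⟨p.1.1.2, p.1.2, p.2⟩ = p.1.1.1.1) :=
      Dec.and (Dec.lt (Rep.const 0) Rep.snd)
        (Dec.eq (Rep.codeFrac_mk Rep.var2 Rep.var1 Rep.snd) (Rep.fst Rep.id3))
    have h2 : Dec (M := M) (fun p : (((M.N × M.N) × M.N) × M.N) × M.N =>
        (0 < p.2 ∧ M.codeFrac ⟨p.1.1.2, p.1.2, p.2⟩ = p.1.1.1.1) →
          π ⟨p.1.1.2, p.1.2, p.2⟩ = p.1.1.1.2) :=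
      Dec.imp h1 (Dec.eq hπ (Rep.fst Rep.var2))
    have h3 : Dec (M := M) (fun p : M.N × M.N => ∀ a b c : M.N,
        (0 < c ∧ M.codeFrac ⟨a, b, c⟩ = p.1) → π ⟨a, b, c⟩ = p.2) :=
      Dec.all (P := fun (p : M.N × M.N) a => ∀ b c : M.N,
        (0 < c ∧ M.codeFrac ⟨a, b, c⟩ = p.1) → π ⟨a, b, c⟩ = p.2)
      (Dec.all (P := fun (p : (M.N × M.N) × M.N) b => ∀ c : M.N,
        (0 < c ∧ M.codeFrac ⟨p.2, b, c⟩ = p.1.1) → π ⟨p.2, b, c⟩ = p.1.2)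
      (Dec.all (P := fun (p : ((M.N × M.N) × M.N) × M.N) c =>
        (0 < c ∧ M.codeFrac ⟨p.1.2, p.2, c⟩ = p.1.1.1) → π ⟨p.1.2, p.2, c⟩ = p.1.1.2) h2))
    have h4 : Dec (M := M) (fun p : M.N × M.N => ∃ a b c : M.N,
        (0 < c ∧ M.codeFrac ⟨a, b, c⟩ = p.1)) :=
      Dec.ex (P := fun (p : M.N × M.N) a => ∃ b c : M.N,
        (0 < c ∧ M.codeFrac ⟨a, b, c⟩ = p.1))
      (Dec.ex (P := fun (p : (M.N × M.N) × M.N) b => ∃ c : M.N,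
        (0 < c ∧ M.codeFrac ⟨p.2, b, c⟩ = p.1.1))
      (Dec.ex (P := fun (p : ((M.N × M.N) × M.N) × M.N) c =>
        (0 < c ∧ M.codeFrac ⟨p.1.2, p.2, c⟩ = p.1.1.1)) h1))
    refine Rep.of_graph (Dec.congr (Dec.and h3 (Dec.or h4
      (Dec.eq (Rep.const (π 0)) Rep.snd))) fun p => ?_)
    by_cases hp : ∃ a b c : M.N, 0 < c ∧ M.codeFrac ⟨a, b, c⟩ = p.1
    · obtain ⟨a, b, c, hc, h⟩ := hp
      have hd : M.decode p.1 = ⟨a, b, c⟩ := by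
        rw [← h]; exact decode_codeFrac (q := ⟨a, b, c⟩) hc
      rw [hd]
      constructor
      · rintro ⟨h5, -⟩
        exact h5 a b c ⟨hc, h⟩
      · intro h5
        refine ⟨fun a' b' c' h6 => ?_, Or.inl ⟨a, b, c, hc, h⟩⟩
        rw [codeFrac_inj (h6.2.trans h.symm)]
        exact h5
    · have hd : M.decode p.1 = 0 := by
        rw [Str.decode, dif_neg]
        rintro ⟨⟨a, b, c⟩, hq⟩
        exact hp ⟨a, b, c, hq⟩
      rw [hd]
      constructor
      · rintro ⟨-, h5⟩
        exact h5.resolve_left hp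
      · intro h5
        exact ⟨fun a b c h6 => absurd ⟨a, b, c, h6⟩ hp, Or.inr h5⟩
  obtain ⟨f, hf⟩ := key
  exact ((Rep.const f).app hF).congr fun x => hf (F x)

/-- The components of the fraction-valued function `F` on a context are represented. -/
def RepQ (F : X → Frac M) : Prop :=
  Rep (fun x => (F x).pos) ∧ Rep (fun x => (F x).neg) ∧ Rep (fun x => (F x).den)

theorem RepQ.const (q : Frac M) : RepQ (fun _ : X => q) :=
  ⟨Rep.const _, Rep.const _, Rep.const _⟩

theorem RepQ.decode {F : X → M.N} (hF : Rep F) : RepQ (fun x => M.decode (F x)) :=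
  ⟨Rep.decode_component _ Rep.var2 hF, Rep.decode_component _ Rep.var1 hF,
    Rep.decode_component _ Rep.snd hF⟩

theorem RepQ.seq {F : X → M.Car FinType.one} {n : X → M.N} (hF : Rep F) (hn : Rep n) :
    RepQ (fun x => M.seq (F x) (n x)) := RepQ.decode (hF.app hn)

theorem RepQ.add {F G : X → Frac M} (hF : RepQ F) (hG : RepQ G) : RepQ (fun x => F x + G x) :=
  ⟨Rep.add (Rep.mul hF.1 hG.2.2) (Rep.mul hG.1 hF.2.2),
    Rep.add (Rep.mul hF.2.1 hG.2.2) (Rep.mul hG.2.1 hF.2.2), Rep.mul hF.2.2 hG.2.2⟩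

theorem RepQ.eps {n : X → M.N} (hn : Rep n) : RepQ (fun x => M.eps (n x)) :=
  ⟨Rep.const 1, Rep.const 0, Rep.pow2 hn⟩

theorem RepQ.ite {P : X → Prop} [∀ x, Decidable (P x)] {F G : X → Frac M} (hP : Dec (M := M) P)
    (hF : RepQ F) (hG : RepQ G) : RepQ (fun x => if P x then F x else G x) := by
  refine ⟨(Rep.ite hP hF.1 hG.1).congr fun x => ?_, (Rep.ite hP hF.2.1 hG.2.1).congr fun x => ?_,
    (Rep.ite hP hF.2.2 hG.2.2).congr fun x => ?_⟩ <;> show _ = _ <;> dsimp only <;> split_ifs <;> rfl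

theorem Dec.qle {F G : X → Frac M} (hF : RepQ F) (hG : RepQ G) :
    Dec (M := M) (fun x => F x ≤ G x) :=
  Dec.le (Rep.add (Rep.mul hF.1 hG.2.2) (Rep.mul hG.2.1 hF.2.2))
    (Rep.add (Rep.mul hG.1 hF.2.2) (Rep.mul hF.2.1 hG.2.2))

theorem Dec.qlt {F G : X → Frac M} (hF : RepQ F) (hG : RepQ G) :
    Dec (M := M) (fun x => F x < G x) :=
  Dec.lt (Rep.add (Rep.mul hF.1 hG.2.2) (Rep.mul hG.2.1 hF.2.2))
    (Rep.add (Rep.mul hG.1 hF.2.2) (Rep.mul hF.2.1 hG.2.2))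

/-- The sequence of fractions `s x` is definable from `x`. -/
def RepS (s : X → FSeq M) : Prop := RepQ (fun p : X × M.N => s p.1 p.2)

theorem RepS.const {F : X → Frac M} (hF : RepQ F) : RepS (fun x => FSeq.const (F x)) :=
  ⟨Rep.fst hF.1, Rep.fst hF.2.1, Rep.fst hF.2.2⟩

theorem RepS.seq {F : X → M.Car FinType.one} (hF : Rep F) : RepS (fun x => M.seq (F x)) :=
  RepQ.seq (Rep.fst hF) Rep.snd

theorem Dec.sle {s t : X → FSeq M} (hs : RepS s) (ht : RepS t) :
    Dec (M := M) (fun x => FSeq.Le (s x) (t x)) :=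
  Dec.all (P := fun x n => s x n ≤ t x n + (M.eps n + M.eps n))
    (Dec.qle hs (RepQ.add ht (RepQ.add (RepQ.eps Rep.snd) (RepQ.eps Rep.snd))))

theorem Dec.slt {s t : X → FSeq M} (hs : RepS s) (ht : RepS t) :
    Dec (M := M) (fun x => FSeq.Lt (s x) (t x)) :=
  Dec.ex (P := fun x n => s x n + (M.eps n + M.eps n) < t x n)
    (Dec.qlt (RepQ.add hs (RepQ.add (RepQ.eps Rep.snd) (RepQ.eps Rep.snd))) ht)

theorem Dec.seqv {s t : X → FSeq M} (hs : RepS s) (ht : RepS t) :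
    Dec (M := M) (fun x => FSeq.Eqv (s x) (t x)) := Dec.and (Dec.sle hs ht) (Dec.sle ht hs)

theorem Dec.isReal {F : X → M.Car FinType.one} (hF : Rep F) :
    Dec (M := M) (fun x => M.IsReal (F x)) := by
  have h1 : RepQ (fun p : (X × M.N) × M.N => M.seq (F p.1.1) p.1.2) :=
    RepQ.seq (Rep.fst (Rep.fst hF)) Rep.var1
  have h2 : RepQ (fun p : (X × M.N) × M.N => M.seq (F p.1.1) (p.1.2 + p.2)) :=
    RepQ.seq (Rep.fst (Rep.fst hF)) (Rep.add Rep.var1 Rep.snd)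
  have h3 : RepQ (fun p : (X × M.N) × M.N => M.eps p.1.2) := RepQ.eps Rep.var1
  exact Dec.all (P := fun x n => ∀ i : M.N, M.seq (F x) n ≤ M.seq (F x) (n + i) + M.eps n ∧
      M.seq (F x) (n + i) ≤ M.seq (F x) n + M.eps n)
    (Dec.all (P := fun (p : X × M.N) i => M.seq (F p.1) p.2 ≤ M.seq (F p.1) (p.2 + i) + M.eps p.2 ∧
      M.seq (F p.1) (p.2 + i) ≤ M.seq (F p.1) p.2 + M.eps p.2)
      (Dec.and (Dec.qle h1 (RepQ.add h2 h3)) (Dec.qle h2 (RepQ.add h1 h3))))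

theorem Dec.unit_mem {F : X → M.Car FinType.one} (hF : Rep F) :
    Dec (M := M) (fun x => (Dom.unit M).mem (F x)) :=
  Dec.and (Dec.isReal hF) (Dec.and (Dec.sle (RepS.const (RepQ.const 0)) (RepS.seq hF))
    (Dec.sle (RepS.seq hF) (RepS.const (RepQ.const 1))))

theorem seq_congr {x y : M.Car FinType.one} (h : M.eqT _ x y) : M.seq x = M.seq y := by
  funext n
  have : x ⬝ n = y ⬝ n := h n
  rw [Str.seq, Str.seq, this]

theorem isReal_congr {x y : M.Car FinType.one} (h : M.seq x = M.seq y) :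
    M.IsReal x ↔ M.IsReal y := by
  unfold Str.IsReal
  rw [h]

/-- Definable sequences of fractions are coded by definable objects of type `1`. -/
theorem RepS.exists_code {s : X → FSeq M} (hs : RepS s) (hd : ∀ x n, 0 < (s x n).den) :
    ∃ G : X → M.Car FinType.one, Rep G ∧ ∀ x, M.seq (G x) = s x := by
  obtain ⟨G, hG, h⟩ := Rep.lam (F := fun x n => M.codeFrac (s x n))
    (Rep.codeFrac_mk hs.1 hs.2.1 hs.2.2)
  refine ⟨G, hG, fun x => funext fun n => ?_⟩
  have : G x ⬝ n = M.codeFrac (s x n) := h x n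
  rw [Str.seq, this, decode_codeFrac (hd x n)]

theorem RepS.exists_fun {σ : FinType} {s : M.Car σ → FSeq M} (hs : RepS s)
    (hd : ∀ x n, 0 < (s x n).den) :
    ∃ g : M.Car (σ ⇾ FinType.one), ∀ x, M.seq (g ⬝ x) = s x := by
  obtain ⟨G, ⟨g, hg⟩, h⟩ := hs.exists_code hd
  exact ⟨g, fun x => (seq_congr (hg x)).trans (h x)⟩

theorem exists_comp {σ τ ρ : FinType} (f : M.Car (τ ⇾ ρ)) (g : M.Car (σ ⇾ τ)) :
    ∃ h : M.Car (σ ⇾ ρ), ∀ x, M.eqT ρ (h ⬝ x) (f ⬝ (g ⬝ x)) :=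
  Rep.app (Rep.const f) (Rep.app (Rep.const g) Rep.id)

end Codes

/-! ### Operations on reals -/

section Operations

variable {M : Str.{u}} [Model M]

namespace Frac

/-- The difference of two fractions. -/
def sub (q r : Frac M) : Frac M :=
  ⟨q.pos * r.den + r.neg * q.den, q.neg * r.den + r.pos * q.den, q.den * r.den⟩

/-- The product of a fraction and a number. -/
def nmul (m : M.N) (q : Frac M) : Frac M := ⟨m * q.pos, m * q.neg, q.den⟩

/-- The quotient of a fraction and a number. -/
def ndiv (q : Frac M) (m : M.N) : Frac M := ⟨q.pos, q.neg, q.den * m⟩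

theorem val_sub {q r : Frac M} (hq : 0 < q.den) (hr : 0 < r.den) :
    (q.sub r).val = q.val - r.val := by
  rw [Frac.val, Frac.val, Frac.val, ← Rat.toHyp_sub]
  congr 1
  have h1 := (QField.ofNum_pos hq).ne'
  have h2 := (QField.ofNum_pos hr).ne'
  simp only [sub, map_add, map_mul]
  field_simp
  ring

theorem val_nmul_pow2 (k : M.N) (q : Frac M) : (q.nmul (M.pow2 k)).val = q.val / ep k := by
  rw [eq_div_iff (ep_pos k).ne', Frac.val, Frac.val, ep, ← Rat.toHyp_mul]
  congr 1
  have h1 := (QField.ofNum_pos (pow2_pos k)).ne'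
  simp only [nmul, map_mul]
  field_simp

theorem val_ndiv_pow2 (k : M.N) {q : Frac M} (hq : 0 < q.den) :
    (q.ndiv (M.pow2 k)).val = q.val * ep k := by
  rw [Frac.val, Frac.val, ep, ← Rat.toHyp_mul]
  congr 1
  have h1 := (QField.ofNum_pos (pow2_pos k)).ne'
  have h2 := (QField.ofNum_pos hq).ne'
  simp only [ndiv, map_mul]
  field_simp

end Frac

theorem RepQ.sub {X : Type u} [Ctx M X] {F G : X → Frac M} (hF : RepQ F) (hG : RepQ G) :
    RepQ (fun x => (F x).sub (G x)) :=
  ⟨Rep.add (Rep.mul hF.1 hG.2.2) (Rep.mul hG.2.1 hF.2.2),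
    Rep.add (Rep.mul hF.2.1 hG.2.2) (Rep.mul hG.1 hF.2.2), Rep.mul hF.2.2 hG.2.2⟩

theorem RepQ.nmul {X : Type u} [Ctx M X] (m : M.N) {F : X → Frac M} (hF : RepQ F) :
    RepQ (fun x => (F x).nmul m) :=
  ⟨Rep.mul (Rep.const m) hF.1, Rep.mul (Rep.const m) hF.2.1, hF.2.2⟩

theorem RepQ.ndiv {X : Type u} [Ctx M X] {F : X → Frac M} (hF : RepQ F) (m : M.N) :
    RepQ (fun x => (F x).ndiv m) :=
  ⟨hF.1, hF.2.1, Rep.mul hF.2.2 (Rep.const m)⟩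

/-- The distance function of the reals. -/
theorem exists_dist (M : Str.{u}) [Model M] :
    ∃ d : M.Car (FinType.one ⇾ FinType.one ⇾ FinType.one), ∀ x y,
    M.IsReal x → M.IsReal y → M.IsReal (d ⬝ x ⬝ y) ∧ HasVal (M.seq (d ⬝ x ⬝ y)) |rv x - rv y| := by
  classical
  let s : M.Car FinType.one × M.Car FinType.one → FSeq M := fun p n =>
    if M.seq p.1 (n + (1 + 1)) ≤ M.seq p.2 (n + (1 + 1)) then
      (M.seq p.2 (n + (1 + 1))).sub (M.seq p.1 (n + (1 + 1)))
    else (M.seq p.1 (n + (1 + 1))).sub (M.seq p.2 (n + (1 + 1)))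
  have h1 : RepQ (fun p : (M.Car FinType.one × M.Car FinType.one) × M.N =>
      M.seq p.1.1 (p.2 + (1 + 1))) := RepQ.seq Rep.id2 (Rep.add Rep.snd (Rep.const _))
  have h2 : RepQ (fun p : (M.Car FinType.one × M.Car FinType.one) × M.N =>
      M.seq p.1.2 (p.2 + (1 + 1))) := RepQ.seq Rep.var1 (Rep.add Rep.snd (Rep.const _))
  have hs : RepS s := RepQ.ite (Dec.qle h1 h2) (RepQ.sub h2 h1) (RepQ.sub h1 h2)
  have hv : ∀ p n, 0 < (s p n).den ∧
      (s p n).val = |(M.seq p.1 (n + (1 + 1))).val - (M.seq p.2 (n + (1 + 1))).val| := by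
    intro p n
    have e1 := den_seq_pos p.1 (n + (1 + 1))
    have e2 := den_seq_pos p.2 (n + (1 + 1))
    simp only [s]
    split_ifs with h <;> rw [Frac.val_le e1 e2] at h
    · refine ⟨mul_pos e2 e1, ?_⟩
      rw [Frac.val_sub e2 e1, abs_of_nonpos (by linarith), neg_sub]
    · refine ⟨mul_pos e1 e2, ?_⟩
      rw [Frac.val_sub e1 e2, abs_of_nonneg (by linarith)]
  obtain ⟨G, ⟨d, hd⟩, hG⟩ := hs.exists_code (fun p n => (hv p n).1)
  refine ⟨d, fun x y hx hy => ?_⟩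
  have hseq : M.seq (d ⬝ x ⬝ y) = s (x, y) := (seq_congr (hd (x, y))).trans (hG _)
  refine isReal_of_fast fun n => ?_
  rw [hseq, (hv _ _).2]
  have h3 := (hasVal_rv hx).2 (n + (1 + 1))
  have h4 := (hasVal_rv hy).2 (n + (1 + 1))
  have h5 := ep_half (n + 1)
  rw [add_assoc] at h5
  refine (abs_abs_sub_abs_le_abs_sub _ _).trans ?_
  rw [abs_sub_le_iff]
  constructor <;> linarith

/-- The function `min(1, 2 ^ k * x)` on the reals. -/
theorem exists_trunc (k : M.N) : ∃ t : M.Car (FinType.one ⇾ FinType.one), ∀ x a,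
    HasVal (M.seq x) a → M.IsReal (t ⬝ x) ∧ HasVal (M.seq (t ⬝ x)) (min 1 (a / ep k)) := by
  classical
  let s : M.Car FinType.one → FSeq M := fun x n =>
    if (M.seq x (n + 1 + k)).nmul (M.pow2 k) ≤ 1 then (M.seq x (n + 1 + k)).nmul (M.pow2 k) else 1
  have h1 : RepQ (fun p : M.Car FinType.one × M.N => (M.seq p.1 (p.2 + 1 + k)).nmul (M.pow2 k)) :=
    RepQ.nmul _ (RepQ.seq Rep.id1 (Rep.add (Rep.add Rep.snd (Rep.const _)) (Rep.const _)))
  have hs : RepS s := RepQ.ite (Dec.qle h1 (RepQ.const 1)) h1 (RepQ.const 1)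
  have hv : ∀ x n, 0 < (s x n).den ∧ (s x n).val = min 1 ((M.seq x (n + 1 + k)).val / ep k) := by
    intro x n
    have e1 : 0 < ((M.seq x (n + 1 + k)).nmul (M.pow2 k)).den := den_seq_pos x _
    simp only [s]
    split_ifs with h <;> rw [Frac.val_le e1 den_one_pos, Frac.val_one, Frac.val_nmul_pow2] at h
    · exact ⟨e1, by rw [Frac.val_nmul_pow2, min_eq_right h]⟩
    · exact ⟨den_one_pos, by rw [Frac.val_one, min_eq_left (not_le.1 h).le]⟩
  obtain ⟨t, ht⟩ := hs.exists_fun (fun p n => (hv p n).1)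
  refine ⟨t, fun x a hx => ?_⟩
  refine isReal_of_fast fun n => ?_
  rw [ht, (hv _ _).2]
  refine (abs_min_sub_min_le_max _ _ _ _).trans ?_
  rw [sub_self, abs_zero, max_eq_right (abs_nonneg _), ← sub_div, abs_div, abs_of_pos (ep_pos k),
    div_le_iff₀ (ep_pos k), ← ep_add, abs_sub_le_iff]
  have h3 := hx.2 (n + 1 + k)
  constructor <;> linarith

/-- The function `q + 2 ^ (-k) * x` on the reals. -/
theorem exists_affine {q : Frac M} (hq : 0 < q.den) (k : M.N) :
    ∃ t : M.Car (FinType.one ⇾ FinType.one), ∀ x,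
    M.IsReal x → M.IsReal (t ⬝ x) ∧ HasVal (M.seq (t ⬝ x)) (q.val + rv x * ep k) := by
  let s : M.Car FinType.one → FSeq M := fun x n => q + (M.seq x (n + 1)).ndiv (M.pow2 k)
  have hs : RepS s := RepQ.add (RepQ.const q)
    (RepQ.ndiv (RepQ.seq Rep.id1 (Rep.add Rep.snd (Rep.const _))) _)
  have hd : ∀ x n, 0 < ((M.seq x (n + 1)).ndiv (M.pow2 k)).den := fun x n =>
    mul_pos (den_seq_pos x _) (pow2_pos k)
  obtain ⟨t, ht⟩ := hs.exists_fun (fun x n => Frac.den_add_pos hq (hd x n))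
  refine ⟨t, fun x hx => isReal_of_fast fun n => ?_⟩
  rw [ht, Frac.val_add hq (hd x n), Frac.val_ndiv_pow2 _ (den_seq_pos x _), add_sub_add_left_eq_sub,
    ← sub_mul, abs_mul, abs_of_pos (ep_pos k)]
  have h3 := (hasVal_rv hx).2 (n + 1)
  have h4 : ep k ≤ 1 := by rw [← ep_zero]; exact ep_anti (zero_le_num k)
  refine (mul_le_of_le_one_right (abs_nonneg _) h4).trans ?_
  rw [abs_sub_le_iff]
  constructor <;> linarith

/-- Every real has a representation that depends on its equivalence class only: the `n`-th term is
the fraction with least code that is close enough. -/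
theorem exists_canonical (M : Str.{u}) [Model M] :
    ∃ c : M.Car (FinType.one ⇾ FinType.one),
    (∀ x, M.IsReal x → M.IsReal (c ⬝ x) ∧ FSeq.Eqv (M.seq (c ⬝ x)) (M.seq x)) ∧
    ∀ x y, M.IsReal x → M.IsReal y → FSeq.Eqv (M.seq x) (M.seq y) → M.eqT _ (c ⬝ x) (c ⬝ y) := by
  let P : M.Car FinType.one × M.N → M.N → Prop := fun p i => M.IsReal p.1 →
    FSeq.Le (FSeq.const (M.decode i)) (FSeq.add (M.seq p.1) (FSeq.const (M.eps (p.2 + (1 + 1))))) ∧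
    FSeq.Le (M.seq p.1) (FSeq.const (M.decode i + M.eps (p.2 + (1 + 1))))
  have hP : ∀ x n i, P (x, n) i ↔ (M.IsReal x → ∀ m,
      |(M.decode i).val - rv x| ≤ ep (n + (1 + 1)) + ep m) := by
    intro x n i
    refine imp_congr_right fun hx => ?_
    have hd := Frac.den_add_pos (den_decode_pos i) (den_eps_pos (n + (1 + 1)))
    rw [(HasVal.const (den_decode_pos i)).le_iff ((hasVal_rv hx).add (HasVal.const_eps _)),
      (hasVal_rv hx).le_iff (HasVal.const hd), ← forall_and,
      Frac.val_add (den_decode_pos i) (den_eps_pos _), val_eps]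
    refine forall_congr' fun m => ?_
    rw [abs_sub_le_iff]
    constructor <;> rintro ⟨h1, h2⟩ <;> constructor <;> linarith
  have hdec : Dec (M := M) (fun p : (M.Car FinType.one × M.N) × M.N => P p.1 p.2) := by
    have e1 : RepQ (fun p : (M.Car FinType.one × M.N) × M.N => M.decode p.2) := RepQ.decode Rep.snd
    have e2 : RepQ (fun p : (M.Car FinType.one × M.N) × M.N => M.eps (p.1.2 + (1 + 1))) :=
      RepQ.eps (Rep.add Rep.var1 (Rep.const _))
    have e3 : RepS (fun p : (M.Car FinType.one × M.N) × M.N =>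
        FSeq.add (M.seq p.1.1) (FSeq.const (M.eps (p.1.2 + (1 + 1))))) :=
      RepQ.add (RepQ.seq (Rep.fst Rep.id2) (Rep.add Rep.snd (Rep.const 1)))
        (RepQ.eps (Rep.add Rep.var2 (Rep.const _)))
    exact Dec.imp (Dec.isReal Rep.id2) (Dec.and (Dec.sle (RepS.const e1) e3)
      (Dec.sle (RepS.seq Rep.id2) (RepS.const (RepQ.add e1 e2))))
  -- the term of the given sequence shows that there is a fraction close enough
  obtain ⟨F, hF, hFP⟩ := Rep.exists_least hdec (fun p => ⟨p.1 ⬝ (p.2 + (1 + 1)), by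
    rw [← Prod.mk.eta (p := p), hP]
    intro hx m
    have h1 := (hasVal_rv hx).2 (p.2 + (1 + 1))
    have h2 := ep_pos m
    simp only [Str.seq] at h1
    rw [abs_sub_le_iff]
    constructor <;> linarith⟩)
  obtain ⟨G, ⟨c, hc⟩, hG⟩ := Rep.lam (F := fun x n => F (x, n)) hF
  have hcF : ∀ x (n : M.N), c ⬝ x ⬝ n = F (x, n) := fun x n =>
    eqT_trans (σ := .zero) (hc x n) (hG x n)
  refine ⟨c, fun x hx => ?_, fun x y hx hy h n => ?_⟩
  · have := isReal_of_fast (x := c ⬝ x) (a := rv x) (fun n => by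
      have h1 := (hP x n (F (x, n))).1 (hFP (x, n)).1 hx (n + (1 + 1))
      have h2 := ep_half (n + 1)
      rw [add_assoc] at h2
      rw [Str.seq, hcF]
      linarith)
    exact ⟨this.1, hasVal_of_eqv this.2 (hasVal_rv hx) fun n => by
      rw [sub_self, abs_zero]; exact (ep_pos n).le⟩
  · show c ⬝ x ⬝ n = c ⬝ y ⬝ n
    rw [hcF, hcF]
    have hv := ((hasVal_rv hx).eqv_iff (hasVal_rv hy)).1 h
    have hiff : ∀ i, P (x, n) i ↔ P (y, n) i := by
      intro i
      rw [hP, hP]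
      have key : ∀ a b : Hyp M, (∀ m, |a - b| ≤ ep m) →
          (∀ m, |(M.decode i).val - a| ≤ ep (n + (1 + 1)) + ep m) →
          ∀ m, |(M.decode i).val - b| ≤ ep (n + (1 + 1)) + ep m := by
        intro a b hab ha m
        have h1 := ha (m + 1)
        have h2 := hab (m + 1)
        have h3 := ep_half m
        have h4 := abs_sub_le (M.decode i).val a b
        linarith
      exact ⟨fun h1 _ => key _ _ hv (h1 hx),
        fun h1 _ => key _ _ (fun m => by rw [abs_sub_comm]; exact hv m) (h1 hy)⟩
    exact le_antisymm ((hFP (x, n)).2 _ ((hiff _).2 (hFP (y, n)).1))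
      ((hFP (y, n)).2 _ ((hiff _).1 (hFP (x, n)).1))

/-- The constant sequence with value the fraction coded by a number. -/
def ratObj (c : M.N) : M.Car FinType.one := M.cst (.combK .zero .zero) ⬝ c

theorem seq_ratObj (c : M.N) : M.seq (ratObj c) = FSeq.const (M.decode c) := by
  funext n
  have : ratObj c ⬝ n = c := (rca M).combK .zero .zero c n
  rw [Str.seq, this, FSeq.const]

theorem isReal_ratObj (c : M.N) : M.IsReal (ratObj c) ∧
    HasVal (M.seq (ratObj c)) (M.decode c).val :=
  isReal_of_fast fun n => by
    rw [seq_ratObj, FSeq.const, sub_self, abs_zero]; exact (ep_pos _).le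

theorem Rep.ratObj {X : Type u} [Ctx M X] {F : X → M.N} (hF : Rep F) :
    Rep (fun x => HOA.ratObj (F x)) := (Rep.const _).app hF

end Operations

/-! ### Reals and the unit interval -/

section UnitInterval

variable {M : Str.{u}} [Model M]

theorem HasVal.not_lt {s t : FSeq M} {a b : Hyp M} (hs : HasVal s a) (ht : HasVal t b) :
    ¬ FSeq.Lt s t ↔ FSeq.Le t s := by
  rw [hs.lt_iff ht, ht.le_iff hs]
  push Not
  rfl

theorem real_eqv_refl {x : M.Car FinType.one} (hx : M.IsReal x) :
    FSeq.Eqv (M.seq x) (M.seq x) :=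
  hasVal_of_eqv (hasVal_rv hx) (hasVal_rv hx) fun n => by
    rw [sub_self, abs_zero]; exact (ep_pos n).le

theorem real_eqv_symm {s t : FSeq M} (h : FSeq.Eqv s t) : FSeq.Eqv t s := ⟨h.2, h.1⟩

theorem HasVal.eqv_trans {s t w : FSeq M} {a b c : Hyp M} (hs : HasVal s a) (ht : HasVal t b)
    (hw : HasVal w c) (h : FSeq.Eqv s t) (h' : FSeq.Eqv t w) : FSeq.Eqv s w := by
  rw [hs.eqv_iff ht] at h
  rw [ht.eqv_iff hw] at h'
  rw [hs.eqv_iff hw]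
  intro n
  have h1 := h (n + 1)
  have h2 := h' (n + 1)
  have h3 := ep_half n
  have h4 := abs_sub_le a b c
  linarith

theorem real_eqv_trans {x y z : M.Car FinType.one} (hx : M.IsReal x) (hy : M.IsReal y)
    (hz : M.IsReal z) (h : FSeq.Eqv (M.seq x) (M.seq y)) (h' : FSeq.Eqv (M.seq y) (M.seq z)) :
    FSeq.Eqv (M.seq x) (M.seq z) :=
  (hasVal_rv hx).eqv_trans (hasVal_rv hy) (hasVal_rv hz) h h'

theorem unit_mem_iff {x : M.Car FinType.one} (hx : M.IsReal x) :
    (Dom.unit M).mem x ↔ ∀ n, 0 ≤ rv x + ep n ∧ rv x ≤ 1 + ep n := by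
  rw [forall_and, ← HasVal.const_zero.le_iff (hasVal_rv hx),
    ← (hasVal_rv hx).le_iff HasVal.const_one]
  exact and_iff_right hx

theorem unit_mem_congr {x y : M.Car FinType.one} (hx : (Dom.unit M).mem x) (hy : M.IsReal y)
    (h : FSeq.Eqv (M.seq y) (M.seq x)) : (Dom.unit M).mem y := by
  rw [unit_mem_iff hy]
  have h1 := (unit_mem_iff hx.1).1 hx
  have h2 := ((hasVal_rv hy).eqv_iff (hasVal_rv hx.1)).1 h
  intro n
  have h3 := h1 (n + 1)
  have h4 := abs_sub_le_iff.1 (h2 (n + 1))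
  have h5 := ep_half n
  constructor <;> linarith

theorem not_eqv_iff {s t : FSeq M} {a b : Hyp M} (hs : HasVal s a) (ht : HasVal t b) :
    ¬ FSeq.Eqv s t ↔ ∃ n, ep n < |a - b| := by
  rw [hs.eqv_iff ht]
  push Not
  rfl

theorem HasVal.le_congr {s t s' t' : FSeq M} {a b a' b' : Hyp M} (hs : HasVal s a) (ht : HasVal t b)
    (hs' : HasVal s' a') (ht' : HasVal t' b') (h1 : FSeq.Eqv s s') (h2 : FSeq.Eqv t t')
    (h : FSeq.Le s t) : FSeq.Le s' t' := by
  rw [hs.eqv_iff hs'] at h1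
  rw [ht.eqv_iff ht'] at h2
  rw [hs.le_iff ht] at h
  rw [hs'.le_iff ht']
  intro n
  have e1 := abs_sub_le_iff.1 (h1 (n + 1 + 1))
  have e2 := abs_sub_le_iff.1 (h2 (n + 1 + 1))
  have e3 := h (n + 1)
  have e4 := ep_half n
  have e5 := ep_half (n + 1)
  linarith

end UnitInterval

/-! ### Connectedness and intermediate values -/

section Connected

variable {M : Str.{u}} [Model M] {ρ τ : FinType}

theorem Dom.isSubset_of_char {D : Dom M ρ} {U : M.Car (ρ ⇾ .zero)} {P : M.Car ρ → Prop}
    (hU : ∀ x, (U ⬝ x = 0 ∨ U ⬝ x = 1) ∧ (U ⬝ x = 1 ↔ P x))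
    (hP : ∀ x y, D.mem x → D.mem y → D.eqv x y → (P x ↔ P y)) : D.IsSubset U := by
  refine ⟨fun x _ => (hU x).1, fun x y hx hy h => ?_⟩
  have hiff : U ⬝ x = 1 ↔ U ⬝ y = 1 := by rw [(hU x).2, (hU y).2, hP x y hx hy h]
  rcases (hU x).1 with h0 | h1
  · rcases (hU y).1 with h0' | h1'
    · rw [h0, h0']
    · rw [hiff.2 h1', h1']
  · rw [h1, hiff.1 h1]

/-- Intermediate values. The hypothesis `hop` says that `h` is continuous for the topology with the
open sets `IsOpen`. -/
theorem Dom.Connected.exists_value {D : Dom M ρ} {IsOpen : M.Car (ρ ⇾ .zero) → Prop}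
    (hconn : D.Connected IsOpen) {h : M.Car (ρ ⇾ FinType.one)}
    (hreal : ∀ x, D.mem x → M.IsReal (h ⬝ x))
    (heqv : ∀ x y, D.mem x → D.mem y → D.eqv x y → FSeq.Eqv (M.seq (h ⬝ x)) (M.seq (h ⬝ y)))
    (hop : ∀ U, D.IsSubset U → (∀ x, D.mem x → U ⬝ x = 1 →
      ∃ k : M.N, ∀ y, D.mem y → |rv (h ⬝ x) - rv (h ⬝ y)| ≤ ep k → U ⬝ y = 1) → IsOpen U)
    {x₀ x₁ : M.Car ρ} (hx₀ : D.mem x₀) (hx₁ : D.mem x₁) {r : M.Car FinType.one} (hr : M.IsReal r)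
    (h₀ : FSeq.Le (M.seq (h ⬝ x₀)) (M.seq r)) (h₁ : FSeq.Le (M.seq r) (M.seq (h ⬝ x₁))) :
    ∃ x, D.mem x ∧ FSeq.Eqv (M.seq (h ⬝ x)) (M.seq r) := by
  by_contra hc
  push Not at hc
  -- otherwise `{h < r}` and `{h > r}` disconnect the space
  have hv := fun x hx => hasVal_rv (hreal x hx)
  have hvr := hasVal_rv hr
  have hhx : RepS (fun x : M.Car ρ => M.seq (h ⬝ x)) := RepS.seq (Rep.app (Rep.const h) Rep.id)
  have hrr : RepS (fun _ : M.Car ρ => M.seq r) := RepS.seq (Rep.const r)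
  obtain ⟨U, hU⟩ := (Dec.slt hhx hrr).exists_char
  obtain ⟨V, hV⟩ := (Dec.slt hrr hhx).exists_char
  refine hconn ⟨U, V, hop U (Dom.isSubset_of_char hU ?_) ?_, hop V (Dom.isSubset_of_char hV ?_) ?_,
    ⟨x₀, hx₀, ?_⟩, ⟨x₁, hx₁, ?_⟩, ?_, ?_⟩
  · intro x y hx hy hxy
    rw [← not_iff_not, (hv x hx).not_lt hvr, (hv y hy).not_lt hvr]
    have hrr := real_eqv_refl hr
    exact ⟨HasVal.le_congr hvr (hv x hx) hvr (hv y hy) hrr (heqv x y hx hy hxy),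
      HasVal.le_congr hvr (hv y hy) hvr (hv x hx) hrr (real_eqv_symm (heqv x y hx hy hxy))⟩
  · intro x hx hUx
    obtain ⟨n, hn⟩ := ((hv x hx).lt_iff hvr).1 ((hU x).2.1 hUx)
    refine ⟨n + 1, fun y hy hxy => (hU y).2.2 (((hv y hy).lt_iff hvr).2 ⟨n + 1, ?_⟩)⟩
    have := abs_sub_le_iff.1 hxy
    have := ep_half n
    linarith
  · intro x y hx hy hxy
    rw [← not_iff_not, hvr.not_lt (hv x hx), hvr.not_lt (hv y hy)]
    have hrr := real_eqv_refl hr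
    exact ⟨HasVal.le_congr (hv x hx) hvr (hv y hy) hvr (heqv x y hx hy hxy) hrr,
      HasVal.le_congr (hv y hy) hvr (hv x hx) hvr (real_eqv_symm (heqv x y hx hy hxy)) hrr⟩
  · intro x hx hVx
    obtain ⟨n, hn⟩ := (hvr.lt_iff (hv x hx)).1 ((hV x).2.1 hVx)
    refine ⟨n + 1, fun y hy hxy => (hV y).2.2 ((hvr.lt_iff (hv y hy)).2 ⟨n + 1, ?_⟩)⟩
    have := abs_sub_le_iff.1 hxy
    have := ep_half n
    linarith
  · rw [(hU x₀).2]
    by_contra hlt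
    exact hc x₀ hx₀ ⟨h₀, ((hv x₀ hx₀).not_lt hvr).1 hlt⟩
  · rw [(hV x₁).2]
    by_contra hlt
    exact hc x₁ hx₁ ⟨(hvr.not_lt (hv x₁ hx₁)).1 hlt, h₁⟩
  · intro x hx
    rw [(hU x).2, (hV x).2]
    by_contra hlt
    push Not at hlt
    exact hc x hx ⟨(hvr.not_lt (hv x hx)).1 hlt.2, ((hv x hx).not_lt hvr).1 hlt.1⟩
  · rintro ⟨x, hx, hUx, hVx⟩
    obtain ⟨n, hn⟩ := ((hv x hx).lt_iff hvr).1 ((hU x).2.1 hUx)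
    obtain ⟨m, hm⟩ := (hvr.lt_iff (hv x hx)).1 ((hV x).2.1 hVx)
    have := ep_pos n
    have := ep_pos m
    linarith

/-- A connected metric space with at least two points maps onto the unit interval: the distance from
a point, suitably scaled and truncated, is such a map. -/
theorem exists_onto_unit {D : Dom M ρ} {d : M.Car (ρ ⇾ ρ ⇾ FinType.one)} (hd : D.IsMetric d)
    (hrefl : ∀ x, D.mem x → D.eqv x x) (hconn : D.MetricConnected d) (h2 : D.TwoPoints) :
    ∃ h : M.Car (ρ ⇾ FinType.one), (∀ x, D.mem x → M.IsReal (h ⬝ x)) ∧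
      (∀ x y, D.mem x → D.mem y → D.eqv x y → FSeq.Eqv (M.seq (h ⬝ x)) (M.seq (h ⬝ y))) ∧
      ∀ r, (Dom.unit M).mem r → ∃ x, D.mem x ∧ FSeq.Eqv (M.seq (h ⬝ x)) (M.seq r) := by
  obtain ⟨x₀, x₁, hx₀, hx₁, hne⟩ := h2
  have hv := fun x y hx hy => hasVal_rv (hd.real x y hx hy)
  have hnn : ∀ x y, D.mem x → D.mem y → ∀ n, 0 ≤ rv (d ⬝ x ⬝ y) + ep n := fun x y hx hy =>
    (HasVal.const_zero.le_iff (hv x y hx hy)).1 (hd.nonneg x y hx hy)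
  rw [← hd.eq_zero _ _ hx₀ hx₁, not_eqv_iff (hv _ _ hx₀ hx₁) HasVal.const_zero, sub_zero] at hne
  obtain ⟨n, hn⟩ := hne
  have hn : ep n ≤ rv (d ⬝ x₀ ⬝ x₁) := by
    have := hnn x₀ x₁ hx₀ hx₁ n
    rcases abs_cases (rv (d ⬝ x₀ ⬝ x₁)) with h | h <;> linarith
  obtain ⟨t, ht⟩ := exists_trunc (M := M) n
  obtain ⟨h, hh⟩ := exists_comp t (d ⬝ x₀)
  have hseq : ∀ x, M.seq (h ⬝ x) = M.seq (t ⬝ (d ⬝ x₀ ⬝ x)) := fun x => seq_congr (hh x)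
  have hreal : ∀ x, D.mem x → M.IsReal (h ⬝ x) := fun x hx =>
    (isReal_congr (hseq x)).2 (ht _ _ (hv _ _ hx₀ hx)).1
  have hval : ∀ x, D.mem x → HasVal (M.seq (h ⬝ x)) (min 1 (rv (d ⬝ x₀ ⬝ x) / ep n)) :=
    fun x hx => by rw [hseq]; exact (ht _ _ (hv _ _ hx₀ hx)).2
  -- the map is Lipschitz with respect to the distance from `x₀`
  have hlip : ∀ x y k, |rv (d ⬝ x₀ ⬝ x) - rv (d ⬝ x₀ ⬝ y)| ≤ ep (n + k) →
      |min 1 (rv (d ⬝ x₀ ⬝ x) / ep n) - min 1 (rv (d ⬝ x₀ ⬝ y) / ep n)| ≤ ep k := by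
    intro x y k hk
    refine (abs_min_sub_min_le_max _ _ _ _).trans ?_
    rw [sub_self, abs_zero, max_eq_right (abs_nonneg _), ← sub_div, abs_div, abs_of_pos (ep_pos n),
      div_le_iff₀ (ep_pos n), mul_comm, ← ep_add]
    exact hk
  have heqv : ∀ x y, D.mem x → D.mem y → D.eqv x y →
      FSeq.Eqv (M.seq (h ⬝ x)) (M.seq (h ⬝ y)) := by
    intro x y hx hy hxy
    rw [(hval x hx).eqv_iff (hval y hy)]
    intro k
    refine hlip x y k ?_
    exact ((hv _ _ hx₀ hx).eqv_iff (hv _ _ hx₀ hy)).1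
      (hd.congr _ _ _ _ hx₀ hx₀ hx hy (hrefl _ hx₀) hxy) _
  refine ⟨h, hreal, heqv, fun r hr => ?_⟩
  have hr' := (unit_mem_iff hr.1).1 hr
  refine Dom.Connected.exists_value hconn hreal heqv ?_ hx₀ hx₁ hr.1 ?_ ?_
  · refine fun U hU hop => ⟨hU, fun x hx hUx => ?_⟩
    obtain ⟨k, hk⟩ := hop x hx hUx
    refine ⟨n + (k + 1) + 1, fun y hy hnear => hk y hy ?_⟩
    obtain ⟨j, hj⟩ := ((hv x y hx hy).lt_iff (HasVal.const_eps _)).1 hnear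
    have e1 := ((hv x₀ y hx₀ hy).le_iff ((hv x₀ x hx₀ hx).add (hv x y hx hy))).1
      (hd.triangle x₀ x y hx₀ hx hy) (n + (k + 1) + 1)
    have e2 := ((hv x₀ x hx₀ hx).le_iff ((hv x₀ y hx₀ hy).add (hv y x hy hx))).1
      (hd.triangle x₀ y x hx₀ hy hx) j
    have e3 := abs_sub_le_iff.1 (((hv x y hx hy).eqv_iff (hv y x hy hx)).1 (hd.symm x y hx hy)
      (n + (k + 1) + 1))
    have e4 := ep_half (n + (k + 1))
    have e5 := ep_pos j
    have e6 := hlip x y (k + 1) (by rw [abs_sub_le_iff]; constructor <;> linarith)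
    have e7 := (hasVal_rv (hreal x hx)).unique (hval x hx) (k + 1 + 1)
    have e8 := (hasVal_rv (hreal y hy)).unique (hval y hy) (k + 1 + 1)
    have e9 := ep_half k
    have e10 := ep_half (k + 1)
    rw [abs_sub_le_iff] at e6 e7 e8 ⊢
    constructor <;> linarith
  · rw [(hval x₀ hx₀).le_iff (hasVal_rv hr.1)]
    intro m
    have e1 := abs_sub_le_iff.1 (((hv x₀ x₀ hx₀ hx₀).eqv_iff HasVal.const_zero).1
      ((hd.eq_zero _ _ hx₀ hx₀).2 (hrefl _ hx₀)) (n + (m + 1)))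
    have e2 := (hr' (m + 1)).1
    have e3 := ep_half m
    have e4 : rv (d ⬝ x₀ ⬝ x₀) / ep n ≤ ep (m + 1) := by
      rw [div_le_iff₀ (ep_pos n), mul_comm, ← ep_add]
      linarith
    have e5 := min_le_right 1 (rv (d ⬝ x₀ ⬝ x₀) / ep n)
    linarith
  · rw [(hasVal_rv hr.1).le_iff (hval x₁ hx₁)]
    intro m
    rw [min_eq_left ((one_le_div₀ (ep_pos n)).2 hn)]
    exact (hr' m).2

end Connected

/-! ### Consequences of `NIN` -/

section OfNIN

variable {M : Str.{u}} [Model M]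

/-- If a part `P` of Baire space is mapped onto the unit interval by `h`, then any `W` with
values in the numbers takes the same value at points with different images under `h`. -/
theorem NIN.exists_ne (hN : NIN M) (hac : M.QFAC FinType.one FinType.one)
    {P : M.Car FinType.one → Prop} (hP : Dec (M := M) P) {h : M.Car (FinType.one ⇾ FinType.one)}
    (hreal : ∀ x, P x → M.IsReal (h ⬝ x))
    (honto : ∀ r, (Dom.unit M).mem r → ∃ x, P x ∧ FSeq.Eqv (M.seq (h ⬝ x)) (M.seq r))
    (W : M.Car (FinType.one ⇾ .zero)) :
    ∃ x y, P x ∧ P y ∧ ¬ FSeq.Eqv (M.seq (h ⬝ x)) (M.seq (h ⬝ y)) ∧ W ⬝ x = W ⬝ y := by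
  classical
  have hdec : Dec (M := M) (fun p : M.Car FinType.one × M.Car FinType.one =>
      (Dom.unit M).mem p.1 → P p.2 ∧ FSeq.Eqv (M.seq (h ⬝ p.2)) (M.seq p.1)) := by
    refine Dec.imp (Dec.unit_mem Rep.id1) (Dec.and ?_ (Dec.seqv
      (RepS.seq (Rep.app (Rep.const h) Rep.snd)) (RepS.seq Rep.id1)))
    obtain ⟨χ, hχ⟩ := hP.exists_char
    exact (Dec.eq (Rep.app (Rep.const χ) Rep.snd) (Rep.const 1)).congr fun p => (hχ _).2
  obtain ⟨χ, hχ'⟩ := hdec.exists_rel (P := fun r x =>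
    (Dom.unit M).mem r → P x ∧ FSeq.Eqv (M.seq (h ⬝ x)) (M.seq r))
  have hχ := fun r x => (hχ' r x).2
  obtain ⟨Φ, hΦ⟩ := exists_choice hac χ (fun r => by
    by_cases hr : (Dom.unit M).mem r
    · obtain ⟨x, hx⟩ := honto r hr
      exact ⟨x, (hχ r x).2 fun _ => hx⟩
    · exact ⟨r, (hχ r r).2 fun h => absurd h hr⟩)
  have hΦ : ∀ r, (Dom.unit M).mem r → P (Φ ⬝ r) ∧ FSeq.Eqv (M.seq (h ⬝ (Φ ⬝ r))) (M.seq r) :=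
    fun r => (hχ _ _).1 (hΦ r)
  -- the choice is made to depend on the real only, not on its representation
  obtain ⟨c, hc1, hc2⟩ := exists_canonical M
  obtain ⟨Z, hZ⟩ : Rep (fun x : M.Car FinType.one => W ⬝ (Φ ⬝ (c ⬝ x))) :=
    Rep.app (Rep.const W) (Rep.app (Rep.const Φ) (Rep.app (Rep.const c) Rep.id))
  have hZ : ∀ x, Z ⬝ x = W ⬝ (Φ ⬝ (c ⬝ x)) := hZ
  obtain ⟨x, y, hx, hy, hne, hxy⟩ := hN Z ⟨fun _ _ => trivial, fun x y hx hy h => by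
    show Z ⬝ x = Z ⬝ y
    rw [hZ, hZ]
    exact (rca M).ext _ _ W _ _ ((rca M).ext _ _ Φ _ _ (hc2 x y hx.1 hy.1 h))⟩
  have key : ∀ x, (Dom.unit M).mem x →
      P (Φ ⬝ (c ⬝ x)) ∧ FSeq.Eqv (M.seq (h ⬝ (Φ ⬝ (c ⬝ x)))) (M.seq x) := fun x hx => by
    have h1 := hc1 x hx.1
    have h2 := hΦ _ (unit_mem_congr hx h1.1 h1.2)
    exact ⟨h2.1, real_eqv_trans (hreal _ h2.1) h1.1 hx.1 h2.2 h1.2⟩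
  obtain ⟨hPx, hex⟩ := key x hx
  obtain ⟨hPy, hey⟩ := key y hy
  refine ⟨_, _, hPx, hPy, fun he => hne ?_, by rw [← hZ, ← hZ]; exact hxy⟩
  exact real_eqv_trans hx.1 (hreal _ hPx) hy.1 (real_eqv_symm hex)
    (real_eqv_trans (hreal _ hPx) (hreal _ hPy) hy.1 he hey)

theorem Dec.real_sub_mem (S : M.Car (FinType.one ⇾ .zero)) :
    Dec (M := M) ((Dom.real M).sub S).mem :=
  Dec.and (Dec.isReal Rep.id) (Dec.eq (Rep.app (Rep.const S) Rep.id) (Rep.const 1))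

theorem NIN.surjectsOntoUnit (hN : NIN M) (hac : M.QFAC FinType.one FinType.one) :
    SurjectsOntoUnit M := by
  intro X f hX hf hsurj Y hY
  obtain ⟨x, y, hx, hy, hne, hxy⟩ := hN.exists_ne hac (Dec.real_sub_mem X)
    (fun x hx => (hf.1 x hx).1) hsurj Y
  exact ⟨x, y, hx, hy, fun h => hne (hf.2 x y hx hy h), hxy⟩

theorem Dom.IsMetric.sub {ρ : FinType} {D : Dom M ρ} {d : M.Car (ρ ⇾ ρ ⇾ FinType.one)}
    (hd : D.IsMetric d) (A : M.Car (ρ ⇾ .zero)) : (D.sub A).IsMetric d where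
  real x y hx hy := hd.real x y hx.1 hy.1
  congr x x' y y' hx hx' hy hy' := hd.congr x x' y y' hx.1 hx'.1 hy.1 hy'.1
  nonneg x y hx hy := hd.nonneg x y hx.1 hy.1
  eq_zero x y hx hy := hd.eq_zero x y hx.1 hy.1
  symm x y hx hy := hd.symm x y hx.1 hy.1
  triangle x y z hx hy hz := hd.triangle x y z hx.1 hy.1 hz.1

theorem NIN.connectedSubset (hN : NIN M) (hac : M.QFAC FinType.one FinType.one) :
    ConnectedSubset M := by
  intro S A d hS hA hconn h2 Y hY
  obtain ⟨h, hreal, heqv, honto⟩ := exists_onto_unit (hS.2.sub A)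
    (fun x hx => real_eqv_refl hx.1.1) hconn h2
  obtain ⟨x, y, hx, hy, hne, hxy⟩ := hN.exists_ne hac
    (P := (((Dom.real M).sub S).sub A).mem)
    (Dec.and (Dec.real_sub_mem S) (Dec.eq (Rep.app (Rep.const A) Rep.id) (Rep.const 1)))
    hreal honto Y
  exact ⟨x, y, hx, hy, fun h => hne (heqv x y hx hy h), hxy⟩

theorem NIN.surjectsOntoConnected (hN : NIN M) (hac : M.QFAC FinType.one FinType.one) :
    SurjectsOntoConnected M := by
  intro S₀ S₁ d₀ d₁ f h₀ h₁ h2 hconn hf hsurj Y hY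
  obtain ⟨h, hreal, heqv, honto⟩ := exists_onto_unit h₀.2 (fun x hx => real_eqv_refl hx.1) hconn h2
  obtain ⟨g, hg⟩ := exists_comp h f
  have hseq : ∀ x, M.seq (g ⬝ x) = M.seq (h ⬝ (f ⬝ x)) := fun x => seq_congr (hg x)
  obtain ⟨x, y, hx, hy, hne, hxy⟩ := hN.exists_ne hac (Dec.real_sub_mem S₁) (h := g)
    (fun x hx => (isReal_congr (hseq x)).2 (hreal _ (hf.1 x hx))) (fun r hr => by
      obtain ⟨y, hy, hyr⟩ := honto r hr
      obtain ⟨x, hx, hxy⟩ := hsurj y hy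
      refine ⟨x, hx, ?_⟩
      rw [hseq]
      exact real_eqv_trans (hreal _ (hf.1 x hx)) (hreal _ hy) hr.1
        (heqv _ _ (hf.1 x hx) hy hxy) hyr) Y
  refine ⟨x, y, hx, hy, fun h => hne ?_, hxy⟩
  rw [hseq, hseq]
  exact heqv _ _ (hf.1 x hx) (hf.1 y hy) (hf.2 x y hx hy h)

theorem NIN.metricImage (hN : NIN M) (hac : M.QFAC FinType.one FinType.one) : MetricImage M := by
  intro ρ S d S₀ d₀ f Z hS hconn hS₀ hf hcont hZ h2 Y hY
  have hfrefl : ∀ x, ((Dom.real M).sub S).mem x → (Dom.ofMetric S₀ d₀).eqv (f ⬝ x) (f ⬝ x) :=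
    fun x hx => hf.2 x x hx hx (real_eqv_refl hx.1)
  have hfZ : ∀ x, ((Dom.real M).sub S).mem x → ((Dom.ofMetric S₀ d₀).sub Z).mem (f ⬝ x) :=
    fun x hx => ⟨hf.1 x hx, (hZ.2 _ (hf.1 x hx)).2 ⟨x, hx, hfrefl x hx⟩⟩
  have hd := hS₀.2.sub Z
  -- Equality on `S₀` is distance `0`, so the axioms of a metric do not give `d₀ y y = 0` for all
  -- `y`. On the range of `f` it follows from the triangle inequality.
  have hrefl : ∀ y, ((Dom.ofMetric S₀ d₀).sub Z).mem y →
      ((Dom.ofMetric S₀ d₀).sub Z).eqv y y := by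
    intro y hy
    obtain ⟨x, hx, hxy⟩ := (hZ.2 y hy.1).1 hy.2
    have hv := fun x y hx hy => hasVal_rv (hd.real x y hx hy)
    have hx' := hfZ x hx
    have e1 := ((hv y y hy hy).le_iff ((hv _ _ hy hx').add (hv _ _ hx' hy))).1
      (hd.triangle y (f ⬝ x) y hy hx' hy)
    have e2 := ((hv _ _ hx' hy).eqv_iff (hv _ _ hy hx')).1 (hd.symm _ _ hx' hy)
    have e3 := ((hv _ _ hx' hy).eqv_iff HasVal.const_zero).1 hxy
    have e4 := (HasVal.const_zero.le_iff (hv y y hy hy)).1 (hd.nonneg y y hy hy)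
    refine hasVal_of_eqv (hv y y hy hy) HasVal.const_zero fun n => ?_
    have f1 := e1 (n + 1)
    have f2 := abs_sub_le_iff.1 (e2 (n + 1 + 1))
    have f3 := abs_sub_le_iff.1 (e3 (n + 1 + 1 + 1))
    have f4 := e4 n
    have f5 := ep_half n
    have f6 := ep_half (n + 1)
    have f7 := ep_half (n + 1 + 1)
    rw [abs_sub_le_iff]
    constructor <;> linarith
  -- the image of a connected space is connected
  have hconnZ : ((Dom.ofMetric S₀ d₀).sub Z).MetricConnected d₀ := by
    rintro ⟨U, V, hU, hV, ⟨u, hu, hUu⟩, ⟨v, hv, hVv⟩, hcov, hdisj⟩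
    have hpull : ∀ W : M.Car (ρ ⇾ .zero), ((Dom.ofMetric S₀ d₀).sub Z).MetricOpen d₀ W →
        ∃ W' : M.Car (FinType.one ⇾ .zero), ((Dom.real M).sub S).MetricOpen d W' ∧
          ∀ x, W' ⬝ x = W ⬝ (f ⬝ x) := by
      intro W hW
      obtain ⟨W', hW'⟩ := exists_comp W f
      have hW' : ∀ x, W' ⬝ x = W ⬝ (f ⬝ x) := hW'
      refine ⟨W', ⟨⟨fun x hx => ?_, fun x y hx hy hxy => ?_⟩, fun x hx h1 => ?_⟩, hW'⟩
      · rw [hW']; exact hW.1.1 _ (hfZ x hx)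
      · rw [hW', hW']; exact hW.1.2 _ _ (hfZ x hx) (hfZ y hy) (hf.2 x y hx hy hxy)
      · rw [hW'] at h1
        obtain ⟨k, hk⟩ := hW.2 _ (hfZ x hx) h1
        obtain ⟨m, hm⟩ := hcont x hx k
        exact ⟨m, fun y hy hn => by rw [hW']; exact hk _ (hfZ y hy) (hm y hy hn)⟩
    have hpt : ∀ W, ((Dom.ofMetric S₀ d₀).sub Z).MetricOpen d₀ W →
        ∀ y, ((Dom.ofMetric S₀ d₀).sub Z).mem y → W ⬝ y = 1 →
          ∃ x, ((Dom.real M).sub S).mem x ∧ W ⬝ (f ⬝ x) = 1 := by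
      intro W hW y hy h1
      obtain ⟨x, hx, hxy⟩ := (hZ.2 y hy.1).1 hy.2
      exact ⟨x, hx, (hW.1.2 _ _ (hfZ x hx) hy hxy).trans h1⟩
    obtain ⟨U', hU', hU'f⟩ := hpull U hU
    obtain ⟨V', hV', hV'f⟩ := hpull V hV
    obtain ⟨u', hu', hu'1⟩ := hpt U hU u hu hUu
    obtain ⟨v', hv', hv'1⟩ := hpt V hV v hv hVv
    refine hconn ⟨U', V', hU', hV', ⟨u', hu', (hU'f u').trans hu'1⟩,
      ⟨v', hv', (hV'f v').trans hv'1⟩, fun x hx => ?_, ?_⟩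
    · rw [hU'f, hV'f]; exact hcov _ (hfZ x hx)
    · rintro ⟨x, hx, h1, h3⟩
      exact hdisj ⟨f ⬝ x, hfZ x hx, (hU'f x).symm.trans h1, (hV'f x).symm.trans h3⟩
  obtain ⟨h, hreal, heqv, honto⟩ := exists_onto_unit hd hrefl hconnZ h2
  obtain ⟨g, hg⟩ := exists_comp h f
  have hseq : ∀ x, M.seq (g ⬝ x) = M.seq (h ⬝ (f ⬝ x)) := fun x => seq_congr (hg x)
  obtain ⟨W, hW⟩ := exists_comp Y f
  have hW : ∀ x, W ⬝ x = Y ⬝ (f ⬝ x) := hW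
  obtain ⟨x, y, hx, hy, hne, hxy⟩ := hN.exists_ne hac (Dec.real_sub_mem S) (h := g)
    (fun x hx => (isReal_congr (hseq x)).2 (hreal _ (hfZ x hx))) (fun r hr => by
      obtain ⟨y, hy, hyr⟩ := honto r hr
      obtain ⟨x, hx, hxy⟩ := (hZ.2 y hy.1).1 hy.2
      refine ⟨x, hx, ?_⟩
      rw [hseq]
      exact real_eqv_trans (hreal _ (hfZ x hx)) (hreal _ hy) hr.1
        (heqv _ _ (hfZ x hx) hy hxy) hyr) W
  refine ⟨f ⬝ x, f ⬝ y, hfZ x hx, hfZ y hy, fun h => hne ?_, by rw [← hW, ← hW]; exact hxy⟩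
  rw [hseq, hseq]
  exact heqv _ _ (hfZ x hx) (hfZ y hy) h

theorem NIN.secondCountable (hN : NIN M) (hac : M.QFAC FinType.one FinType.one) :
    SecondCountable M := by
  intro X B hX hB hconn hfh h2 Y hY
  obtain ⟨x₀, x₁, hx₀, hx₁, hne⟩ := h2
  obtain ⟨f, hf, hcont, hf₀, hf₁⟩ := hfh x₀ x₁ hx₀ hx₁ hne
  have hreal : ∀ x, ((Dom.real M).sub X).mem x → M.IsReal (f ⬝ x) := fun x hx => (hf.1 x hx).1
  obtain ⟨x, y, hx, hy, hne, hxy⟩ := hN.exists_ne hac (Dec.real_sub_mem X) (h := f) hreal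
    (fun r hr => by
      have hrr := real_eqv_refl hr.1
      refine Dom.Connected.exists_value hconn hreal hf.2 ?_ hx₀ hx₁ hr.1
        (HasVal.le_congr HasVal.const_zero (hasVal_rv hr.1) (hasVal_rv (hreal _ hx₀)) (hasVal_rv hr.1)
          (real_eqv_symm hf₀) hrr hr.2.1)
        (HasVal.le_congr (hasVal_rv hr.1) HasVal.const_one (hasVal_rv hr.1) (hasVal_rv (hreal _ hx₁))
          hrr (real_eqv_symm hf₁) hr.2.2)
      refine fun U hU hop => ⟨hU, fun x hx hUx => ?_⟩
      obtain ⟨k, hk⟩ := hop x hx hUx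
      obtain ⟨n, hn, hn'⟩ := hcont x hx k
      refine ⟨n, hn, fun y hy hBy => hk y hy ?_⟩
      obtain ⟨j, hj⟩ := ((hasVal_rv (hreal x hx)).close_iff (hasVal_rv (hreal y hy)) k).1
        (hn' y hy hBy)
      have := ep_pos j
      linarith) Y
  exact ⟨x, y, hx, hy, fun h => hne (hf.2 x y hx hy h), hxy⟩

/-- A non-degenerate interval contains a scaled copy of the unit interval with rational left end
point. -/
theorem exists_unit_to_interval {y₀ y₁ : M.Car FinType.one} (hy₀ : M.IsReal y₀) (hy₁ : M.IsReal y₁)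
    {n : M.N} (hn : rv y₀ + ep n ≤ rv y₁) :
    ∃ t : M.Car (FinType.one ⇾ FinType.one), (∀ r, (Dom.unit M).mem r → M.IsReal (t ⬝ r) ∧
      FSeq.Le (M.seq y₀) (M.seq (t ⬝ r)) ∧ FSeq.Le (M.seq (t ⬝ r)) (M.seq y₁)) ∧
    ∀ r r', (Dom.unit M).mem r → (Dom.unit M).mem r' →
      (FSeq.Eqv (M.seq (t ⬝ r)) (M.seq (t ⬝ r')) ↔ FSeq.Eqv (M.seq r) (M.seq r')) := by
  obtain ⟨q, hq, hq0, hq1⟩ : ∃ q : Frac M, 0 < q.den ∧ rv y₀ ≤ q.val ∧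
      q.val + ep (n + 1) ≤ rv y₁ := by
    refine ⟨M.seq y₀ (n + 1 + 1) + M.eps (n + 1 + 1),
      Frac.den_add_pos (den_seq_pos _ _) (den_eps_pos _), ?_⟩
    rw [Frac.val_add (den_seq_pos _ _) (den_eps_pos _), val_eps]
    have e1 := (hasVal_rv hy₀).2 (n + 1 + 1)
    have e2 := ep_half n
    have e3 := ep_half (n + 1)
    constructor <;> linarith
  obtain ⟨t, ht⟩ := exists_affine hq (n + 1)
  have hp := ep_pos (n + 1)
  have hle1 : ep (n + 1) ≤ (1 : Hyp M) := by rw [← ep_zero]; exact ep_anti (zero_le_num _)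
  refine ⟨t, fun r hr => ?_, fun r r' hr hr' => ?_⟩
  · have hr' := (unit_mem_iff hr.1).1 hr
    obtain ⟨htr, htv⟩ := ht r hr.1
    refine ⟨htr, ((hasVal_rv hy₀).le_iff htv).2 fun m => ?_,
      (htv.le_iff (hasVal_rv hy₁)).2 fun m => ?_⟩
    · have e4 := mul_le_mul_of_nonneg_right (hr' m).1 (ep_pos (n + 1)).le
      have e6 := mul_le_of_le_one_right (ep_pos m).le hle1
      rw [zero_mul, add_mul] at e4
      linarith
    · have e5 := mul_le_mul_of_nonneg_right (hr' m).2 (ep_pos (n + 1)).le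
      have e6 := mul_le_of_le_one_right (ep_pos m).le hle1
      rw [add_mul, one_mul] at e5
      linarith
  · have hdiff : |q.val + rv r * ep (n + 1) - (q.val + rv r' * ep (n + 1))| =
        |rv r - rv r'| * ep (n + 1) := by
      rw [add_sub_add_left_eq_sub, ← sub_mul, abs_mul, abs_of_pos hp]
    rw [(ht r hr.1).2.eqv_iff (ht r' hr'.1).2, (hasVal_rv hr.1).eqv_iff (hasVal_rv hr'.1), hdiff]
    constructor
    · intro h m
      have h1 := h (m + (n + 1))
      rw [ep_add m (n + 1)] at h1
      exact le_of_mul_le_mul_right h1 hp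
    · intro h m
      exact (mul_le_of_le_one_right (abs_nonneg _) hle1).trans (h m)

/-- Here no choice is needed: an interval with distinct end points is contained in the image. -/
theorem NIN.realImage (hN : NIN M) : RealImage M := by
  intro S d f Z hS hconn hf hcont hZ h2 Y hY
  -- the two given points, in increasing order
  obtain ⟨y₀, y₁, hy₀, hy₁, n, hn⟩ : ∃ y₀ y₁, ((Dom.real M).sub Z).mem y₀ ∧
      ((Dom.real M).sub Z).mem y₁ ∧ ∃ n, rv y₀ + ep n ≤ rv y₁ := by
    obtain ⟨y₀, y₁, hy₀, hy₁, hne⟩ := h2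
    obtain ⟨n, hn⟩ := (not_eqv_iff (hasVal_rv hy₀.1) (hasVal_rv hy₁.1)).1 hne
    rcases abs_cases (rv y₀ - rv y₁) with h | h
    · exact ⟨y₁, y₀, hy₁, hy₀, n, by linarith⟩
    · exact ⟨y₀, y₁, hy₀, hy₁, n, by linarith⟩
  obtain ⟨x₀, hx₀, he₀⟩ := (hZ.2 y₀ hy₀.1).1 hy₀.2
  obtain ⟨x₁, hx₁, he₁⟩ := (hZ.2 y₁ hy₁.1).1 hy₁.2
  obtain ⟨t, ht, htt⟩ := exists_unit_to_interval hy₀.1 hy₁.1 hn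
  have hmem : ∀ r, (Dom.unit M).mem r → ((Dom.real M).sub Z).mem (t ⬝ r) := by
    intro r hr
    obtain ⟨htr, h₀, h₁⟩ := ht r hr
    refine ⟨htr, (hZ.2 _ htr).2 ?_⟩
    have hv := hasVal_rv htr
    refine Dom.Connected.exists_value hconn (fun x hx => hf.1 x hx) hf.2 ?_ hx₀ hx₁ htr
      (HasVal.le_congr (hasVal_rv hy₀.1) hv (hasVal_rv (hf.1 _ hx₀)) hv (real_eqv_symm he₀)
        (real_eqv_refl htr) h₀)
      (HasVal.le_congr hv (hasVal_rv hy₁.1) hv (hasVal_rv (hf.1 _ hx₁)) (real_eqv_refl htr)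
        (real_eqv_symm he₁) h₁)
    refine fun U hU hop => ⟨hU, fun x hx hUx => ?_⟩
    obtain ⟨k, hk⟩ := hop x hx hUx
    obtain ⟨m, hm⟩ := hcont x hx k
    refine ⟨m, fun y hy hxy => hk y hy ?_⟩
    obtain ⟨j, hj⟩ := ((hasVal_rv (hf.1 x hx)).close_iff (hasVal_rv (hf.1 y hy)) k).1 (hm y hy hxy)
    have := ep_pos j
    linarith
  obtain ⟨W, hW⟩ := exists_comp Y t
  have hW : ∀ x, W ⬝ x = Y ⬝ (t ⬝ x) := hW
  obtain ⟨r, r', hr, hr', hne, heq⟩ := hN W ⟨fun _ _ => trivial, fun r r' hr hr' h => by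
    show W ⬝ r = W ⬝ r'
    rw [hW, hW]
    exact hY.2 _ _ (ht r hr).1 (ht r' hr').1 ((htt r r' hr hr').2 h)⟩
  exact ⟨t ⬝ r, t ⬝ r', hmem r hr, hmem r' hr', fun h => hne ((htt r r' hr hr').1 h),
    by rw [← hW, ← hW]; exact heq⟩

end OfNIN

/-! ### The unit interval is connected -/

section UnitConnected

variable {M : Str.{u}} [Model M]

theorem rv_congr {x y : M.Car FinType.one} (h : M.seq x = M.seq y) : rv x = rv y := by
  rw [rv, rv, h]

theorem rv_ratObj (c : M.N) : rv (ratObj c) = (M.decode c).val := by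
  rw [rv, seq_ratObj]
  rfl

theorem unit_mem_ratObj {c : M.N} : (Dom.unit M).mem (ratObj c) ↔
    0 ≤ (M.decode c).val ∧ (M.decode c).val ≤ 1 := by
  rw [unit_mem_iff (isReal_ratObj c).1, rv_ratObj]
  constructor
  · intro h
    rw [← Frac.val_zero, ← Frac.val_one]
    refine ⟨Frac.le_of_forall_val fun n => ?_, Frac.le_of_forall_val fun n => ?_⟩
    · rw [Frac.val_zero]; exact (h n).1
    · rw [Frac.val_one]; exact (h n).2
  · intro h n
    have := ep_pos n
    constructor <;> linarith

theorem exists_ratObj_near {x : M.Car FinType.one} (hx : (Dom.unit M).mem x) (k : M.N) :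
    ∃ c : M.N, (Dom.unit M).mem (ratObj c) ∧ |rv x - rv (ratObj c)| ≤ ep k := by
  have h1 := (hasVal_rv hx.1).2 k
  have h2 := (unit_mem_iff hx.1).1 hx k
  simp only [rv_ratObj, unit_mem_ratObj]
  rcases lt_or_ge (M.seq x k).val 0 with h | h
  · refine ⟨M.codeFrac 0, ?_⟩
    rw [decode_codeFrac den_zero_pos, Frac.val_zero, abs_sub_le_iff]
    exact ⟨⟨le_rfl, zero_le_one⟩, by linarith, by linarith⟩
  rcases lt_or_ge 1 (M.seq x k).val with h' | h'
  · refine ⟨M.codeFrac 1, ?_⟩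
    rw [decode_codeFrac den_one_pos, Frac.val_one, abs_sub_le_iff]
    exact ⟨⟨zero_le_one, le_rfl⟩, by linarith, by linarith⟩
  · refine ⟨x ⬝ k, ⟨h, h'⟩, ?_⟩
    simp only [Str.seq] at h1
    rw [abs_sub_le_iff]
    constructor <;> linarith

/-- `U` contains, with any of its points in the unit interval, all points of the unit interval
nearby. -/
def UnitOpen (U : M.Car (FinType.one ⇾ .zero)) : Prop :=
  ∀ x, (Dom.unit M).mem x → U ⬝ x = 1 →
    ∃ k : M.N, ∀ y, (Dom.unit M).mem y → |rv x - rv y| ≤ ep k → U ⬝ y = 1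

/-- All rationals of the unit interval between those coded by `a` and `q` belong to `U`. -/
def Filled (U : M.Car (FinType.one ⇾ .zero)) (a : M.N) (q : Frac M) : Prop :=
  ∀ p : M.N, M.decode a ≤ M.decode p → M.decode p ≤ q → M.decode p ≤ 1 → U ⬝ ratObj p = 1

theorem Dec.filled {X : Type u} [Ctx M X] (U : M.Car (FinType.one ⇾ .zero)) (a : M.N)
    {F : X → Frac M} (hF : RepQ F) : Dec (M := M) (fun x => Filled U a (F x)) := by
  have h1 : RepQ (fun p : X × M.N => M.decode p.2) := RepQ.decode Rep.snd
  exact Dec.all (P := fun x p => M.decode a ≤ M.decode p → M.decode p ≤ F x → M.decode p ≤ 1 →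
      U ⬝ ratObj p = 1)
    (Dec.imp (Dec.qle (RepQ.const _) h1) (Dec.imp (Dec.qle h1
      ⟨Rep.fst hF.1, Rep.fst hF.2.1, Rep.fst hF.2.2⟩)
      (Dec.imp (Dec.qle h1 (RepQ.const 1))
        (Dec.eq (Rep.app (Rep.const U) (Rep.ratObj Rep.snd)) (Rep.const 1)))))

theorem filled_iff {U : M.Car (FinType.one ⇾ .zero)} {a : M.N} {q : Frac M} (hq : 0 < q.den) :
    Filled U a q ↔ ∀ p : M.N, (M.decode a).val ≤ (M.decode p).val →
      (M.decode p).val ≤ q.val → (M.decode p).val ≤ 1 → U ⬝ ratObj p = 1 := by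
  refine forall_congr' fun p => ?_
  rw [Frac.val_le (den_decode_pos a) (den_decode_pos p), Frac.val_le (den_decode_pos p) hq,
    Frac.val_le (den_decode_pos p) den_one_pos, Frac.val_one]

theorem Filled.mono {U : M.Car (FinType.one ⇾ .zero)} {a : M.N} {q r : Frac M} (hq : 0 < q.den)
    (hr : 0 < r.den) (h : q.val ≤ r.val) (hf : Filled U a r) : Filled U a q := by
  rw [filled_iff hr] at hf
  rw [filled_iff hq]
  exact fun p h1 h2 h3 => hf p h1 (h2.trans h) h3

/-- If `a` but not `b` belongs to the open set `U`, then up to any precision there is a rational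
near the supremum of those `q` for which the rationals from `a` to `q` lie in `U`. -/
theorem exists_filled_step {U : M.Car (FinType.one ⇾ .zero)} (hU : UnitOpen U) {a b : M.N}
    (ha : (Dom.unit M).mem (ratObj a)) (hUa : U ⬝ ratObj a = 1)
    (hb : (Dom.unit M).mem (ratObj b)) (hUb : ¬ U ⬝ ratObj b = 1)
    (hab : (M.decode a).val ≤ (M.decode b).val) (n : M.N) :
    ∃ c : M.N, M.decode a ≤ M.decode c ∧ Filled U a (M.decode c) ∧
      ¬ Filled U a (M.decode c + M.eps n) := by
  by_contra hc
  push Not at hc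
  -- otherwise all `a + i * 2 ^ (-n)` are filled by induction on `i`, and some exceed `b`
  let q : M.N → Frac M := fun i => M.decode a + ⟨i, 0, M.pow2 n⟩
  have hden : ∀ i : M.N, 0 < (⟨i, 0, M.pow2 n⟩ : Frac M).den := fun i => pow2_pos n
  have hqd : ∀ i, 0 < (q i).den := fun i => Frac.den_add_pos (den_decode_pos a) (hden i)
  have hqv : ∀ i, (q i).val = (M.decode a).val + Rat.toHyp (QField.ofNum i) * ep n := by
    intro i
    rw [Frac.val_add (den_decode_pos a) (hden i), ep, ← Rat.toHyp_mul, mul_one_div]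
    congr 1
    show Rat.toHyp ((QField.ofNum i - QField.ofNum 0) / QField.ofNum (M.pow2 n)) = _
    rw [map_zero, sub_zero]
  have hnum : ∀ i : M.N, (0 : Hyp M) ≤ Rat.toHyp (QField.ofNum i) := fun i => by
    rw [← Rat.toHyp_zero]; exact Rat.toHyp_le.2 (QField.ofNum_nonneg i)
  have key : ∀ i : M.N, Filled U a (q i) := by
    refine Dec.induction (Dec.filled U a (RepQ.add (RepQ.const _)
      ⟨Rep.id, Rep.const 0, Rep.const _⟩)) ?_ fun i hi => ?_
    · rw [filled_iff (hqd 0)]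
      intro p h1 h2 h3
      rw [hqv, map_zero, Rat.toHyp_zero, zero_mul, add_zero] at h2
      obtain ⟨k, hk⟩ := hU _ ha hUa
      refine hk _ (unit_mem_ratObj.2 ⟨(unit_mem_ratObj.1 ha).1.trans h1, h3⟩) ?_
      rw [rv_ratObj, rv_ratObj, le_antisymm h1 h2, sub_self, abs_zero]
      exact (ep_pos k).le
    · have hdec := decode_codeFrac (hqd i)
      have h1 := hc (M.codeFrac (q i))
      rw [hdec, Frac.val_le (den_decode_pos a) (hqd i), hqv] at h1
      have h2 := mul_nonneg (hnum i) (ep_pos n).le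
      refine Filled.mono (hqd _) (Frac.den_add_pos (hqd i) (den_eps_pos n)) ?_
        (h1 (by linarith) hi)
      rw [Frac.val_add (hqd i) (den_eps_pos n), val_eps, hqv, hqv, map_add, map_one,
        Rat.toHyp_add, Rat.toHyp_one]
      exact le_of_eq (by ring)
  have h1 := (filled_iff (hqd _)).1 (key (M.pow2 n)) b hab
  rw [hqv, ep, ← Rat.toHyp_mul, mul_one_div_cancel (QField.ofNum_pos (pow2_pos n)).ne',
    Rat.toHyp_one] at h1
  have ha' := unit_mem_ratObj.1 ha
  have hb' := unit_mem_ratObj.1 hb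
  exact hUb (h1 (by linarith) hb'.2)

/-- The core of the connectedness of the unit interval: the supremum of the initial segment of
`U` that starts at `a` can belong neither to `U` nor to `V`. -/
theorem unit_no_gap {U V : M.Car (FinType.one ⇾ .zero)} (hU : UnitOpen U) (hV : UnitOpen V)
    (hcov : ∀ x, (Dom.unit M).mem x → U ⬝ x = 1 ∨ V ⬝ x = 1)
    (hdisj : ∀ x, (Dom.unit M).mem x → U ⬝ x = 1 → V ⬝ x = 1 → False) {a b : M.N}
    (ha : (Dom.unit M).mem (ratObj a)) (hUa : U ⬝ ratObj a = 1)
    (hb : (Dom.unit M).mem (ratObj b)) (hVb : V ⬝ ratObj b = 1)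
    (hab : (M.decode a).val ≤ (M.decode b).val) : False := by
  have hUb : ¬ U ⬝ ratObj b = 1 := fun h => hdisj _ hb h hVb
  have ha' := unit_mem_ratObj.1 ha
  have hb' := unit_mem_ratObj.1 hb
  have hdec : Dec (M := M) (fun p : M.N × M.N => M.decode a ≤ M.decode p.2 ∧
      Filled U a (M.decode p.2) ∧ ¬ Filled U a (M.decode p.2 + M.eps (p.1 + 1))) := by
    have h1 : RepQ (fun p : M.N × M.N => M.decode p.2) := RepQ.decode Rep.snd
    exact Dec.and (Dec.qle (RepQ.const _) h1) (Dec.and (Dec.filled U a h1)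
      (Dec.not (Dec.filled U a (RepQ.add h1 (RepQ.eps (Rep.add Rep.id1 (Rep.const 1)))))))
  -- `s` is the supremum, given by approximations from below
  obtain ⟨F, ⟨s, hs⟩, hF⟩ := Rep.exists_least (P := fun n c : M.N => M.decode a ≤ M.decode c ∧
      Filled U a (M.decode c) ∧ ¬ Filled U a (M.decode c + M.eps (n + 1))) hdec
    (fun n => exists_filled_step hU ha hUa hb hUb hab (n + 1))
  have hs : ∀ n : M.N, s ⬝ n = F n := hs
  have hseq : ∀ n, M.seq s n = M.decode (F n) := fun n => by rw [Str.seq, hs]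
  have hge : ∀ n, (M.decode a).val ≤ (M.seq s n).val := fun n => by
    rw [hseq]; exact (Frac.val_le (den_decode_pos a) (den_decode_pos _)).1 (hF n).1.1
  have hfill : ∀ n, Filled U a (M.seq s n) := fun n => by rw [hseq]; exact (hF n).1.2.1
  have hnot : ∀ n, ¬ Filled U a (M.seq s n + M.eps (n + 1)) := fun n => by
    rw [hseq]; exact (hF n).1.2.2
  have hd := fun n => den_seq_pos s n
  have hd' := fun n => Frac.den_add_pos (den_seq_pos s n) (den_eps_pos (n + 1))
  have hv' : ∀ n, (M.seq s n + M.eps (n + 1)).val = (M.seq s n).val + ep (n + 1) := fun n => by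
    rw [Frac.val_add (hd n) (den_eps_pos _), val_eps]
  have hclose : ∀ n m, (M.seq s n).val ≤ (M.seq s m).val + ep (m + 1) := by
    intro n m
    by_contra hlt
    refine hnot m (Filled.mono (hd' m) (hd n) ?_ (hfill n))
    rw [hv']
    exact (not_le.1 hlt).le
  have hlt : ∀ n, (M.seq s n).val ≤ (M.decode b).val := by
    intro n
    by_contra hlt
    exact hUb ((filled_iff (hd n)).1 (hfill n) b hab (not_le.1 hlt).le hb'.2)
  have hreal : M.IsReal s := by
    rw [isReal_iff]
    intro n i
    have h1 := hclose n (n + i)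
    have h2 := hclose (n + i) n
    have h3 := ep_half n
    have h4 := ep_pos (n + 1)
    have h5 : ep (n + i + 1) ≤ ep (n + 1) := by
      apply ep_anti; gcongr; exact le_add_of_nonneg_right (zero_le_num i)
    constructor <;> linarith
  have hval := (hasVal_rv hreal).2
  have hsmem : (Dom.unit M).mem s := by
    rw [unit_mem_iff hreal]
    intro n
    have h1 := hval n
    have h2 := hge n
    have h3 := hlt n
    constructor <;> linarith
  rcases hcov s hsmem with hUs | hVs
  · obtain ⟨k, hk⟩ := hU s hsmem hUs
    refine hnot (k + 1) ((filled_iff (hd' _)).2 fun p h1 h2 h3 => ?_)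
    rcases le_or_gt (M.decode p).val (M.seq s (k + 1)).val with h4 | h4
    · exact (filled_iff (hd _)).1 (hfill _) p h1 h4 h3
    · refine hk _ (unit_mem_ratObj.2 ⟨ha'.1.trans h1, h3⟩) ?_
      rw [rv_ratObj, abs_sub_le_iff]
      rw [hv'] at h2
      have h5 := hval (k + 1)
      have h6 := ep_half k
      have h7 := ep_half (k + 1)
      have h8 := ep_pos (k + 1 + 1)
      constructor <;> linarith
  · obtain ⟨k, hk⟩ := hV s hsmem hVs
    have h1 : (Dom.unit M).mem (ratObj (F k)) := by
      rw [unit_mem_ratObj, ← hseq]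
      exact ⟨ha'.1.trans (hge k), (hlt k).trans hb'.2⟩
    have h2 : V ⬝ ratObj (F k) = 1 := by
      refine hk _ h1 ?_
      rw [rv_ratObj, ← hseq, abs_sub_le_iff]
      have := hval k
      constructor <;> linarith
    refine hdisj _ h1 ((filled_iff (hd k)).1 (hfill k) (F k) ?_ ?_ ?_) h2
    · rw [← hseq]; exact hge k
    · rw [← hseq]
    · rw [← hseq]; exact (hlt k).trans hb'.2

theorem unit_connected {D : Dom M FinType.one} (hD : ∀ x, D.mem x ↔ (Dom.unit M).mem x)
    {IsOpen : M.Car (FinType.one ⇾ .zero) → Prop} (hop : ∀ U, IsOpen U → UnitOpen U) :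
    D.Connected IsOpen := by
  rintro ⟨U, V, hU, hV, ⟨u, hu, hUu⟩, ⟨v, hv, hVv⟩, hcov, hdisj⟩
  simp only [hD] at hu hv hcov hdisj
  have hU := hop U hU
  have hV := hop V hV
  have hrat : ∀ W, UnitOpen W → ∀ w, (Dom.unit M).mem w → W ⬝ w = 1 →
      ∃ c : M.N, (Dom.unit M).mem (ratObj c) ∧ W ⬝ ratObj c = 1 := by
    intro W hW w hw hWw
    obtain ⟨k, hk⟩ := hW w hw hWw
    obtain ⟨c, hc, hwc⟩ := exists_ratObj_near hw k
    exact ⟨c, hc, hk _ hc hwc⟩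
  obtain ⟨a, ha, hUa⟩ := hrat U hU u hu hUu
  obtain ⟨b, hb, hVb⟩ := hrat V hV v hv hVv
  rcases le_total (M.decode a).val (M.decode b).val with h | h
  · exact unit_no_gap hU hV hcov (fun x hx h1 h2 => hdisj ⟨x, hx, h1, h2⟩) ha hUa hb hVb h
  · exact unit_no_gap hV hU (fun x hx => (hcov x hx).symm)
      (fun x hx h1 h2 => hdisj ⟨x, hx, h2, h1⟩) hb hVb ha hUa h

end UnitConnected

/-! ### The unit interval as a metric and as a second-countable space -/

section UnitSpaces

variable {M : Str.{u}} [Model M]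

theorem exists_unit_char (M : Str.{u}) [Model M] : ∃ I : M.Car (FinType.one ⇾ .zero), ∀ x,
    (I ⬝ x = 0 ∨ I ⬝ x = 1) ∧ (I ⬝ x = 1 ↔ (Dom.unit M).mem x) :=
  (Dec.unit_mem Rep.id).exists_char

/-- `d` is the distance function of the reals. -/
def IsDist (d : M.Car (FinType.one ⇾ FinType.one ⇾ FinType.one)) : Prop :=
  ∀ x y, M.IsReal x → M.IsReal y → M.IsReal (d ⬝ x ⬝ y) ∧ HasVal (M.seq (d ⬝ x ⬝ y)) |rv x - rv y|

variable {d : M.Car (FinType.one ⇾ FinType.one ⇾ FinType.one)}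

theorem IsDist.eqv_zero_iff (hd : IsDist d) {x y : M.Car FinType.one} (hx : M.IsReal x)
    (hy : M.IsReal y) :
    FSeq.Eqv (M.seq (d ⬝ x ⬝ y)) (FSeq.const 0) ↔ FSeq.Eqv (M.seq x) (M.seq y) := by
  rw [(hd x y hx hy).2.eqv_iff HasVal.const_zero, (hasVal_rv hx).eqv_iff (hasVal_rv hy)]
  simp only [sub_zero, abs_abs]

theorem IsDist.isMetric (hd : IsDist d) {D : Dom M FinType.one} (hD : ∀ x, D.mem x → M.IsReal x)
    (he : ∀ x y, D.mem x → D.mem y → (D.eqv x y ↔ FSeq.Eqv (M.seq x) (M.seq y))) :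
    D.IsMetric d where
  real x y hx hy := (hd x y (hD x hx) (hD y hy)).1
  congr x x' y y' hx hx' hy hy' h h' := by
    have h1 := ((hasVal_rv (hD x hx)).eqv_iff (hasVal_rv (hD x' hx'))).1 ((he x x' hx hx').1 h)
    have h2 := ((hasVal_rv (hD y hy)).eqv_iff (hasVal_rv (hD y' hy'))).1 ((he y y' hy hy').1 h')
    refine hasVal_of_eqv (hd x y (hD x hx) (hD y hy)).2 (hd x' y' (hD x' hx') (hD y' hy')).2
      fun n => ?_
    refine (abs_abs_sub_abs_le_abs_sub _ _).trans ?_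
    have h3 := abs_sub_le_iff.1 (h1 (n + 1))
    have h4 := abs_sub_le_iff.1 (h2 (n + 1))
    have h5 := ep_half n
    rw [abs_sub_le_iff]
    constructor <;> linarith
  nonneg x y hx hy := (HasVal.const_zero.le_iff (hd x y (hD x hx) (hD y hy)).2).2 fun n =>
    add_nonneg (abs_nonneg _) (ep_pos n).le
  eq_zero x y hx hy := (hd.eqv_zero_iff (hD x hx) (hD y hy)).trans (he x y hx hy).symm
  symm x y hx hy := hasVal_of_eqv (hd x y (hD x hx) (hD y hy)).2 (hd y x (hD y hy) (hD x hx)).2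
    fun n => by rw [abs_sub_comm (rv x), sub_self, abs_zero]; exact (ep_pos n).le
  triangle x y z hx hy hz := by
    rw [(hd x z (hD x hx) (hD z hz)).2.le_iff ((hd x y (hD x hx) (hD y hy)).2.add
      (hd y z (hD y hy) (hD z hz)).2)]
    intro n
    have := abs_sub_le (rv x) (rv y) (rv z)
    have := ep_pos n
    linarith

theorem IsDist.near_iff (hd : IsDist d) {x y : M.Car FinType.one} (hx : M.IsReal x)
    (hy : M.IsReal y) (k : M.N) : Dom.Near d x y k ↔ ∃ j, |rv x - rv y| + ep j < ep k :=
  (hd x y hx hy).2.lt_iff (HasVal.const_eps k)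

theorem IsDist.near_of_le (hd : IsDist d) {x y : M.Car FinType.one} (hx : M.IsReal x)
    (hy : M.IsReal y) {k : M.N} (h : |rv x - rv y| ≤ ep (k + 1)) : Dom.Near d x y k := by
  rw [hd.near_iff hx hy]
  have h1 := ep_half k
  have h2 := ep_half (k + 1)
  have h3 := ep_pos (k + 1 + 1)
  exact ⟨k + 1 + 1, by linarith⟩

theorem IsDist.unit_metricConnected (hd : IsDist d) {D : Dom M FinType.one}
    (hD : ∀ x, D.mem x ↔ (Dom.unit M).mem x) : D.MetricConnected d := by
  refine unit_connected hD fun U hU x hx hUx => ?_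
  obtain ⟨k, hk⟩ := hU.2 x ((hD x).2 hx) hUx
  exact ⟨k + 1, fun y hy hxy => hk y ((hD y).2 hy) (hd.near_of_le hx.1 hy.1 hxy)⟩

theorem unit_twoPoints {D : Dom M FinType.one} (hD : ∀ x, D.mem x ↔ (Dom.unit M).mem x)
    (he : ∀ x y, D.mem x → D.mem y → D.eqv x y → FSeq.Eqv (M.seq x) (M.seq y)) : D.TwoPoints := by
  have h0 : D.mem (ratObj (M.codeFrac 0)) := by
    rw [hD, unit_mem_ratObj, decode_codeFrac den_zero_pos, Frac.val_zero]
    exact ⟨le_rfl, zero_le_one⟩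
  have h1 : D.mem (ratObj (M.codeFrac 1)) := by
    rw [hD, unit_mem_ratObj, decode_codeFrac den_one_pos, Frac.val_one]
    exact ⟨zero_le_one, le_rfl⟩
  refine ⟨_, _, h0, h1, fun h => ?_⟩
  have h2 := ((isReal_ratObj _).2.eqv_iff (isReal_ratObj _).2).1 (he _ _ h0 h1 h) (0 + 1)
  rw [decode_codeFrac den_zero_pos, decode_codeFrac den_one_pos, Frac.val_zero, Frac.val_one,
    zero_sub, abs_neg, abs_one] at h2
  have h3 := ep_half (0 : M.N)
  rw [ep_zero] at h3
  linarith

/-- The sets `B n` are the open intervals with rational end points. -/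
theorem exists_interval_basis (M : Str.{u}) [Model M] :
    ∃ B : M.Car (FinType.zero ⇾ FinType.one ⇾ .zero),
    (∀ n x, B ⬝ n ⬝ x = 0 ∨ B ⬝ n ⬝ x = 1) ∧
    (∀ x, M.IsReal x → ∀ n, B ⬝ n ⬝ x = 1 →
      ∃ k, ∀ y, M.IsReal y → |rv x - rv y| ≤ ep k → B ⬝ n ⬝ y = 1) ∧
    ∀ x, M.IsReal x → ∀ k, ∃ n, B ⬝ n ⬝ x = 1 ∧
      ∀ y, M.IsReal y → B ⬝ n ⬝ y = 1 → |rv x - rv y| ≤ ep k := by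
  -- a number that codes a fraction is read as the pair of codes given by its first two components
  let l : M.N → Frac M := fun n => M.decode (M.decode n).pos
  let r : M.N → Frac M := fun n => M.decode (M.decode n).neg
  have hl : RepQ (fun p : M.N × M.Car FinType.one => l p.1) :=
    RepQ.decode (RepQ.decode (X := M.N × M.Car FinType.one) Rep.id1).1
  have hr : RepQ (fun p : M.N × M.Car FinType.one => r p.1) :=
    RepQ.decode (RepQ.decode (X := M.N × M.Car FinType.one) Rep.id1).2.1
  obtain ⟨B, hB⟩ := Dec.exists_rel (P := fun (n : M.N) (x : M.Car FinType.one) =>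
      FSeq.Lt (FSeq.const (l n)) (M.seq x) ∧ FSeq.Lt (M.seq x) (FSeq.const (r n)))
    (Dec.and (Dec.slt (RepS.const hl) (RepS.seq Rep.snd))
      (Dec.slt (RepS.seq Rep.snd) (RepS.const hr)))
  have hBv : ∀ n x, M.IsReal x → (B ⬝ n ⬝ x = 1 ↔
      (∃ k, (l n).val + ep k < rv x) ∧ ∃ k, rv x + ep k < (r n).val) := fun n x hx => by
    rw [(hB n x).2, (HasVal.const (den_decode_pos _)).lt_iff (hasVal_rv hx),
      (hasVal_rv hx).lt_iff (HasVal.const (den_decode_pos _))]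
  refine ⟨B, fun n x => (hB n x).1, fun x hx n hn => ?_, fun x hx k => ?_⟩
  · obtain ⟨⟨i, hi⟩, j, hj⟩ := (hBv n x hx).1 hn
    have h1 := ep_anti (le_add_of_nonneg_right (zero_le_num j) : i ≤ i + j)
    have h2 := ep_anti (le_add_of_nonneg_left (zero_le_num i) : j ≤ i + j)
    have h3 := ep_half (i + j)
    refine ⟨i + j + 1, fun y hy hxy => (hBv n y hy).2 ⟨⟨i + j + 1, ?_⟩, i + j + 1, ?_⟩⟩ <;>
      rw [abs_sub_le_iff] at hxy <;> linarith
  · let q : Frac M := M.seq x (k + 1 + 1)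
    have hq : 0 < q.den := den_seq_pos _ _
    have he := den_eps_pos (k + 1)
    let n : M.N := M.codeFrac ⟨M.codeFrac (q.sub (M.eps (k + 1))),
      M.codeFrac (q + M.eps (k + 1)), 1⟩
    have hn : M.decode n = ⟨M.codeFrac (q.sub (M.eps (k + 1))),
      M.codeFrac (q + M.eps (k + 1)), 1⟩ := decode_codeFrac (zero_lt_one : (0 : M.N) < 1)
    have hln : (l n).val = q.val - ep (k + 1) := by
      simp only [l, hn]
      rw [decode_codeFrac (q := q.sub _) (mul_pos hq he), Frac.val_sub hq he, val_eps]
    have hrn : (r n).val = q.val + ep (k + 1) := by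
      simp only [r, hn]
      rw [decode_codeFrac (Frac.den_add_pos hq he), Frac.val_add hq he, val_eps]
    have h1 := (hasVal_rv hx).2 (k + 1 + 1)
    have h2 := ep_half k
    have h3 := ep_half (k + 1)
    have h4 := ep_half (k + 1 + 1)
    have h5 := ep_pos (k + 1 + 1 + 1)
    refine ⟨n, (hBv n x hx).2 ⟨⟨k + 1 + 1 + 1, ?_⟩, k + 1 + 1 + 1, ?_⟩, fun y hy hny => ?_⟩
    · rw [hln]; linarith
    · rw [hrn]; linarith
    · obtain ⟨⟨i, hi⟩, j, hj⟩ := (hBv n y hy).1 hny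
      rw [hln] at hi
      rw [hrn] at hj
      have := ep_pos i
      have := ep_pos j
      rw [abs_sub_le_iff]
      constructor <;> linarith

theorem unit_isSubset {D : Dom M FinType.one} {I : M.Car (FinType.one ⇾ .zero)}
    (hI : ∀ x, (I ⬝ x = 0 ∨ I ⬝ x = 1) ∧ (I ⬝ x = 1 ↔ (Dom.unit M).mem x))
    (hD : ∀ x, D.mem x → M.IsReal x)
    (he : ∀ x y, D.mem x → D.mem y → D.eqv x y → FSeq.Eqv (M.seq x) (M.seq y)) :
    D.IsSubset I := by
  refine Dom.isSubset_of_char hI fun x y hx hy h => ?_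
  have := he x y hx hy h
  exact ⟨fun h1 => unit_mem_congr h1 (hD y hy) (real_eqv_symm this),
    fun h1 => unit_mem_congr h1 (hD x hx) this⟩

end UnitSpaces

/-! ### The principles imply `NIN` -/

section ToNIN

variable {M : Str.{u}} [Model M]

theorem real_sub_unit_mem {I : M.Car (FinType.one ⇾ .zero)}
    (hI : ∀ x, (I ⬝ x = 0 ∨ I ⬝ x = 1) ∧ (I ⬝ x = 1 ↔ (Dom.unit M).mem x))
    (x : M.Car FinType.one) : ((Dom.real M).sub I).mem x ↔ (Dom.unit M).mem x :=
  ⟨fun h => (hI x).2.1 h.2, fun h => ⟨h.1, (hI x).2.2 h⟩⟩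

/-- Functions from the unit interval to the numbers extend to the reals. -/
theorem exists_extension {Y : M.Car (FinType.one ⇾ .zero)}
    (hY : (Dom.unit M).IsMap (Dom.nat M) Y) : ∃ Z : M.Car (FinType.one ⇾ .zero),
    (Dom.real M).IsMap (Dom.nat M) Z ∧ ∀ x, (Dom.unit M).mem x → Z ⬝ x = Y ⬝ x := by
  classical
  obtain ⟨Z, hZ⟩ := Rep.ite (X := M.Car FinType.one) (Dec.unit_mem Rep.id)
    (Rep.app (Rep.const Y) Rep.id) (Rep.const 0)
  have hZ : ∀ x, Z ⬝ x = if (Dom.unit M).mem x then Y ⬝ x else 0 := hZ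
  refine ⟨Z, ⟨fun _ _ => trivial, fun x y hx hy h => ?_⟩, fun x hx => by rw [hZ, if_pos hx]⟩
  show Z ⬝ x = Z ⬝ y
  have hiff : (Dom.unit M).mem x ↔ (Dom.unit M).mem y :=
    ⟨fun h1 => unit_mem_congr h1 hy (real_eqv_symm h), fun h1 => unit_mem_congr h1 hx h⟩
  rw [hZ, hZ]
  by_cases hxu : (Dom.unit M).mem x
  · rw [if_pos hxu, if_pos (hiff.1 hxu)]
    exact hY.2 x y hxu (hiff.1 hxu) h
  · rw [if_neg hxu, if_neg (mt hiff.2 hxu)]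

/-- `NIN` holds if some copy of the unit interval, inside a collection of reals, is uncountable. -/
theorem NIN.of_uncountableIn {D A : Dom M FinType.one} (hD : ∀ x, D.mem x → M.IsReal x)
    (he : ∀ x y, D.mem x → D.mem y → (D.eqv x y ↔ FSeq.Eqv (M.seq x) (M.seq y)))
    (hA : ∀ x, A.mem x → (Dom.unit M).mem x) (hAD : ∀ x, A.mem x → D.mem x)
    (h : D.UncountableIn A) : NIN M := by
  intro Y hY
  obtain ⟨Z, hZ, hZY⟩ := exists_extension hY
  obtain ⟨x, y, hx, hy, hne, hxy⟩ := h Z ⟨fun _ _ => trivial, fun x y hx hy h =>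
    hZ.2 x y (hD x hx) (hD y hy) ((he x y hx hy).1 h)⟩
  refine ⟨x, y, hA x hx, hA y hy, fun h => hne ((he x y (hAD x hx) (hAD y hy)).2 h), ?_⟩
  rw [← hZY x (hA x hx), ← hZY y (hA y hy), hxy]

theorem SurjectsOntoUnit.nin (h : SurjectsOntoUnit M) : NIN M := by
  obtain ⟨I, hI⟩ := exists_unit_char M
  obtain ⟨i, hi⟩ := exists_id (M := M) FinType.one
  have hseq : ∀ x, M.seq (i ⬝ x) = M.seq x := fun x => seq_congr (hi x)
  have hmem := real_sub_unit_mem hI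
  refine NIN.of_uncountableIn (fun _ hx => hx) (fun _ _ _ _ => Iff.rfl)
    (fun x hx => (hmem x).1 hx) (fun x hx => hx.1)
    (h I i (unit_isSubset hI (fun _ hx => hx) fun _ _ _ _ h => h)
      ⟨fun x hx => ?_, fun x y _ _ hxy => ?_⟩ fun y hy => ⟨y, (hmem y).2 hy, ?_⟩)
  · have hx' := (hmem x).1 hx
    have hr : M.IsReal (i ⬝ x) := (isReal_congr (hseq x)).2 hx.1
    exact unit_mem_congr hx' hr (by rw [hseq]; exact real_eqv_refl hx.1)
  · show FSeq.Eqv _ _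
    rw [hseq, hseq]; exact hxy
  · show FSeq.Eqv _ _
    rw [hseq]; exact real_eqv_refl hy.1

/-- The unit interval as a metric space. -/
theorem exists_unit_realMetric (M : Str.{u}) [Model M] :
    ∃ (I : M.Car (FinType.one ⇾ .zero)) (d : M.Car (FinType.one ⇾ FinType.one ⇾ FinType.one)),
    (∀ x, (I ⬝ x = 0 ∨ I ⬝ x = 1) ∧ (I ⬝ x = 1 ↔ (Dom.unit M).mem x)) ∧ IsDist d ∧
    Dom.realMetric I d ∧ ((Dom.real M).sub I).MetricConnected d ∧
    ((Dom.real M).sub I).TwoPoints := by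
  obtain ⟨I, hI⟩ := exists_unit_char M
  obtain ⟨d, hd⟩ := exists_dist M
  have hd : IsDist d := hd
  exact ⟨I, d, hI, hd, ⟨unit_isSubset hI (fun _ hx => hx) fun _ _ _ _ h => h,
    hd.isMetric (fun x hx => hx.1) fun _ _ _ _ => Iff.rfl⟩,
    hd.unit_metricConnected (real_sub_unit_mem hI),
    unit_twoPoints (real_sub_unit_mem hI) fun _ _ _ _ h => h⟩

theorem ConnectedSubset.nin (h : ConnectedSubset M) : NIN M := by
  obtain ⟨I, d, hI, hd, hId, -, -⟩ := exists_unit_realMetric M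
  have hmem : ∀ x, (((Dom.real M).sub I).sub I).mem x ↔ (Dom.unit M).mem x := fun x =>
    ⟨fun h => (hI x).2.1 h.2, fun h => ⟨(real_sub_unit_mem hI x).2 h, (hI x).2.2 h⟩⟩
  exact NIN.of_uncountableIn (D := (Dom.real M).sub I) (fun _ hx => hx.1) (fun _ _ _ _ => Iff.rfl)
    (fun x hx => (hmem x).1 hx) (fun x hx => hx.1)
    (h I I d hId (unit_isSubset hI (fun _ hx => hx.1) fun _ _ _ _ h => h)
      (hd.unit_metricConnected hmem) (unit_twoPoints hmem fun _ _ _ _ h => h))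

theorem RealImage.nin (h : RealImage M) : NIN M := by
  obtain ⟨I, d, hI, hd, hId, hconn, h2⟩ := exists_unit_realMetric M
  obtain ⟨i, hi⟩ := exists_id (M := M) FinType.one
  have hseq : ∀ x, M.seq (i ⬝ x) = M.seq x := fun x => seq_congr (hi x)
  have hmem := real_sub_unit_mem hI
  refine NIN.of_uncountableIn (fun _ hx => hx) (fun _ _ _ _ => Iff.rfl)
    (fun x hx => (hmem x).1 hx) (fun x hx => hx.1)
    (h I d i I hId hconn ⟨fun x hx => (isReal_congr (hseq x)).2 hx.1, fun x y _ _ hxy => ?_⟩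
      (fun x hx k => ⟨k, fun y hy hxy => ?_⟩)
      ⟨unit_isSubset hI (fun _ hx => hx) fun _ _ _ _ h => h, fun y hy => ⟨fun h => ?_, ?_⟩⟩ h2)
  · show FSeq.Eqv _ _
    rw [hseq, hseq]; exact hxy
  · rw [hseq, hseq, (hasVal_rv hx.1).close_iff (hasVal_rv hy.1)]
    exact (hd.near_iff hx.1 hy.1 k).1 hxy
  · refine ⟨y, ⟨hy, h⟩, ?_⟩
    show FSeq.Eqv _ _
    rw [hseq]; exact real_eqv_refl hy
  · rintro ⟨x, hx, hxy⟩
    have hxy : FSeq.Eqv (M.seq (i ⬝ x)) (M.seq y) := hxy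
    rw [hseq] at hxy
    exact (hI y).2.2 (unit_mem_congr ((hmem x).1 hx) hy (real_eqv_symm hxy))

theorem MetricImage.nin (h : MetricImage M) : NIN M := by
  obtain ⟨I, d, hI, hd, hId, hconn, h2⟩ := exists_unit_realMetric M
  obtain ⟨i, hi⟩ := exists_id (M := M) FinType.one
  have hseq : ∀ x, M.seq (i ⬝ x) = M.seq x := fun x => seq_congr (hi x)
  have hmem := real_sub_unit_mem hI
  have hreal : ∀ x, (Dom.ofMetric I d).mem x → M.IsReal x := fun x hx => ((hI x).2.1 hx).1
  have he : ∀ x y, (Dom.ofMetric I d).mem x → (Dom.ofMetric I d).mem y →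
      ((Dom.ofMetric I d).eqv x y ↔ FSeq.Eqv (M.seq x) (M.seq y)) := fun x y hx hy =>
    hd.eqv_zero_iff (hreal x hx) (hreal y hy)
  have himem : ∀ x, ((Dom.real M).sub I).mem x → (Dom.ofMetric I d).mem (i ⬝ x) := by
    intro x hx
    have : I ⬝ (i ⬝ x) = I ⬝ x := (rca M).ext _ _ I _ _ (hi x)
    exact this.trans hx.2
  refine NIN.of_uncountableIn (A := (Dom.ofMetric I d).sub I) hreal he (fun x hx => (hI x).2.1 hx.1) (fun x hx => hx.1)
    (h FinType.one I d I d i I hId hconn ⟨fun x => (hI x).1, hd.isMetric hreal he⟩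
      ⟨himem, fun x y hx hy hxy => ?_⟩ (fun x hx k => ⟨k, fun y hy hxy => ?_⟩)
      ⟨unit_isSubset hI hreal fun x y hx hy => (he x y hx hy).1,
        fun y hy => ⟨fun _ => ⟨y, (hmem y).2 ((hI y).2.1 hy), ?_⟩, fun _ => hy⟩⟩
      (unit_twoPoints (fun x => ⟨fun hx => (hI x).2.1 hx.1,
        fun hx => ⟨(hI x).2.2 hx, (hI x).2.2 hx⟩⟩) fun x y hx hy => (he x y hx.1 hy.1).1))
  · rw [he _ _ (himem x hx) (himem y hy), hseq, hseq]; exact hxy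
  · rw [hd.near_iff (hreal _ (himem x hx)) (hreal _ (himem y hy)), rv_congr (hseq x),
      rv_congr (hseq y)]
    exact (hd.near_iff hx.1 hy.1 k).1 hxy
  · rw [he _ _ (himem y ((hmem y).2 ((hI y).2.1 hy))) hy, hseq]
    exact real_eqv_refl (hreal y hy)

theorem SurjectsOntoConnected.nin (h : SurjectsOntoConnected M) : NIN M := by
  obtain ⟨I, d, hI, hd, hId, hconn, h2⟩ := exists_unit_realMetric M
  obtain ⟨i, hi⟩ := exists_id (M := M) FinType.one
  have hseq : ∀ x, M.seq (i ⬝ x) = M.seq x := fun x => seq_congr (hi x)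
  have hmem := real_sub_unit_mem hI
  refine NIN.of_uncountableIn (D := (Dom.real M).sub I) (fun _ hx => hx.1) (fun _ _ _ _ => Iff.rfl)
    (fun x hx => (hmem x).1 hx) (fun x hx => hx)
    (h I I d d i hId hId h2 hconn ⟨fun x hx => ⟨(isReal_congr (hseq x)).2 hx.1, ?_⟩,
      fun x y hx hy hxy => ?_⟩ fun y hy => ⟨y, hy, ?_⟩)
  · have : I ⬝ (i ⬝ x) = I ⬝ x := (rca M).ext _ _ I _ _ (hi x)
    exact this.trans hx.2
  · show FSeq.Eqv _ _
    rw [hseq, hseq]; exact hxy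
  · show FSeq.Eqv _ _
    rw [hseq]; exact real_eqv_refl hy.1

theorem unit_functionallyHausdorff {D : Dom M FinType.one} (hD : ∀ x, D.mem x → M.IsReal x)
    (he : ∀ x y, D.mem x → D.mem y → (D.eqv x y ↔ FSeq.Eqv (M.seq x) (M.seq y)))
    {B : M.Car (FinType.zero ⇾ FinType.one ⇾ .zero)}
    (hB : ∀ x, M.IsReal x → ∀ k, ∃ n, B ⬝ n ⬝ x = 1 ∧
      ∀ y, M.IsReal y → B ⬝ n ⬝ y = 1 → |rv x - rv y| ≤ ep k) : D.FunctionallyHausdorff B := by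
  intro x y hx hy hne
  obtain ⟨d, hd⟩ := exists_dist M
  rw [he x y hx hy, not_eqv_iff (hasVal_rv (hD x hx)) (hasVal_rv (hD y hy))] at hne
  obtain ⟨n, hn⟩ := hne
  obtain ⟨t, ht⟩ := exists_trunc (M := M) n
  obtain ⟨h, hh⟩ := exists_comp t (d ⬝ x)
  have hseq : ∀ z, M.seq (h ⬝ z) = M.seq (t ⬝ (d ⬝ x ⬝ z)) := fun z => seq_congr (hh z)
  have hval : ∀ z, D.mem z → M.IsReal (h ⬝ z) ∧
      HasVal (M.seq (h ⬝ z)) (min 1 (|rv x - rv z| / ep n)) := fun z hz => by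
    have := ht _ _ (hd x z (hD x hx) (hD z hz)).2
    exact ⟨(isReal_congr (hseq z)).2 this.1, by rw [hseq]; exact this.2⟩
  have hlip : ∀ z w k, |rv z - rv w| ≤ ep (n + k) →
      |min 1 (|rv x - rv z| / ep n) - min 1 (|rv x - rv w| / ep n)| ≤ ep k := by
    intro z w k hk
    refine (abs_min_sub_min_le_max _ _ _ _).trans ?_
    rw [sub_self, abs_zero, max_eq_right (abs_nonneg _), ← sub_div, abs_div, abs_of_pos (ep_pos n),
      div_le_iff₀ (ep_pos n), mul_comm, ← ep_add]
    refine (abs_abs_sub_abs_le_abs_sub _ _).trans ?_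
    rwa [sub_sub_sub_cancel_left, abs_sub_comm]
  refine ⟨h, ⟨fun z hz => ⟨(hval z hz).1, ?_, ?_⟩, fun z w hz hw hzw => ?_⟩, fun z hz k => ?_,
    ?_, ?_⟩
  · rw [HasVal.const_zero.le_iff (hval z hz).2]
    intro m
    exact add_nonneg (le_min zero_le_one (div_nonneg (abs_nonneg _) (ep_pos n).le)) (ep_pos m).le
  · rw [(hval z hz).2.le_iff HasVal.const_one]
    intro m
    exact (min_le_left _ _).trans (le_add_of_nonneg_right (ep_pos m).le)
  · refine hasVal_of_eqv (hval z hz).2 (hval w hw).2 fun k => hlip z w k ?_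
    exact ((hasVal_rv (hD z hz)).eqv_iff (hasVal_rv (hD w hw))).1 ((he z w hz hw).1 hzw) _
  · obtain ⟨j, hj, hj'⟩ := hB z (hD z hz) (n + (k + 1))
    refine ⟨j, hj, fun w hw hjw => ?_⟩
    rw [(hval z hz).2.close_iff (hval w hw).2]
    have h1 := hlip z w (k + 1) (hj' w (hD w hw) hjw)
    have h2 := ep_half k
    have h3 := ep_half (k + 1)
    have h4 := ep_pos (k + 1 + 1)
    exact ⟨k + 1 + 1, by linarith⟩
  · refine hasVal_of_eqv (hval x hx).2 HasVal.const_zero fun k => ?_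
    rw [sub_self, abs_zero, zero_div, min_eq_right zero_le_one, sub_zero, abs_zero]
    exact (ep_pos k).le
  · refine hasVal_of_eqv (hval y hy).2 HasVal.const_one fun k => ?_
    rw [min_eq_left ((one_le_div₀ (ep_pos n)).2 hn.le), sub_self, abs_zero]
    exact (ep_pos k).le

theorem SecondCountable.nin (h : SecondCountable M) : NIN M := by
  obtain ⟨I, hI⟩ := exists_unit_char M
  obtain ⟨B, hB01, hBopen, hBsmall⟩ := exists_interval_basis M
  have hmem := real_sub_unit_mem hI
  refine NIN.of_uncountableIn (D := (Dom.real M).sub I) (fun _ hx => hx.1) (fun _ _ _ _ => Iff.rfl)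
    (fun x hx => (hmem x).1 hx) (fun x hx => hx)
    (h I B (unit_isSubset hI (fun _ hx => hx) fun _ _ _ _ h => h) ⟨fun n => ?_, fun x hx => ?_,
      fun x hx m n hm hn => ?_⟩ (unit_connected hmem fun U hU x hx hUx => ?_)
      (unit_functionallyHausdorff (D := (Dom.real M).sub I) (fun _ hx => hx.1) (fun _ _ _ _ => Iff.rfl) hBsmall)
      (unit_twoPoints hmem fun _ _ _ _ h => h))
  · refine Dom.isSubset_of_char (fun x => ⟨hB01 n x, Iff.rfl⟩) fun x y hx hy hxy => ?_
    have hv := ((hasVal_rv hx.1).eqv_iff (hasVal_rv hy.1)).1 hxy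
    constructor
    · intro h1
      obtain ⟨k, hk⟩ := hBopen x hx.1 n h1
      exact hk y hy.1 (hv k)
    · intro h1
      obtain ⟨k, hk⟩ := hBopen y hy.1 n h1
      exact hk x hx.1 (by rw [abs_sub_comm]; exact hv k)
  · obtain ⟨n, hn, -⟩ := hBsmall x hx.1 0
    exact ⟨n, hn⟩
  · obtain ⟨i, hi⟩ := hBopen x hx.1 m hm
    obtain ⟨j, hj⟩ := hBopen x hx.1 n hn
    obtain ⟨k, hk, hk'⟩ := hBsmall x hx.1 (i + j)
    refine ⟨k, hk, fun y hy hky => ?_⟩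
    have h1 := hk' y hy.1 hky
    exact ⟨hi y hy.1 (h1.trans (ep_anti (le_add_of_nonneg_right (zero_le_num j)))),
      hj y hy.1 (h1.trans (ep_anti (le_add_of_nonneg_left (zero_le_num i))))⟩
  · obtain ⟨n, hn, hn'⟩ := hU.2 x ((hmem x).2 hx) hUx
    obtain ⟨k, hk⟩ := hBopen x hx.1 n hn
    exact ⟨k, fun y hy hxy => hn' y ((hmem y).2 hy) (hk y hy.1 hxy)⟩

end ToNIN

end HOA

theorem theorem3p1 :
    (∀ M : HOA.Str.{u}, M.ACA → M.QFAC HOA.FinType.one HOA.FinType.one →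
      List.TFAE
        [HOA.NIN M,
         HOA.SurjectsOntoUnit M,
         HOA.ConnectedSubset M,
         HOA.RealImage M,
         HOA.MetricImage M,
         HOA.SurjectsOntoConnected M,
         HOA.SecondCountable M]) ∧
    (∀ M : HOA.Str.{u}, M.ACA → (HOA.NIN M ↔ HOA.RealImage M)) := by
  refine ⟨fun M hM hac => ?_, fun M hM => ?_⟩
  · have : HOA.Model M := ⟨hM⟩
    tfae_have 1 → 2 := fun h => h.surjectsOntoUnit hac
    tfae_have 2 → 1 := fun h => h.nin
    tfae_have 1 → 3 := fun h => h.connectedSubset hac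
    tfae_have 3 → 1 := fun h => h.nin
    tfae_have 1 → 4 := fun h => h.realImage
    tfae_have 4 → 1 := fun h => h.nin
    tfae_have 1 → 5 := fun h => h.metricImage hac
    tfae_have 5 → 1 := fun h => h.nin
    tfae_have 1 → 6 := fun h => h.surjectsOntoConnected hac
    tfae_have 6 → 1 := fun h => h.nin
    tfae_have 1 → 7 := fun h => h.secondCountable hac
    tfae_have 7 → 1 := fun h => h.nin
    tfae_finish
  · have : HOA.Model M := ⟨hM⟩
    exact ⟨fun h => h.realImage, fun h => h.nin⟩
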